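/- Let $N\ge 5$, $2<p<2+\frac4N$, $4^*=\frac{2N}{N-4}$ and $\gamma_p=\frac N2\bigl(\frac12-\frac1p\bigr)$. Let $H^2(\mathbb R^N)$ be the space of real $u\in L^2(\mathbb R^N)$ with weak derivatives $\nabla u,\Delta u\in L^2(\mathbb R^N)$, with norm $\|u\|_{H^2}^2=\|\Delta u\|_2^2+\|\nabla u\|_2^2+\|u\|_2^2$, and let $H^2_r(\mathbb R^N)$ be its subspace of radially symmetric functions. For $\mu>0$ put $$I(u)=\tfrac12\|\Delta u\|_2^2+\tfrac12\|\nabla u\|_2^2-\tfrac{\mu}{p}\int_{\mathbb R^N}|u|^p\,dx-\tfrac1{4^*}\int_{\mathbb R^N}|u|^{4^*}dx,\qquad u\in H^2(\mathbb R^N).$$ Let $C_{N,p}$ be the best constant in $\|u\|_p\le C\|\Delta u\|_2^{\gamma_p}\|u\|_2^{1-\gamma_p}$ on $H^2(\mathbb R^N)$, let $S=\inf_{u\in H^2(\mathbb R^N)\setminus\{0\}}\|\Delta u\|_2^2/\|u\|_{4^*}^2$, and set $$\mathcal E=\tfrac{4^*-p\gamma_p}{2-p\gamma_p}\Bigl(\tfrac{(2-p\gamma_p)\mu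 C_{N,p}^p}{(4^*-2)p}\Bigr)^{\frac{4^*-2}{4^*-p\gamma_p}}\bigl(4^*S^{\frac{4^*}2}\bigr)^{\frac{p\gamma_p-2}{4^*-p\gamma_p}},\qquad c_*=c_*(\mu)=\Bigl(\tfrac1{2\mathcal E}\Bigr)^{\frac{2(4^*-p\gamma_p)}{p(1-\gamma_p)(4^*-2)}},$$ $$r_*=\Bigl(\tfrac{(2-p\gamma_p)\mu 4^*S^{4^*/2}C_{N,p}^p\,c_*^{p(1-\gamma_p)/2}}{(4^*-2)p}\Bigr)^{\frac1{4^*-p\gamma_p}},\qquad V_r(c)=\bigl\{u\in H^2_r(\mathbb R^N):\|u\|_2^2=c,\ \|\Delta u\|_2^2+\|\nabla u\|_2^2<r_*^2\bigr\}.$$ A critical point of $I|_{V_r(c)}$ is a $u\in V_r(c)$ such that $I'(u)v=0$ for all $v\in H^2_r(\mathbb R^N)$ with $\int uv\,dx=0$; its Lagrange multiplier is the $\lambda\in\mathbb R$ with $I'(u)v=\lambda\int uv\,dx$ for all $v\in H^2_r(\mathbb R^N)$. There is a bounded sequence of numbers $\mu_m>0$ $(m\ge1)$ such that for all $\mu>0$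 and $0<c<c_*(\mu)$ there are $(u_j,\lambda_j)_{j\ge1}$ in $H^2(\mathbb R^N)\times\mathbb R$ with the following properties. For every $m\ge1$ with $\mu\ge\mu_m$, the functions $u_1,\dots,u_m$ are critical points of $I|_{V_r(c)}$ with Lagrange multipliers $\lambda_1,\dots,\lambda_m$, they are pairwise distinct up to sign ($u_i\ne\pm u_j$ for $i\ne j$), and $$I(u_j)<0,\qquad \|u_j\|_2^2=c,\qquad \lambda_j<0\qquad(j=1,\dots,m).$$ Moreover, if $\mu\ge\mu_m$ for all $m\ge1$, then $I(u_m)\to0^-$ as $m\to\infty$. -/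

import Mathlib

open MeasureTheory Filter Topology
open scoped ContDiff

noncomputable section

/-- The Euclidean space `ℝ^N`. -/
abbrev RN (N : ℕ) : Type := EuclideanSpace ℝ (Fin N)

/-- The real Hilbert space `L²(ℝ^N)`. -/
abbrev L2Fun (N : ℕ) : Type := Lp ℝ 2 (volume : Measure (RN N))

/-- The real Hilbert space `L²(ℝ^N; ℝ^N)` of square integrable vector fields. -/
abbrev L2Vec (N : ℕ) : Type := Lp (RN N) 2 (volume : Measure (RN N))

/-- `g` is the weak (distributional) gradient of `u`. -/
def IsWeakGradient {N : ℕ} (u : L2Fun N) (g : L2Vec N) : Prop :=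
  ∀ φ : RN N → ℝ, ContDiff ℝ ∞ φ → HasCompactSupport φ → ∀ v : RN N,
    ∫ x, u x * fderiv ℝ φ x v = - ∫ x, inner ℝ (g x) v * φ x

/-- `w` is the weak (distributional) Laplacian of `u`. -/
def IsWeakLaplacian {N : ℕ} (u w : L2Fun N) : Prop :=
  ∀ φ : RN N → ℝ, ContDiff ℝ ∞ φ → HasCompactSupport φ →
    ∫ x, u x * Laplacian.laplacian φ x = ∫ x, w x * φ x

section Helpers

variable {N : ℕ}

lemma testFun_memLp {φ : RN N → ℝ} (h : ContDiff ℝ ∞ φ) (hc : HasCompactSupport φ) :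
    MemLp φ 2 volume :=
  h.continuous.memLp_of_hasCompactSupport hc

lemma testFun_fderiv_memLp {φ : RN N → ℝ} (h : ContDiff ℝ ∞ φ) (hc : HasCompactSupport φ)
    (v : RN N) : MemLp (fun x => fderiv ℝ φ x v) 2 volume :=
  ((h.continuous_fderiv (by simp)).clm_apply continuous_const).memLp_of_hasCompactSupport
    (hc.fderiv_apply ℝ v)

lemma testFun_laplacian_memLp {φ : RN N → ℝ} (h : ContDiff ℝ ∞ φ) (hc : HasCompactSupport φ) :
    MemLp (fun x => Laplacian.laplacian φ x) 2 volume := by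
  have hcont : Continuous (fun x => Laplacian.laplacian φ x) := by
    rw [InnerProductSpace.laplacian_eq_iteratedFDeriv_stdOrthonormalBasis]
    refine continuous_finsetSum _ fun i _ => ?_
    have := h.continuous_iteratedFDeriv (m := 2) (WithTop.coe_le_coe.2 le_top)
    exact (ContinuousMultilinearMap.apply ℝ (fun _ : Fin 2 => RN N) ℝ _).continuous.comp this
  refine hcont.memLp_of_hasCompactSupport ?_
  have h2 : HasCompactSupport (iteratedFDeriv ℝ 2 φ) := hc.iteratedFDeriv 2
  refine h2.mono ?_
  intro x hx hx'
  apply hx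
  simp [InnerProductSpace.laplacian_eq_iteratedFDeriv_stdOrthonormalBasis, hx']

lemma l2_mul_integrable (u : L2Fun N) {ψ : RN N → ℝ} (hψ : MemLp ψ 2 volume) :
    Integrable (fun x => u x * ψ x) volume :=
  (Lp.memLp u).integrable_mul hψ

lemma l2vec_mul_integrable (g : L2Vec N) (v : RN N) {ψ : RN N → ℝ} (hψ : MemLp ψ 2 volume) :
    Integrable (fun x => inner ℝ (g x) v * ψ x) volume :=
  ((Lp.memLp g).inner_const v).integrable_mul hψ

lemma l2_integral_add (u v : L2Fun N) {ψ : RN N → ℝ} (hψ : MemLp ψ 2 volume) :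
    ∫ x, (u + v) x * ψ x = (∫ x, u x * ψ x) + ∫ x, v x * ψ x := by
  rw [← integral_add (l2_mul_integrable u hψ) (l2_mul_integrable v hψ)]
  refine integral_congr_ae ?_
  filter_upwards [Lp.coeFn_add u v] with x hx
  rw [hx, Pi.add_apply, add_mul]

lemma l2_integral_smul (a : ℝ) (u : L2Fun N) (ψ : RN N → ℝ) :
    ∫ x, (a • u) x * ψ x = a * ∫ x, u x * ψ x := by
  rw [← integral_const_mul]
  refine integral_congr_ae ?_
  filter_upwards [Lp.coeFn_smul a u] with x hx
  rw [hx, Pi.smul_apply, smul_eq_mul, mul_assoc]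

lemma l2_integral_zero (ψ : RN N → ℝ) : ∫ x, (0 : L2Fun N) x * ψ x = 0 := by
  have h := l2_integral_smul 0 (0 : L2Fun N) ψ
  rwa [zero_smul, zero_mul] at h

lemma l2vec_integral_add (g h : L2Vec N) (v : RN N) {ψ : RN N → ℝ} (hψ : MemLp ψ 2 volume) :
    ∫ x, inner ℝ ((g + h) x) v * ψ x
      = (∫ x, inner ℝ (g x) v * ψ x) + ∫ x, inner ℝ (h x) v * ψ x := by
  rw [← integral_add (l2vec_mul_integrable g v hψ) (l2vec_mul_integrable h v hψ)]
  refine integral_congr_ae ?_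
  filter_upwards [Lp.coeFn_add g h] with x hx
  rw [hx, Pi.add_apply, inner_add_left, add_mul]

lemma l2vec_integral_smul (a : ℝ) (g : L2Vec N) (v : RN N) (ψ : RN N → ℝ) :
    ∫ x, inner ℝ ((a • g) x) v * ψ x = a * ∫ x, inner ℝ (g x) v * ψ x := by
  rw [← integral_const_mul]
  refine integral_congr_ae ?_
  filter_upwards [Lp.coeFn_smul a g] with x hx
  rw [hx, Pi.smul_apply, real_inner_smul_left, mul_assoc]

lemma l2vec_integral_zero (v : RN N) (ψ : RN N → ℝ) :
    ∫ x, inner ℝ ((0 : L2Vec N) x) v * ψ x = 0 := by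
  have h := l2vec_integral_smul 0 (0 : L2Vec N) v ψ
  rwa [zero_smul, zero_mul] at h

end Helpers

/-- The carrier of the Sobolev space `H²(ℝ^N) = {u ∈ L² : ∇u ∈ L², Δu ∈ L²}` (weak derivatives). Since `∇u` and
`Δu` are determined by `u`, it is realised as the space of triples `(u, ∇u, Δu)` inside the Hilbert
sum `L² ⊕ L² ⊕ L²`, from which it inherits exactly the norm
`‖u‖_{H²} = (∫ |Δu|² + |∇u|² + u²)^{1/2}`. -/
def H2Graph (N : ℕ) : Submodule ℝ (WithLp 2 (L2Fun N × WithLp 2 (L2Vec N × L2Fun N))) where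
  carrier := {U | IsWeakGradient U.fst U.snd.fst ∧ IsWeakLaplacian U.fst U.snd.snd}
  zero_mem' := by
    refine ⟨fun φ _ _ v => ?_, fun φ _ _ => ?_⟩
    · have e := congrArg Neg.neg (l2vec_integral_zero v φ)
      rw [neg_zero] at e
      exact (l2_integral_zero _).trans e.symm
    · exact (l2_integral_zero _).trans (l2_integral_zero φ).symm
  add_mem' := by
    rintro U W ⟨hU1, hU2⟩ ⟨hW1, hW2⟩
    refine ⟨fun φ h hc v => ?_, fun φ h hc => ?_⟩
    · have e1 := l2_integral_add U.fst W.fst (testFun_fderiv_memLp h hc v)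
      have e2 := l2vec_integral_add U.snd.fst W.snd.fst v (testFun_memLp h hc)
      rw [hU1 φ h hc v, hW1 φ h hc v] at e1
      refine e1.trans ?_
      rw [← neg_add]
      exact congrArg Neg.neg e2.symm
    · have e1 := l2_integral_add U.fst W.fst (testFun_laplacian_memLp h hc)
      have e2 := l2_integral_add U.snd.snd W.snd.snd (testFun_memLp h hc)
      rw [hU2 φ h hc, hW2 φ h hc] at e1
      exact e1.trans e2.symm
  smul_mem' := by
    rintro a U ⟨hU1, hU2⟩
    refine ⟨fun φ h hc v => ?_, fun φ h hc => ?_⟩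
    · have e1 := l2_integral_smul a U.fst (fun x => fderiv ℝ φ x v)
      have e2 := l2vec_integral_smul a U.snd.fst v φ
      rw [hU1 φ h hc v] at e1
      refine e1.trans ?_
      rw [mul_neg]
      exact congrArg Neg.neg e2.symm
    · have e1 := l2_integral_smul a U.fst (fun x => Laplacian.laplacian φ x)
      have e2 := l2_integral_smul a U.snd.snd φ
      rw [hU2 φ h hc] at e1
      exact e1.trans e2.symm

/-- The Sobolev space `H²(ℝ^N)`, a real inner product space. -/
abbrev H2 (N : ℕ) : Type := H2Graph N

namespace H2

variable {N : ℕ}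

/-- The function `u ∈ L²` underlying an element of `H²`. -/
def fn (u : H2 N) : L2Fun N := u.1.fst

/-- The gradient `∇u ∈ L²`. -/
def grad (u : H2 N) : L2Vec N := u.1.snd.fst

/-- The Laplacian `Δu ∈ L²`. -/
def lap (u : H2 N) : L2Fun N := u.1.snd.snd

/-- `∫ |u|^q dx`. -/
def powInt (q : ℝ) (u : H2 N) : ℝ := ∫ x, |u.fn x| ^ q

end H2

/-- The subspace `H²_r(ℝ^N)` of radially symmetric functions: `u(x) = f(|x|)` almost everywhere. -/
def H2rad (N : ℕ) : Submodule ℝ (H2 N) where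
  carrier := {u | ∃ f : ℝ → ℝ, Measurable f ∧ ∀ᵐ x : RN N, u.fn x = f ‖x‖}
  zero_mem' := ⟨fun _ => 0, measurable_const, by
    filter_upwards [Lp.coeFn_zero ℝ 2 (volume : Measure (RN N))] with x hx
    exact hx⟩
  add_mem' := by
    rintro u v ⟨f, hf, hu⟩ ⟨g, hg, hv⟩
    refine ⟨fun t => f t + g t, hf.add hg, ?_⟩
    filter_upwards [hu, hv, Lp.coeFn_add u.fn v.fn] with x h1 h2 h3
    exact h3.trans (by rw [Pi.add_apply, h1, h2])
  smul_mem' := by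
    rintro a u ⟨f, hf, hu⟩
    refine ⟨fun t => a * f t, hf.const_mul a, ?_⟩
    filter_upwards [hu, Lp.coeFn_smul a u.fn] with x h1 h3
    exact h3.trans (by rw [Pi.smul_apply, h1, smul_eq_mul])

/-- The Sobolev critical exponent `4^* = 2N/(N-4)`. -/
def fourStar (N : ℕ) : ℝ := 2 * N / (N - 4)

/-- `γ_t = (N/2)(1/2 - 1/t)`. -/
def gam (N : ℕ) (t : ℝ) : ℝ := N / 2 * (1 / 2 - 1 / t)

/-- The best constant `C_{N,t}` in the Gagliardo-Nirenberg inequality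
`‖u‖_t ≤ C ‖Δu‖₂^{γ_t} ‖u‖₂^{1-γ_t}`, `u ∈ H²(ℝ^N)`. -/
def gnConst (N : ℕ) (t : ℝ) : ℝ :=
  sInf {C : ℝ | 0 ≤ C ∧ ∀ u : H2 N,
    u.powInt t ^ (1 / t) ≤ C * ‖u.lap‖ ^ gam N t * ‖u.fn‖ ^ (1 - gam N t)}

/-- The best Sobolev constant `S = inf_{u ≠ 0} ‖Δu‖₂² / (∫ |u|^{4^*})^{2/4^*}`. -/
def sobolevS (N : ℕ) : ℝ :=
  sInf ((fun u : H2 N => ‖u.lap‖ ^ 2 / u.powInt (fourStar N) ^ (2 / fourStar N)) '' {u | u ≠ 0})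

/-- The constant `𝓔` entering the definition of `c_*`. -/
def constE (N : ℕ) (p μ : ℝ) : ℝ :=
  (fourStar N - p * gam N p) / (2 - p * gam N p)
    * ((2 - p * gam N p) * μ * gnConst N p ^ p / ((fourStar N - 2) * p))
        ^ ((fourStar N - 2) / (fourStar N - p * gam N p))
    * (fourStar N * sobolevS N ^ (fourStar N / 2))
        ^ ((p * gam N p - 2) / (fourStar N - p * gam N p))

/-- The mass threshold `c_*`; it depends on `N`, `p` and `μ`. -/
def cStar (N : ℕ) (p μ : ℝ) : ℝ :=
  (1 / (2 * constE N p μ))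
    ^ (2 * (fourStar N - p * gam N p) / (p * (1 - gam N p) * (fourStar N - 2)))

/-- The radius `r_c`. -/
def rOf (N : ℕ) (p μ c : ℝ) : ℝ :=
  ((2 - p * gam N p) * μ * fourStar N * sobolevS N ^ (fourStar N / 2) * gnConst N p ^ p
      * c ^ (p * (1 - gam N p) / 2) / ((fourStar N - 2) * p))
    ^ (1 / (fourStar N - p * gam N p))

/-- The radius `r_* = r_{c_*}`. -/
def rStar (N : ℕ) (p μ : ℝ) : ℝ := rOf N p μ (cStar N p μ)

/-- The energy functional
`I(u) = ½∫|Δu|² + ½∫|∇u|² - (μ/p)∫|u|^p - (1/4^*)∫|u|^{4^*}` on `H²(ℝ^N)`. -/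
def energy (N : ℕ) (p μ : ℝ) (u : H2 N) : ℝ :=
  1 / 2 * ‖u.lap‖ ^ 2 + 1 / 2 * ‖u.grad‖ ^ 2 - μ / p * u.powInt p
    - 1 / fourStar N * u.powInt (fourStar N)

/-- `V_r(c)`: radial `u ∈ H²` with `‖u‖₂² = c` and `‖Δu‖₂² + ‖∇u‖₂² < r_*²`. -/
def Vr (N : ℕ) (p μ c : ℝ) : Set (H2 N) :=
  {u | u ∈ H2rad N ∧ ‖u.fn‖ ^ 2 = c ∧ ‖u.lap‖ ^ 2 + ‖u.grad‖ ^ 2 < rStar N p μ ^ 2}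

/-- `u` is a critical point of `I` restricted to `V_r(c)`, a relatively open subset of the manifold
`{u ∈ H²_r : ‖u‖₂² = c}`: the Fréchet derivative `I'(u)` exists and vanishes on the tangent space
`{v ∈ H²_r : ∫ u v = 0}`. -/
def IsCriticalPoint (N : ℕ) (p μ c : ℝ) (u : H2 N) : Prop :=
  u ∈ Vr N p μ c ∧ DifferentiableAt ℝ (energy N p μ) u ∧
    ∀ v ∈ H2rad N, inner ℝ u.fn v.fn = 0 → fderiv ℝ (energy N p μ) u v = 0

/-- `l` is the Lagrange multiplier of `u`: `I'(u) v = l ∫ u v` for all `v ∈ H²_r`. -/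
def IsLagrangeMultiplier (N : ℕ) (p μ : ℝ) (u : H2 N) (l : ℝ) : Prop :=
  ∀ v ∈ H2rad N, fderiv ℝ (energy N p μ) u v = l * inner ℝ u.fn v.fn

end

/-! On the mass sphere of radial functions put `ρ² = ‖Δu‖² + ‖∇u‖²`. The Gagliardo–Nirenberg and
Sobolev inequalities bound the energy below by `h(ρ) = ρ²/2 - K₁ ρ^{pγ_p} - K₂ ρ^{4^*}`, where `K₁`
increases with `c`. The constants `c_*` and `r_*` are such that `h(r_*) = 0` when `c = c_*`. For `c
< c_*` therefore `h ≥ 0` on a shell just below `r_*` (`exists_shell`), and the functions of negative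
energy in `V_r(c)` stay at a positive distance from its boundary. A short gradient step, projected
back to the mass sphere, cannot leave `V_r(c)`, so minimax arguments work although the energy is
unbounded below on the whole sphere.

The minimax levels are `a_k = inf_h max_{S^k} I(h)`, over odd continuous maps `h` from `S^k` into
the negative part of `V_r(c)`. Three facts give the theorem (`ConstrainedCrit.exists_seq_critical`).

Every `a_k` is negative. Take a `(k+1)`-dimensional space of radial test functions and spread it out
by `x ↦ t x` with `t` small, at fixed mass. The quadratic part is then `O(t²)`, while `∫|u|^p` is of
order `t^{2pγ_p}`. Since `p < 2 + 4/N` means `pγ_p < 1`, the power wins (`exists_radial_sphere`).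

Every `a_k` is a critical value. Otherwise one projected gradient step applied to an almost optimal
map would push its maximum below `a_k` (`exists_descend`); the Palais–Smale condition then turns
almost critical points into a critical point. Palais–Smale holds at negative levels
(`radial_palaisSmale`). Since `p, 4^* > 2`, one has `I'(u)u ≤ 2I(u)`, so the multipliers stay below
a negative number. The subcritical term is compact on radial functions. The critical term is
absorbed by `‖Δ(u_n - v)‖²`, because `r_*^{4^*-2} < S^{4^*/2}`.

The `a_k` have supremum `0`. By Borsuk–Ulam every odd map on `S^k` meets the orthogonal complement
of any `k` given vectors. If all `a_k` were at most some `b < 0`, letting these vectors run through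
a dense sequence would give a weakly null sequence with energy at most `b/2`. But weakly null radial
sequences tend to zero in `L^p`, and in the ball of radius `r_*` the energy is at least
`-(μ/p)∫|u|^p` (`radial_not_weakly_null`).

A set of negative levels with supremum `0` contains a strictly increasing sequence tending to `0`.
Distinct energies, together with evenness of `I`, make the critical points distinct up to sign.
Nothing restricts `μ > 0`, so constant thresholds suffice.

Two tools are built from scratch. Borsuk–Ulam comes from mod 2 cup products evaluated on chains of
small mesh (`HasHemisphere`). Radial compactness comes from mollification: a ball far from the
origin has many disjoint congruent copies carrying the same mass (`exists_radial_decay`). -/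

noncomputable section

/-! ### The Borsuk–Ulam theorem

Mod 2 cochains are functions on lists of points, and chains are additive functionals on cochains. -/

namespace BorsukUlam

/-! ### Mod 2 cochains: coboundary, prism homotopy and cup products. -/

section Cochains

variable {E : Type*}

/-- The (augmented) mod 2 simplicial coboundary of a function on lists. -/
def cobd : (List E → ZMod 2) → List E → ZMod 2
  | _, [] => 0
  | φ, x :: t => φ t + cobd (fun s => φ (x :: s)) t

/-- The prism operator between two maps `a` and `b`. -/
def prism (a b : E → E) : (List E → ZMod 2) → List E → ZMod 2
  | _, [] => 0
  | φ, x :: t => φ (a x :: b x :: t.map b) + prism a b (fun s => φ (a x :: s)) t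

/-- The iterated cup product of the coboundaries of the functions in the first list. -/
def cup : List (E → ZMod 2) → List E → ZMod 2
  | [], [_] => 1
  | s :: ss, x :: y :: t => (s x + s y) * cup ss (y :: t)
  | _, _ => 0

/-- The cup product of a function with the cochain `cup ss`. -/
def cupHead (s : E → ZMod 2) (ss : List (E → ZMod 2)) : List E → ZMod 2
  | [] => 0
  | x :: t => s x * cup ss (x :: t)

lemma zmod2_add_self (a : ZMod 2) : a + a = 0 := CharTwo.add_self_eq_zero a

lemma cobd_add (φ ψ : List E → ZMod 2) (l : List E) :
    cobd (fun s => φ s + ψ s) l = cobd φ l + cobd ψ l := by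
  induction l generalizing φ ψ with
  | nil => simp [cobd]
  | cons x t ih => simp only [cobd, ih]; ring

lemma cobd_const_mul (c : ZMod 2) (φ : List E → ZMod 2) (l : List E) :
    cobd (fun s => c * φ s) l = c * cobd φ l := by
  induction l generalizing φ with
  | nil => simp [cobd]
  | cons x t ih => simp only [cobd, ih]; ring

lemma cobd_map (g : E → E) (φ : List E → ZMod 2) (l : List E) :
    cobd (fun s => φ (s.map g)) l = cobd φ (l.map g) := by
  induction l generalizing φ with
  | nil => simp [cobd]
  | cons x t ih => simp only [cobd, List.map_cons, ← ih]

lemma prism_add (a b : E → E) (φ ψ : List E → ZMod 2) (l : List E) :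
    prism a b (fun s => φ s + ψ s) l = prism a b φ l + prism a b ψ l := by
  induction l generalizing φ ψ with
  | nil => simp [prism]
  | cons x t ih => simp only [prism, ih]; ring

/-- The homotopy formula for the prism operator. -/
lemma prism_homotopy (a b : E → E) (φ : List E → ZMod 2) (l : List E) :
    prism a b (cobd φ) l + cobd (prism a b φ) l = φ (l.map a) + φ (l.map b) := by
  induction l generalizing φ with
  | nil => simp [prism, cobd, zmod2_add_self]
  | cons x t ih =>
    have h := ih (fun s => φ (a x :: s))
    have h1 : prism a b (fun s => cobd φ (a x :: s)) t
        = prism a b φ t + prism a b (cobd fun s => φ (a x :: s)) t := by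
      rw [← prism_add]; rfl
    have h2 : cobd (fun s => prism a b φ (x :: s)) t
        = cobd (fun s => φ (a x :: b x :: s)) (t.map b)
          + cobd (prism a b fun s => φ (a x :: s)) t := by
      rw [← cobd_map, ← cobd_add]; rfl
    simp only [prism, cobd, List.map_cons] at *
    rw [h1, h2]
    linear_combination h + CharTwo.two_eq_zero (R := ZMod 2) * (prism a b φ t
      + φ (a x :: t.map b) + cobd (fun s => φ (a x :: b x :: s)) (t.map b))

/-- Each factor is the coboundary of a function, so the Leibniz rule makes the product a cocycle.
The induction strips off the first factor; the case split on the list isolates the lengths where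
`cup` takes its default values. -/
lemma cobd_cup (ss : List (E → ZMod 2)) (l : List E) : cobd (cup ss) l = 0 := by
  induction ss generalizing l with
  | nil =>
    rcases l with _ | ⟨x, _ | ⟨y, t⟩⟩
    · rfl
    · simp [cobd, cup]
    · have h0 : cobd (fun s => cup (E := E) [] (x :: y :: s)) t = 0 := by
        have : (fun s => cup (E := E) [] (x :: y :: s)) = fun s => 0 * 0 := by
          funext s; simp [cup]
        rw [this, cobd_const_mul, zero_mul]
      simp only [cobd, h0, add_zero]
      rcases t with _ | ⟨z, t⟩
      · simp [cup]; exact zmod2_add_self 1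
      · simp [cup]
  | cons s ss ih =>
    rcases l with _ | ⟨x, _ | ⟨y, t⟩⟩
    · rfl
    · simp [cobd, cup]
    · have h0 : cobd (fun u => cup (s :: ss) (x :: y :: u)) t = (s x + s y) * cup ss t := by
        have h1 : (fun u => cup (s :: ss) (x :: y :: u))
            = fun u => (s x + s y) * cup ss (y :: u) := by
          funext u; simp [cup]
        have h2 := ih (y :: t)
        rw [cobd] at h2
        rw [h1, cobd_const_mul]
        linear_combination (s x + s y) * h2
          - CharTwo.two_eq_zero (R := ZMod 2) * (s x + s y) * cup ss t
      simp only [cobd, h0]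
      rcases t with _ | ⟨z, t⟩
      · cases ss <;> simp [cup]
      · simp only [cup]
        linear_combination CharTwo.two_eq_zero (R := ZMod 2) * (s x + s y + s z) * cup ss (z :: t)

/-- The Leibniz rule again: `δ(s ∪ α) = δs ∪ α` for a cocycle `α`. This exhibits the product of `n +
1` coboundaries as a coboundary, which drives the induction on dimension in `HasHemisphere.succ`. -/
lemma cobd_cupHead (s : E → ZMod 2) (ss : List (E → ZMod 2)) (l : List E) :
    cobd (cupHead s ss) l = cup (s :: ss) l := by
  rcases l with _ | ⟨x, t⟩
  · rfl
  · have h1 : (fun u => cupHead s ss (x :: u)) = fun u => s x * cup ss (x :: u) := rfl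
    have h2 := cobd_cup ss (x :: t)
    rw [cobd] at h2
    rw [cobd, h1, cobd_const_mul]
    rcases t with _ | ⟨y, t⟩
    · simp [cobd, cupHead, cup]
    · simp only [cupHead, cup]
      linear_combination s x * h2 - CharTwo.two_eq_zero (R := ZMod 2) * s x * cup ss (y :: t)

/-- A nonzero product has nonzero factors, and a factor is the difference of one function at two
consecutive points of the list. -/
lemma exists_ne_of_cup_ne_zero {ss : List (E → ZMod 2)} {l : List E} (h : cup ss l ≠ 0)
    {s : E → ZMod 2} (hs : s ∈ ss) : ∃ x ∈ l, ∃ y ∈ l, s x ≠ s y := by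
  induction ss generalizing l with
  | nil => simp at hs
  | cons s' ss ih =>
    rcases l with _ | ⟨x, _ | ⟨y, t⟩⟩
    · simp [cup] at h
    · simp [cup] at h
    · simp only [cup] at h
      rcases List.mem_cons.1 hs with rfl | hs
      · refine ⟨x, by simp, y, by simp, fun hxy => h ?_⟩
        rw [hxy, zmod2_add_self, zero_mul]
      · obtain ⟨u, hu, v, hv, huv⟩ := ih (fun h' => h (by rw [h', mul_zero])) hs
        exact ⟨u, List.mem_cons_of_mem _ hu, v, List.mem_cons_of_mem _ hv, huv⟩

/-- The two constants `1` produced by oddness at consecutive points cancel mod 2 in each factor `s x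
+ s y`. -/
lemma cup_neg_of_odd [Neg E] {X : Set E} {ss : List (E → ZMod 2)}
    (hs : ∀ s ∈ ss, ∀ x ∈ X, s (-x) = s x + 1) {l : List E} (hl : ∀ x ∈ l, x ∈ X) :
    cup ss (l.map Neg.neg) = cup ss l := by
  induction ss generalizing l with
  | nil => rcases l with _ | ⟨x, _ | ⟨y, t⟩⟩ <;> simp [cup]
  | cons s ss ih =>
    rcases l with _ | ⟨x, _ | ⟨y, t⟩⟩
    · rfl
    · simp [cup]
    · have h := ih (fun s' hs' => hs s' (List.mem_cons_of_mem _ hs'))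
        (l := y :: t) fun z hz => hl z (List.mem_cons_of_mem _ hz)
      simp only [List.map_cons, cup] at h ⊢
      rw [h, hs s (by simp) x (hl x (by simp)), hs s (by simp) y (hl y (by simp))]
      linear_combination CharTwo.two_eq_zero (R := ZMod 2) * cup ss (y :: t)

end Cochains

/-! ### Chains of small mesh and the hemisphere construction. -/

section Chains

variable {E : Type*} [NormedAddCommGroup E]

/-- Lists of points of `X` with pairwise distances at most `ε`. -/
def SmallList (X : Set E) (ε : ℝ) (l : List E) : Prop :=
  (∀ x ∈ l, x ∈ X) ∧ ∀ x ∈ l, ∀ y ∈ l, dist x y ≤ ε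

/-- The prism of a cochain vanishing on small lists vanishes on slightly smaller lists. -/
lemma prism_eq_zero {X Y : Set E} {a b : E → E} {ε ε' : ℝ}
    (ha : ∀ x ∈ X, a x ∈ Y) (hb : ∀ x ∈ X, b x ∈ Y)
    (hd : ∀ x ∈ X, ∀ y ∈ X, dist x y ≤ ε → dist (a x) (a y) ≤ ε' ∧ dist (a x) (b y) ≤ ε' ∧
      dist (b x) (b y) ≤ ε')
    {φ : List E → ZMod 2} {l : List E} (pre : List E)
    (hφ : ∀ l, SmallList Y ε' l → φ l = 0)
    (hl : SmallList X ε (pre ++ l)) :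
    prism a b (fun s => φ (pre.map a ++ s)) l = 0 := by
  induction l generalizing pre with
  | nil => rfl
  | cons x t ih =>
    have h := ih (pre ++ [x]) (by simpa using hl)
    simp only [prism]
    have e : (fun s => φ (pre.map a ++ a x :: s)) = fun s => φ ((pre ++ [x]).map a ++ s) := by
      funext s; simp
    rw [e, h, add_zero]
    have e2 : pre.map a ++ a x :: b x :: t.map b = (pre ++ [x]).map a ++ (x :: t).map b := by simp
    rw [e2]
    apply hφ
    have hx1 : ∀ y ∈ pre ++ [x], y ∈ pre ++ x :: t := by
      intro y hy; simp at hy ⊢; tauto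
    have hx2 : ∀ y ∈ x :: t, y ∈ pre ++ x :: t := by
      intro y hy; simp at hy ⊢; tauto
    refine ⟨fun y hy => ?_, fun y hy z hz => ?_⟩
    · rcases List.mem_append.1 hy with hy | hy
      · obtain ⟨y, hy', rfl⟩ := List.mem_map.1 hy
        exact ha y (hl.1 y (hx1 y hy'))
      · obtain ⟨y, hy', rfl⟩ := List.mem_map.1 hy
        exact hb y (hl.1 y (hx2 y hy'))
    · have key : ∀ u ∈ pre ++ x :: t, ∀ v ∈ pre ++ x :: t, dist (a u) (a v) ≤ ε' ∧
          dist (a u) (b v) ≤ ε' ∧ dist (b u) (b v) ≤ ε' :=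
        fun u hu v hv => hd u (hl.1 u hu) v (hl.1 v hv) (hl.2 u hu v hv)
      rcases List.mem_append.1 hy with hy | hy <;> rcases List.mem_append.1 hz with hz | hz <;>
        obtain ⟨y, hy', rfl⟩ := List.mem_map.1 hy <;> obtain ⟨z, hz', rfl⟩ := List.mem_map.1 hz
      · exact (key y (hx1 y hy') z (hx1 z hz')).1
      · exact (key y (hx1 y hy') z (hx2 z hz')).2.1
      · rw [dist_comm]; exact (key z (hx1 z hz') y (hx2 y hy')).2.1
      · exact (key y (hx2 y hy') z (hx2 z hz')).2.2

/-- A mod 2 chain supported on `ε`-small lists of points of `X` whose symmetrization is a cycle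
and which pairs to `1` with every product of `n` odd functions. -/
def HasHemisphere (X : Set E) (n : ℕ) (ε : ℝ) : Prop :=
  ∃ c : (List E → ZMod 2) → ZMod 2, (∀ φ ψ, c (fun l => φ l + ψ l) = c φ + c ψ) ∧
    (∀ φ, (∀ l, SmallList X ε l → φ l = 0) → c φ = 0) ∧
    (∀ φ : List E → ZMod 2, c (fun l => cobd φ l + cobd φ (l.map Neg.neg)) = 0) ∧
    ∀ ss : List (E → ZMod 2), ss.length = n → (∀ s ∈ ss, ∀ x ∈ X, s (-x) = s x + 1) → c (cup ss) = 1

lemma hasHemisphere_zero {X : Set E} {x : E} (hx : x ∈ X) {ε : ℝ} (hε : 0 ≤ ε) :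
    HasHemisphere X 0 ε := by
  refine ⟨fun φ => φ [x], fun φ ψ => rfl, fun φ h => h [x] ?_, fun φ => ?_, fun ss h _ => ?_⟩
  · refine ⟨by simpa using hx, by simpa using hε⟩
  · simp [cobd, zmod2_add_self]
  · rw [List.length_eq_zero_iff] at h
    subst h
    simp [cup]

/-- Coning off the symmetrized hemisphere from a point `e`. -/
lemma HasHemisphere.succ [NormedSpace ℝ E] {X Y : Set E} {n : ℕ} {ε ε' : ℝ} (hε : 0 ≤ ε) (hεε : ε < ε') {e : E}
    (hneg : ∀ x ∈ X, -x ∈ X) (hXY : X ⊆ Y) (hXb : ∀ x ∈ X, ‖x - e‖ ≤ 2)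
    (hseg : ∀ x ∈ X, ∀ t : ℝ, 0 ≤ t → t ≤ 1 → (1 - t) • x + t • e ∈ Y)
    (h : HasHemisphere X n ε) (hX : X.Nonempty) : HasHemisphere Y (n + 1) ε' := by
  obtain ⟨c, hadd, hsupp, hcyc, hone⟩ := h
  -- The contraction to `e` is cut into `M` pieces. Points lie within distance `2` of `e`, so each
  -- piece moves them by at most `2 / M ≤ ε' - ε`, which is the mesh that may be lost.
  obtain ⟨M, hM⟩ := exists_nat_gt (2 / (ε' - ε))
  have hM0 : (0 : ℝ) < M := lt_of_le_of_lt (div_nonneg (by norm_num) (by linarith)) hM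
  have hstep : 2 / (M : ℝ) ≤ ε' - ε := by
    rw [div_lt_iff₀ (by linarith)] at hM
    rw [div_le_iff₀ hM0]; linarith
  let a : ℕ → E → E := fun j x => (1 - (j / M : ℝ)) • x + (j / M : ℝ) • e
  have ha0 : a 0 = id := by funext x; simp [a]
  have haM : a M = fun _ => e := by funext x; simp [a, div_self hM0.ne']
  -- Dual of the cone with apex `e`: the prisms over the successive pieces of the contraction,
  -- closed by joining `e` to the collapsed list. It satisfies `R δ = id + δ R`, proved in `hR` by
  -- telescoping the homotopy formula.
  let R : (List E → ZMod 2) → List E → ZMod 2 := fun φ l =>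
    (∑ j ∈ Finset.range M, prism (a j) (a (j + 1)) φ l) + φ (e :: l.map (a M))
  -- The symmetrized hemisphere, a sphere without boundary; coning it off gives the hemisphere of
  -- the next dimension.
  let z : (List E → ZMod 2) → ZMod 2 := fun φ => c fun l => φ l + φ (l.map Neg.neg)
  have hzadd : ∀ φ ψ, z (fun l => φ l + ψ l) = z φ + z ψ := by
    intro φ ψ
    simp only [z]
    rw [← hadd]
    congr 1
    funext l; ring
  have hRadd : ∀ φ ψ l, R (fun l => φ l + ψ l) l = R φ l + R ψ l := by
    intro φ ψ l
    simp only [R, prism_add, Finset.sum_add_distrib]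
    ring
  have hcobd_sum : ∀ (φ : List E → ZMod 2) (l : List E) (m : ℕ),
      cobd (fun l => ∑ j ∈ Finset.range m, prism (a j) (a (j + 1)) φ l) l
        = ∑ j ∈ Finset.range m, cobd (prism (a j) (a (j + 1)) φ) l := by
    intro φ l m
    induction m with
    | zero =>
      have := cobd_const_mul 0 (fun _ => 0) l
      simpa using this
    | succ m ih =>
      simp only [Finset.sum_range_succ]
      rw [cobd_add, ih]
  have hR : ∀ φ l, R (cobd φ) l = φ l + cobd (R φ) l := by
    intro φ l
    have h1 : ∀ m, (∑ j ∈ Finset.range m, prism (a j) (a (j + 1)) (cobd φ) l)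
        + cobd (fun l => ∑ j ∈ Finset.range m, prism (a j) (a (j + 1)) φ l) l
        = φ l + φ (l.map (a m)) := by
      intro m
      rw [hcobd_sum, ← Finset.sum_add_distrib]
      simp only [prism_homotopy]
      induction m with
      | zero => simp [ha0, zmod2_add_self]
      | succ m ih =>
        rw [Finset.sum_range_succ, ih]
        linear_combination CharTwo.two_eq_zero (R := ZMod 2) * φ (l.map (a m))
    have h2 : cobd (R φ) l = cobd (fun l => ∑ j ∈ Finset.range M, prism (a j) (a (j + 1)) φ l) l
        + cobd (fun l => φ (e :: l)) (l.map (a M)) := by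
      rw [← cobd_map, ← cobd_add]
    have h3 := h1 M
    simp only [R] at h2 ⊢
    rw [h2, cobd]
    linear_combination h3 + CharTwo.two_eq_zero (R := ZMod 2) * (φ (l.map (a M)))
      - CharTwo.two_eq_zero (R := ZMod 2) *
        cobd (fun l => ∑ j ∈ Finset.range M, prism (a j) (a (j + 1)) φ l) l
  -- The boundary of the cone over the cycle `z` is `z` itself.
  have hzR : ∀ φ, z (R (cobd φ)) = z φ := by
    intro φ
    have h1 : R (cobd φ) = fun l => φ l + cobd (R φ) l := by funext l; exact hR φ l
    rw [h1, hzadd]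
    have : z (cobd (R φ)) = 0 := hcyc _
    rw [this, add_zero]
  have hnegneg : ∀ l : List E, (l.map Neg.neg).map Neg.neg = l := by
    intro l; simp
  have hzneg : ∀ φ : List E → ZMod 2, z (fun l => φ (l.map Neg.neg)) = z φ := by
    intro φ
    simp only [z, hnegneg]
    congr 1
    funext l; ring
  have hsmallneg : ∀ l, SmallList X ε l → SmallList X ε (l.map Neg.neg) := by
    intro l hl
    refine ⟨fun x hx => ?_, fun x hx y hy => ?_⟩
    · obtain ⟨x, hx', rfl⟩ := List.mem_map.1 hx
      exact hneg x (hl.1 x hx')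
    · obtain ⟨x, hx', rfl⟩ := List.mem_map.1 hx
      obtain ⟨y, hy', rfl⟩ := List.mem_map.1 hy
      rw [dist_neg_neg]; exact hl.2 x hx' y hy'
  have haY : ∀ j ≤ M, ∀ x ∈ X, a j x ∈ Y := by
    intro j hj x hx
    refine hseg x hx _ (by positivity) ?_
    rw [div_le_one hM0]; exact_mod_cast hj
  have hdist : ∀ j k : ℕ, j ≤ M → ∀ x y, dist x y ≤ ε → dist (a j x) (a j y) ≤ ε := by
    intro j k hj x y hxy
    have h1 : a j x - a j y = (1 - (j / M : ℝ)) • (x - y) := by simp only [a]; module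
    have h2 : (j / M : ℝ) ≤ 1 := by rw [div_le_one hM0]; exact_mod_cast hj
    have h3 : 0 ≤ (j / M : ℝ) := by positivity
    rw [dist_eq_norm] at hxy ⊢
    rw [h1, norm_smul, Real.norm_eq_abs, abs_of_nonneg (by linarith)]
    nlinarith [norm_nonneg (x - y)]
  have hmove : ∀ j : ℕ, ∀ y ∈ X, dist (a j y) (a (j + 1) y) ≤ ε' - ε := by
    intro j y hy
    have h1 : a j y - a (j + 1) y = (1 / M : ℝ) • (y - e) := by
      simp only [a]; push_cast; rw [add_div]; module
    rw [dist_eq_norm, h1, norm_smul, Real.norm_eq_abs, abs_of_nonneg (by positivity)]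
    calc 1 / (M : ℝ) * ‖y - e‖ ≤ 1 / (M : ℝ) * 2 := by
          have := hXb y hy; gcongr
      _ = 2 / M := by ring
      _ ≤ _ := hstep
  have hRsupp : ∀ φ, (∀ l, SmallList Y ε' l → φ l = 0) → ∀ l, SmallList X ε l → R φ l = 0 := by
    intro φ hφ l hl
    have h1 : ∀ j ∈ Finset.range M, prism (a j) (a (j + 1)) φ l = 0 := by
      intro j hj
      have hj' : j < M := Finset.mem_range.1 hj
      refine prism_eq_zero (haY j hj'.le) (haY (j + 1) hj') ?_ [] hφ (by simpa using hl)
      intro x hx y hy hxy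
      have d1 := hdist j 0 hj'.le x y hxy
      have d2 := hdist (j + 1) 0 hj' x y hxy
      have d3 := hmove j y hy
      have d4 := dist_triangle (a j x) (a j y) (a (j + 1) y)
      exact ⟨by linarith, by linarith, by linarith⟩
    simp only [R]
    rw [Finset.sum_eq_zero h1, zero_add]
    apply hφ
    have hm : ∀ x ∈ e :: l.map (a M), x = e := by
      intro x hx
      rw [haM] at hx
      simp at hx
      tauto
    obtain ⟨x0, hx0⟩ := hX
    refine ⟨fun x hx => ?_, fun x hx y hy => ?_⟩
    · rw [hm x hx]
      simpa using hseg x0 hx0 1 zero_le_one le_rfl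
    · rw [hm x hx, hm y hy, dist_self]; linarith
  refine ⟨fun φ => z (R φ), fun φ ψ => ?_, fun φ hφ => ?_, fun φ => ?_, fun ss hlen hs => ?_⟩
  · rw [← hzadd]
    exact congrArg z (funext fun l => hRadd φ ψ l)
  · refine hsupp _ fun l hl => ?_
    rw [hRsupp φ hφ l hl, hRsupp φ hφ _ (hsmallneg l hl), add_zero]
  -- The boundary `z` of the new hemisphere is invariant under the antipodal map, so symmetrizing
  -- counts it twice.
  · have h1 : (fun l => cobd φ l + cobd φ (l.map Neg.neg))
        = cobd (fun l => φ l + φ (l.map Neg.neg)) := by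
      funext l
      rw [cobd_add, cobd_map]
    rw [h1]
    exact (hzR _).trans (by rw [hzadd, hzneg, zmod2_add_self])
  · rcases ss with _ | ⟨s, ss⟩
    · simp at hlen
    have h1 : cup (s :: ss) = cobd (cupHead s ss) := by
      funext l; exact (cobd_cupHead s ss l).symm
    rw [h1]
    refine (hzR _).trans ?_
    have hs' : ∀ s' ∈ ss, ∀ x ∈ X, s' (-x) = s' x + 1 := fun s' hs' x hx =>
      hs s' (List.mem_cons_of_mem _ hs') x (hXY hx)
    rw [← hone ss (by simpa using hlen) hs']
    -- On a list headed by `x` the symmetrization of `s ∪ α`, with `α = cup ss` invariant, is `(s x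
    -- + s (-x)) α = α`. The new pairing thus reduces to the old one.
    have h2 : c (fun l => (cupHead s ss l + cupHead s ss (l.map Neg.neg)) + cup ss l) = 0 := by
      refine hsupp _ fun l hl => ?_
      rcases l with _ | ⟨x, t⟩
      · have : cup ss ([] : List E) = 0 := by cases ss <;> rfl
        simp [cupHead, this]
      · have h3 := cup_neg_of_odd hs' hl.1
        have h4 := hs s (by simp) x (hXY (hl.1 x (by simp)))
        simp only [List.map_cons, cupHead] at h3 ⊢
        rw [h3, h4]
        linear_combination CharTwo.two_eq_zero (R := ZMod 2) * (s x + 1) * cup ss (x :: t)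
    rw [hadd (fun l => cupHead s ss l + cupHead s ss (l.map Neg.neg)) (cup ss)] at h2
    rw [← zmod2_add_self (c (cup ss))] at h2
    exact add_right_cancel h2

end Chains

/-! ### Borsuk–Ulam on the cross-polytope and on the sphere. -/

/-- The part of the boundary of the cross-polytope spanned by the first `i + 1` axes. -/
def crossPolytope (n i : ℕ) : Set (Fin (n + 1) → ℝ) :=
  {x | ∑ j, |x j| = 1 ∧ ∀ j : Fin (n + 1), i < j → x j = 0}

lemma norm_le_one_of_mem_crossPolytope {n i : ℕ} {x : Fin (n + 1) → ℝ}
    (hx : x ∈ crossPolytope n i) : ‖x‖ ≤ 1 := by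
  refine (pi_norm_le_iff_of_nonneg zero_le_one).2 fun j => ?_
  rw [← hx.1]
  exact Finset.single_le_sum (f := fun j => |x j|) (fun j _ => abs_nonneg _) (Finset.mem_univ j)

lemma single_mem_crossPolytope {n i : ℕ} (hi : i < n + 1) :
    (Pi.single ⟨i, hi⟩ 1 : Fin (n + 1) → ℝ) ∈ crossPolytope n i := by
  refine ⟨?_, fun j hj => ?_⟩
  · rw [Finset.sum_eq_single (⟨i, hi⟩ : Fin (n + 1))] <;> simp +contextual
  · rw [Pi.single_eq_of_ne]
    rintro rfl
    exact lt_irrefl _ hj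

/-- The cross-polytope is used instead of the round sphere because straight segments to a new vertex
stay inside it, so the cone needs no radial projection. Each step of the induction spends half of
the mesh. -/
lemma hasHemisphere_crossPolytope (n : ℕ) (i : ℕ) (hi : i ≤ n) {ε : ℝ} (hε : 0 < ε) :
    HasHemisphere (crossPolytope n i) i ε := by
  induction i generalizing ε with
  | zero => exact hasHemisphere_zero (single_mem_crossPolytope (by omega)) hε.le
  | succ i ih =>
    have hi' : i + 1 < n + 1 := by omega
    have he := single_mem_crossPolytope hi'
    refine HasHemisphere.succ (e := Pi.single ⟨i + 1, hi'⟩ 1) (half_pos hε).le (half_lt_self hε)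
      ?_ ?_ ?_ ?_ (ih (by omega) (half_pos hε)) ⟨_, single_mem_crossPolytope (by omega)⟩
    · intro x hx
      exact ⟨by simpa using hx.1, fun j hj => by simpa using hx.2 j hj⟩
    · intro x hx
      exact ⟨hx.1, fun j hj => hx.2 j (by omega)⟩
    · intro x hx
      have := norm_sub_le x (Pi.single ⟨i + 1, hi'⟩ 1)
      have h1 := norm_le_one_of_mem_crossPolytope hx
      have h2 := norm_le_one_of_mem_crossPolytope he
      linarith
    · intro x hx t ht0 ht1
      refine ⟨?_, fun j hj => ?_⟩
      -- The coordinate of the new axis vanishes on `x`, so `x` and the vertex have disjoint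
      -- supports and the `ℓ¹` norm is affine along the segment.
      · have h1 : ∀ j : Fin (n + 1), |((1 - t) • x + t • (Pi.single ⟨i + 1, hi'⟩ (1 : ℝ) : Fin (n + 1) → ℝ)) j|
            = (1 - t) * |x j| + t * |(Pi.single ⟨i + 1, hi'⟩ (1 : ℝ) : Fin (n + 1) → ℝ) j| := by
          intro j
          by_cases hj : j = ⟨i + 1, hi'⟩
          · have hx0 : x j = 0 := hx.2 j (by rw [hj]; simp)
            subst hj
            simp [hx0, abs_of_nonneg ht0]
          · simp [Pi.single_eq_of_ne hj, abs_mul, abs_of_nonneg (sub_nonneg.2 ht1)]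
        simp only [h1, Finset.sum_add_distrib, ← Finset.mul_sum]
        rw [hx.1, he.1]; ring
      · have h1 := hx.2 j (by omega)
        have h2 := he.2 j hj
        simp [h1, h2]

open Classical in
/-- An odd function on nonzero vectors with values in `ZMod 2`. -/
def lexSign {m : ℕ} (x : Fin m → ℝ) : ZMod 2 :=
  if 0 < toLex x then 1 else 0

lemma lexSign_neg {m : ℕ} {x : Fin m → ℝ} (hx : x ≠ 0) : lexSign (-x) = lexSign x + 1 := by
  classical
  have h0 : toLex x ≠ 0 := fun h => hx (by simpa using congrArg ofLex h)
  have hneg : 0 < toLex (-x) ↔ toLex x < 0 := neg_pos (a := toLex x)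
  unfold lexSign
  rcases lt_or_gt_of_ne h0 with h | h
  · have h1 : ¬ 0 < toLex x := not_lt.2 h.le
    have h2 : 0 < toLex (-x) := hneg.2 h
    rw [if_pos h2, if_neg h1]; rfl
  · have h1 : 0 < toLex x := h
    have h2 : ¬ 0 < toLex (-x) := fun h' => lt_asymm h (hneg.1 h')
    rw [if_pos h1, if_neg h2]; rfl

/-- **Borsuk–Ulam** on the boundary of the cross-polytope. -/
theorem exists_zero_crossPolytope (n : ℕ) (f : (Fin (n + 1) → ℝ) → Fin n → ℝ)
    (hf : ContinuousOn f (crossPolytope n n)) (hodd : ∀ x ∈ crossPolytope n n, f (-x) = -f x) :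
    ∃ x ∈ crossPolytope n n, f x = 0 := by
  classical
  by_contra! hne
  set X := crossPolytope n n with hXdef
  have hXe : X = {x | ∑ j, |x j| = 1} := by
    ext x
    refine ⟨fun h => h.1, fun h => ⟨h, fun j hj => ?_⟩⟩
    have := j.2; omega
  have hXc : IsCompact X := by
    refine Metric.isCompact_of_isClosed_isBounded ?_ ?_
    · rw [hXe]
      exact isClosed_eq (by fun_prop) continuous_const
    · refine (Metric.isBounded_closedBall (x := 0) (r := 1)).subset fun x hx => ?_
      simpa using norm_le_one_of_mem_crossPolytope hx
  have hXne : X.Nonempty := ⟨_, single_mem_crossPolytope (Nat.lt_succ_self n)⟩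
  obtain ⟨x0, hx0, hmin⟩ := hXc.exists_isMinOn hXne hf.norm
  set m := ‖f x0‖
  have hm : 0 < m := norm_pos_iff.2 (hne x0 hx0)
  have huc := hXc.uniformContinuousOn_of_continuous hf
  obtain ⟨δ, hδ, hδf⟩ := Metric.uniformContinuousOn_iff.1 huc (m / 3) (by positivity)
  obtain ⟨c, -, hsupp, -, hone⟩ := hasHemisphere_crossPolytope n n le_rfl (half_pos hδ)
  -- The sign of the `i`-th component of `f`. Where that component vanishes, the lexicographic sign
  -- of the nonzero point `x` breaks the tie and keeps the function odd; continuity is not needed.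
  let s : Fin n → (Fin (n + 1) → ℝ) → ZMod 2 := fun i x =>
    if 0 < f x i then 1 else if f x i < 0 then 0 else lexSign x
  have hsodd : ∀ i, ∀ x ∈ X, s i (-x) = s i x + 1 := by
    intro i x hx
    have hx0 : x ≠ 0 := by
      rintro rfl
      have := hx.1
      simp at this
    have hfx : f (-x) i = -f x i := by rw [hodd x hx]; rfl
    simp only [s, hfx]
    rcases lt_trichotomy (f x i) 0 with h | h | h
    · rw [if_pos (neg_pos.2 h), if_neg (not_lt.2 h.le), if_pos h]; rfl
    · rw [h]; simpa using lexSign_neg hx0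
    · rw [if_neg (not_lt.2 (neg_nonpos.2 h.le)), if_pos (neg_neg_of_pos h), if_pos h]; rfl
  have h1 := hone (List.ofFn s) (by simp) (by
    intro s' hs' x hx
    obtain ⟨i, rfl⟩ := (List.mem_ofFn' s s').1 hs'
    exact hsodd i x hx)
  -- The pairing equals `1`, so the cup product cannot vanish on all small lists. On such a list
  -- every component of `f` fails to keep one strict sign, hence is small, against the minimum `m`
  -- of `‖f‖`.
  have h2 : ∃ l, SmallList X (δ / 2) l ∧ cup (List.ofFn s) l ≠ 0 := by
    by_contra! h
    have := hsupp _ h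
    rw [h1] at this
    exact one_ne_zero this
  obtain ⟨l, hl, hcup⟩ := h2
  obtain ⟨y, hy⟩ : ∃ y, y ∈ l := by
    rcases l with _ | ⟨y, t⟩
    · cases hs : List.ofFn s <;> simp [cup, hs] at hcup
    · exact ⟨y, by simp⟩
  have hclose : ∀ u ∈ l, ∀ v ∈ l, ∀ i, |f u i - f v i| < m / 3 := by
    intro u hu v hv i
    have h3 := hδf u (hl.1 u hu) v (hl.1 v hv) (lt_of_le_of_lt (hl.2 u hu v hv) (by linarith))
    rw [dist_eq_norm] at h3
    exact lt_of_le_of_lt (norm_le_pi_norm (f u - f v) i) h3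
  have hsmall : ∀ i, |f y i| ≤ 2 * (m / 3) := by
    intro i
    obtain ⟨u, hu, v, hv, huv⟩ := exists_ne_of_cup_ne_zero hcup
      ((List.mem_ofFn' s (s i)).2 ⟨i, rfl⟩)
    have h4 := abs_lt.1 (hclose u hu v hv i)
    have h5 := abs_lt.1 (hclose y hy u hu i)
    have h6 : ¬(0 < f u i ∧ 0 < f v i) := fun h => huv (by simp [s, h.1, h.2])
    have h7 : ¬(f u i < 0 ∧ f v i < 0) := fun h => huv (by
      simp only [s]
      rw [if_neg (not_lt.2 h.1.le), if_pos h.1, if_neg (not_lt.2 h.2.le), if_pos h.2])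
    have h8 : |f u i| ≤ m / 3 := by
      rw [abs_le]
      constructor
      · by_contra! hc
        exact h7 ⟨by linarith, by linarith [h4.1]⟩
      · by_contra! hc
        exact h6 ⟨by linarith, by linarith [h4.2]⟩
    have h9 := abs_le.1 h8
    exact abs_le.2 ⟨by linarith [h9.1, h5.1], by linarith [h9.2, h5.2]⟩
  have h10 : ‖f y‖ ≤ 2 * (m / 3) := (pi_norm_le_iff_of_nonneg (by positivity)).2 hsmall
  have h11 : m ≤ ‖f y‖ := hmin (hl.1 y hy)
  linarith

/-- **Borsuk–Ulam**: an odd continuous map from the `n`-sphere to `ℝ^n` has a zero. -/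
theorem exists_zero_sphere (n : ℕ) (f : EuclideanSpace ℝ (Fin (n + 1)) → Fin n → ℝ)
    (hf : ContinuousOn f (Metric.sphere 0 1)) (hodd : ∀ x ∈ Metric.sphere 0 1, f (-x) = -f x) :
    ∃ x ∈ Metric.sphere 0 1, f x = 0 := by
  -- Radial projection of the cross-polytope to the sphere is odd and continuous, which transfers
  -- the result.
  let ν : (Fin (n + 1) → ℝ) → EuclideanSpace ℝ (Fin (n + 1)) := fun x =>
    ‖WithLp.toLp 2 x‖⁻¹ • WithLp.toLp 2 x
  have hne : ∀ x ∈ crossPolytope n n, WithLp.toLp 2 x ≠ 0 := by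
    intro x hx h
    have : x = 0 := by simpa using congrArg WithLp.ofLp h
    have h1 := hx.1
    simp [this] at h1
  have hν : ∀ x ∈ crossPolytope n n, ν x ∈ Metric.sphere (0 : EuclideanSpace ℝ (Fin (n + 1))) 1 := by
    intro x hx
    simp [ν, norm_smul, inv_mul_cancel₀ (norm_ne_zero_iff.2 (hne x hx))]
  have hνc : ContinuousOn ν (crossPolytope n n) := by
    have h1 : Continuous fun x : Fin (n + 1) → ℝ => WithLp.toLp 2 x := PiLp.continuous_toLp 2 _
    exact (h1.norm.continuousOn.inv₀ fun x hx => norm_ne_zero_iff.2 (hne x hx)).smul h1.continuousOn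
  obtain ⟨x, hx, hfx⟩ := exists_zero_crossPolytope n (fun x => f (ν x)) (hf.comp hνc hν) (by
    intro x hx
    have : ν (-x) = -ν x := by simp [ν]
    simp only [this]
    exact hodd _ (hν x hx))
  exact ⟨ν x, hν x hx, hfx⟩

end BorsukUlam

end

noncomputable section

/-! ### Even functionals on a level set of a quadratic form -/

namespace ConstrainedCrit

/-- Second order Taylor estimate for a functional with Lipschitz gradient on a ball. -/
lemma taylor_le {H : Type*} [NormedAddCommGroup H] [InnerProductSpace ℝ H] {g : H → H} {E : H → ℝ} (hE : ∀ u, HasFDerivAt E (innerSL ℝ (g u)) u) {L R : ℝ} (hL0 : 0 ≤ L)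
    (hL : ∀ u v, ‖u‖ ≤ R → ‖v‖ ≤ R → ‖g u - g v‖ ≤ L * ‖u - v‖) {u z : H} (hu : ‖u‖ ≤ R)
    (hz : ‖z‖ ≤ R) : E z ≤ E u + inner ℝ (g u) (z - u) + L * ‖z - u‖ ^ 2 := by
  have hseg : ∀ x ∈ segment ℝ u z, ‖x‖ ≤ R ∧ ‖x - u‖ ≤ ‖z - u‖ := by
    intro x hx
    have h1 := (convex_closedBall (0 : H) R).segment_subset (by simpa using hu) (by simpa using hz) hx
    refine ⟨by simpa using h1, ?_⟩
    have h2 := (convex_closedBall u ‖z - u‖).segment_subset (x := u) (y := z) (by simp)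
      (by simp [dist_eq_norm]) hx
    simpa [dist_eq_norm] using h2
  -- The mean value inequality for `E` minus its linearisation at `u`. It gives the constant `L` in
  -- place of the sharp `L / 2`, which is enough.
  have h := (convex_segment u z).norm_image_sub_le_of_norm_hasFDerivWithin_le'
    (f := E) (f' := fun x => innerSL ℝ (g x)) (φ := innerSL ℝ (g u)) (C := L * ‖z - u‖)
    (fun x _ => (hE x).hasFDerivWithinAt) (fun x hx => ?_) (left_mem_segment ℝ u z)
    (right_mem_segment ℝ u z)
  · have h3 := (abs_le.1 h).2
    simp only [innerSL_apply_apply] at h3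
    nlinarith
  · rw [← map_sub, innerSL_apply_norm]
    exact (hL x u (hseg x hx).1 hu).trans (by gcongr; exact (hseg x hx).2)

variable {H F : Type*} [NormedAddCommGroup H] [InnerProductSpace ℝ H] [CompleteSpace H]
  [NormedAddCommGroup F] [InnerProductSpace ℝ F] [CompleteSpace F]

open ContinuousLinearMap

/-- The gradient of `½‖J u‖²`. -/
def massGrad (J : H →L[ℝ] F) (u : H) : H := adjoint J (J u)

/-- The multiplier `⟪g u, T u⟫ / ‖T u‖²`, where `T u` is the gradient of the mass. -/
def multiplier (J : H →L[ℝ] F) (g : H → H) (u : H) : ℝ :=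
  inner ℝ (g u) (massGrad J u) / ‖massGrad J u‖ ^ 2

/-- The tangential part of the vector field `g`. -/
def tgrad (J : H →L[ℝ] F) (g : H → H) (u : H) : H :=
  g u - multiplier J g u • massGrad J u

/-- A gradient step followed by the projection to the level set `‖J u‖² = c`. -/
def descend (J : H →L[ℝ] F) (g : H → H) (c τ : ℝ) (u : H) : H :=
  (√c / ‖J (u - τ • tgrad J g u)‖) • (u - τ • tgrad J g u)

lemma inner_massGrad (J : H →L[ℝ] F) (u v : H) : inner ℝ (massGrad J u) v = inner ℝ (J u) (J v) := by
  rw [massGrad, adjoint_inner_left]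

lemma massGrad_neg (J : H →L[ℝ] F) (u : H) : massGrad J (-u) = -massGrad J u := by
  simp [massGrad]

lemma massGrad_ne_zero {J : H →L[ℝ] F} {u : H} {c : ℝ} (hc : 0 < c) (hu : ‖J u‖ ^ 2 = c) :
    massGrad J u ≠ 0 := by
  intro h
  have h1 := inner_massGrad J u u
  rw [h, inner_zero_left, real_inner_self_eq_norm_sq, hu] at h1
  exact hc.ne h1

variable {J : H →L[ℝ] F} {g : H → H}

lemma inner_massGrad_tgrad (u : H) : inner ℝ (massGrad J u) (tgrad J g u) = 0 := by
  rw [tgrad, inner_sub_right, inner_smul_right, real_inner_self_eq_norm_sq, multiplier,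
    real_inner_comm]
  by_cases h : massGrad J u = 0
  · simp [h]
  · have : ‖massGrad J u‖ ^ 2 ≠ 0 := pow_ne_zero _ (norm_ne_zero_iff.2 h)
    rw [div_mul_cancel₀ _ this, sub_self]

/-- `tgrad` is the orthogonal projection of `g u` to the tangent space. This identity is why a step
along `-tgrad` lowers the functional at rate `‖tgrad‖²`. -/
lemma inner_tgrad (u : H) : inner ℝ (g u) (tgrad J g u) = ‖tgrad J g u‖ ^ 2 := by
  have h1 : g u = tgrad J g u + multiplier J g u • massGrad J u := by simp [tgrad]
  conv_lhs => rw [h1]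
  rw [inner_add_left, real_inner_smul_left, inner_massGrad_tgrad, mul_zero, add_zero,
    real_inner_self_eq_norm_sq]

lemma norm_tgrad_le (u : H) : ‖tgrad J g u‖ ≤ ‖g u‖ := by
  by_contra! h
  have h1 := real_inner_le_norm (g u) (tgrad J g u)
  rw [inner_tgrad] at h1
  nlinarith [norm_nonneg (g u)]

lemma tgrad_neg (hg : ∀ u, g (-u) = -g u) (u : H) : tgrad J g (-u) = -tgrad J g u := by
  simp [tgrad, multiplier, massGrad_neg, hg]
  abel

lemma descend_neg (hg : ∀ u, g (-u) = -g u) (c τ : ℝ) (u : H) :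
    descend J g c τ (-u) = -descend J g c τ u := by
  have h : -u - τ • tgrad J g (-u) = -(u - τ • tgrad J g u) := by
    rw [tgrad_neg hg]; module
  simp only [descend, h, map_neg, norm_neg, smul_neg]

lemma continuousAt_tgrad (hg : Continuous g) {u : H} (hu : massGrad J u ≠ 0) :
    ContinuousAt (tgrad J g) u := by
  have hT : Continuous (massGrad J) := (adjoint J).continuous.comp J.continuous
  refine hg.continuousAt.sub (ContinuousAt.smul ?_ hT.continuousAt)
  exact (hg.inner hT).continuousAt.div (hT.norm.pow 2).continuousAt
    (pow_ne_zero _ (norm_ne_zero_iff.2 hu))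

/-- Tangency kills the term linear in `τ`. The step never decreases the mass, and changes it only to
second order; hence the rescaling factor in `descend` is at most `1` and second-order close to `1`.
-/
lemma norm_sq_map_step {u : H} {c : ℝ} (hu : ‖J u‖ ^ 2 = c) (τ : ℝ) :
    ‖J (u - τ • tgrad J g u)‖ ^ 2 = c + τ ^ 2 * ‖J (tgrad J g u)‖ ^ 2 := by
  rw [map_sub, map_smul, norm_sub_sq_real, real_inner_smul_right, ← inner_massGrad,
    inner_massGrad_tgrad, hu, norm_smul, mul_pow, Real.norm_eq_abs, sq_abs]
  ring

lemma continuousAt_descend (hg : Continuous g) {u : H} {c : ℝ} (hc : 0 < c) (hu : ‖J u‖ ^ 2 = c)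
    (τ : ℝ) : ContinuousAt (descend J g c τ) u := by
  have h1 : ContinuousAt (fun u => u - τ • tgrad J g u) u :=
    continuousAt_id.sub ((continuousAt_tgrad hg (massGrad_ne_zero hc hu)).const_smul τ)
  have h2 : ContinuousAt (fun u => ‖J (u - τ • tgrad J g u)‖) u :=
    (J.continuous.continuousAt.comp h1).norm
  refine (continuousAt_const.div h2 ?_).smul h1
  intro h0
  have := norm_sq_map_step (g := g) hu τ
  rw [h0] at this
  nlinarith [sq_nonneg τ, sq_nonneg ‖J (tgrad J g u)‖, mul_nonneg (sq_nonneg τ) (sq_nonneg ‖J (tgrad J g u)‖)]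

/-- A step size small with respect to three given bounds. -/
lemma exists_step_size {M D r : ℝ} (hM0 : 0 ≤ M) (hD0 : 0 ≤ D) (hr : 0 < r) :
    ∃ τ > 0, τ ≤ 1 ∧ τ * M < r ∧ τ * D ≤ 1 / 2 := by
  refine ⟨min 1 (min (r / (M + 1)) (1 / (2 * (D + 1)))), by positivity, min_le_left _ _, ?_, ?_⟩
  · have h1 : min 1 (min (r / (M + 1)) (1 / (2 * (D + 1)))) ≤ r / (M + 1) :=
      (min_le_right _ _).trans (min_le_left _ _)
    calc _ ≤ r / (M + 1) * M := by gcongr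
      _ < r / (M + 1) * (M + 1) := by
          have : 0 < r / (M + 1) := by positivity
          nlinarith
      _ = r := div_mul_cancel₀ _ (by positivity)
  · have h1 : min 1 (min (r / (M + 1)) (1 / (2 * (D + 1)))) ≤ 1 / (2 * (D + 1)) :=
      (min_le_right _ _).trans (min_le_right _ _)
    calc _ ≤ 1 / (2 * (D + 1)) * D := by gcongr
      _ ≤ 1 / (2 * (D + 1)) * (D + 1) := by gcongr; linarith
      _ = 1 / 2 := by field_simp

set_option maxHeartbeats 800000 in
/-- A short projected gradient step decreases the functional. -/
lemma exists_descend {E : H → ℝ} (hE : ∀ u, HasFDerivAt E (innerSL ℝ (g u)) u) {L R R₀ M c : ℝ}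
    (hc : 0 < c) (hR₀ : 0 ≤ R₀) (hR : R₀ < R) (hL0 : 0 ≤ L)
    (hL : ∀ u v, ‖u‖ ≤ R → ‖v‖ ≤ R → ‖g u - g v‖ ≤ L * ‖u - v‖) (hM0 : 0 ≤ M)
    (hM : ∀ u, ‖u‖ ≤ R → ‖g u‖ ≤ M) :
    ∃ τ > 0, ∀ u, ‖J u‖ ^ 2 = c → ‖u‖ ≤ R₀ → ‖J (descend J g c τ u)‖ ^ 2 = c ∧
      ‖descend J g c τ u‖ < R ∧ E (descend J g c τ u) ≤ E u - τ / 2 * ‖tgrad J g u‖ ^ 2 := by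
  set κ := ‖J‖ ^ 2 / c with hκ
  have hκ0 : 0 ≤ κ := by positivity
  -- `τ²‖G‖²D` bounds all second-order errors: `κMR` comes from the rescaling to the level set, the
  -- square from the Taylor remainder. With `τD ≤ 1/2` they consume at most half of the gain
  -- `τ‖G‖²`.
  set D := κ * M * R + L * (1 + κ * M * R) ^ 2 with hD
  have hRpos : 0 < R := hR₀.trans_lt hR
  have hD0 : 0 ≤ D := by positivity
  obtain ⟨τ, hτ0, hτ⟩ := exists_step_size hM0 hD0 (sub_pos.2 hR)
  obtain ⟨hτ1, hτM, hτD⟩ := hτ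
  refine ⟨τ, hτ0, fun u hu huR => ?_⟩
  set G := tgrad J g u with hG
  set w := u - τ • G with hw
  set a := √c / ‖J w‖ with ha
  have hzdef : descend J g c τ u = a • w := rfl
  have hJw : ‖J w‖ ^ 2 = c + τ ^ 2 * ‖J G‖ ^ 2 := norm_sq_map_step hu τ
  have hGM : ‖G‖ ≤ M := (norm_tgrad_le u).trans (hM u (huR.trans hR.le))
  have hJwpos : 0 < ‖J w‖ := by
    refine lt_of_le_of_ne (norm_nonneg _) fun h => ?_
    rw [← h] at hJw
    nlinarith [mul_nonneg (sq_nonneg τ) (sq_nonneg ‖J G‖)]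
  have ha0 : 0 ≤ a := by positivity
  have ha2 : a ^ 2 * ‖J w‖ ^ 2 = c := by
    rw [← mul_pow, ha, div_mul_cancel₀ _ hJwpos.ne', Real.sq_sqrt hc.le]
  have ha1 : a ≤ 1 := by
    rw [ha, div_le_one hJwpos]
    refine Real.sqrt_le_iff.2 ⟨hJwpos.le, ?_⟩
    rw [hJw]; nlinarith [mul_nonneg (sq_nonneg τ) (sq_nonneg ‖J G‖)]
  have hJG : ‖J G‖ ^ 2 ≤ ‖J‖ ^ 2 * ‖G‖ ^ 2 := by
    rw [← mul_pow]; gcongr; exact J.le_opNorm G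
  -- From `‖J w‖² = c + τ²‖J G‖²` and `a²‖J w‖² = c`; since `0 ≤ a ≤ 1`, `1 - a ≤ 1 - a²`.
  have h1a : 1 - a ≤ κ * τ ^ 2 * ‖G‖ ^ 2 := by
    have h1 : 1 - a ^ 2 ≤ κ * τ ^ 2 * ‖G‖ ^ 2 := by
      have h2 : (1 - a ^ 2) * c ≤ τ ^ 2 * (‖J‖ ^ 2 * ‖G‖ ^ 2) := by
        have h3 : (1 - a ^ 2) * ‖J w‖ ^ 2 = τ ^ 2 * ‖J G‖ ^ 2 := by
          rw [sub_mul, ha2, hJw]; ring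
        have h4 : (1 - a ^ 2) * c ≤ (1 - a ^ 2) * ‖J w‖ ^ 2 := by
          have : 0 ≤ 1 - a ^ 2 := by nlinarith
          apply mul_le_mul_of_nonneg_left _ this
          rw [hJw]; nlinarith [mul_nonneg (sq_nonneg τ) (sq_nonneg ‖J G‖)]
        have h5 : τ ^ 2 * ‖J G‖ ^ 2 ≤ τ ^ 2 * (‖J‖ ^ 2 * ‖G‖ ^ 2) := by gcongr
        linarith
      rw [← le_div_iff₀ hc] at h2
      calc _ ≤ _ := h2
        _ = _ := by rw [hκ]; ring
    nlinarith
  have hwR : ‖w‖ < R := by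
    have h1 : ‖w‖ ≤ ‖u‖ + τ * ‖G‖ := by
      refine (norm_sub_le _ _).trans ?_
      rw [norm_smul, Real.norm_eq_abs, abs_of_pos hτ0]
    have h2 : τ * ‖G‖ ≤ τ * M := by gcongr
    linarith
  have hzR : ‖a • w‖ < R := by
    rw [norm_smul, Real.norm_eq_abs, abs_of_nonneg ha0]
    nlinarith [norm_nonneg w]
  refine ⟨?_, hzdef ▸ hzR, ?_⟩
  · rw [hzdef, map_smul, norm_smul, mul_pow, Real.norm_eq_abs, sq_abs, ha2]
  rw [hzdef]
  have ht := taylor_le hE hL0 hL (huR.trans hR.le) hzR.le (u := u)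
  have hdiff : a • w - u = -(τ • G) - (1 - a) • w := by rw [hw]; module
  have hgw : |inner ℝ (g u) w| ≤ M * R := by
    refine (abs_real_inner_le_norm _ _).trans ?_
    gcongr
    · exact hM u (huR.trans hR.le)
  have hin : inner ℝ (g u) (a • w - u) ≤ -τ * ‖G‖ ^ 2 + κ * τ ^ 2 * ‖G‖ ^ 2 * (M * R) := by
    rw [hdiff, inner_sub_right, inner_neg_right, inner_smul_right, inner_smul_right, hG,
      inner_tgrad, ← hG]
    have h1 : -((1 - a) * inner ℝ (g u) w) ≤ (1 - a) * (M * R) := by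
      have := (abs_le.1 hgw).1
      nlinarith
    have h2 : (1 - a) * (M * R) ≤ κ * τ ^ 2 * ‖G‖ ^ 2 * (M * R) := by gcongr
    linarith
  have hnorm : ‖a • w - u‖ ≤ τ * ‖G‖ * (1 + κ * M * R) := by
    rw [hdiff]
    refine (norm_sub_le _ _).trans ?_
    rw [norm_neg, norm_smul, norm_smul, Real.norm_eq_abs, Real.norm_eq_abs, abs_of_pos hτ0,
      abs_of_nonneg (by linarith : 0 ≤ 1 - a)]
    have h1 : (1 - a) * ‖w‖ ≤ κ * τ ^ 2 * ‖G‖ ^ 2 * R := by gcongr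
    have h2 : κ * τ ^ 2 * ‖G‖ ^ 2 * R ≤ τ * ‖G‖ * (κ * M * R) := by
      have h3 : κ * τ ^ 2 * ‖G‖ ^ 2 * R = τ * ‖G‖ * (κ * (τ * ‖G‖) * R) := by ring
      rw [h3]
      have h4 : τ * ‖G‖ ≤ M := by nlinarith [norm_nonneg G]
      gcongr
    linarith
  have hnorm2 : L * ‖a • w - u‖ ^ 2 ≤ L * (τ * ‖G‖ * (1 + κ * M * R)) ^ 2 := by gcongr
  have hfin : τ ^ 2 * ‖G‖ ^ 2 * D ≤ τ / 2 * ‖G‖ ^ 2 := by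
    have : τ ^ 2 * ‖G‖ ^ 2 * D = τ * ‖G‖ ^ 2 * (τ * D) := by ring
    rw [this]
    have h1 : τ * ‖G‖ ^ 2 * (τ * D) ≤ τ * ‖G‖ ^ 2 * (1 / 2) := by gcongr
    linarith
  have hexp : τ ^ 2 * ‖G‖ ^ 2 * D = κ * τ ^ 2 * ‖G‖ ^ 2 * (M * R)
      + L * (τ * ‖G‖ * (1 + κ * M * R)) ^ 2 := by rw [hD]; ring
  linarith

/-- **Infinitely many constrained critical points at negative levels** of an even functional `E`
on `{‖J u‖² = c, ‖u‖ < R}`, when `E` satisfies the Palais–Smale condition at negative levels. -/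
theorem exists_seq_critical [TopologicalSpace.SeparableSpace H] {E : H → ℝ}
    (hE : ∀ u, HasFDerivAt E (innerSL ℝ (g u)) u)
    (hg : ∀ u, g (-u) = -g u)
    (hLip : ∀ r, ∃ L, 0 ≤ L ∧ ∀ u v, ‖u‖ ≤ r → ‖v‖ ≤ r → ‖g u - g v‖ ≤ L * ‖u - v‖)
    {c R R₀ : ℝ} (hc : 0 < c) (hR₀ : 0 ≤ R₀) (hR : R₀ < R)
    (hV : ∀ u, ‖J u‖ ^ 2 = c → ‖u‖ < R → E u < 0 → ‖u‖ ≤ R₀)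
    (hPS : ∀ b < 0, ∀ u : ℕ → H, (∀ n, ‖J (u n)‖ ^ 2 = c ∧ ‖u n‖ ≤ R₀ ∧ E (u n) < 0) →
      Tendsto (fun n => E (u n)) atTop (𝓝 b) → Tendsto (fun n => tgrad J g (u n)) atTop (𝓝 0) →
      ∃ f : Filter ℕ, f.NeBot ∧ f ≤ atTop ∧ ∃ v, Tendsto u f (𝓝 v))
    (hweak : ∀ b < 0, ∀ u : ℕ → H, (∀ n, ‖J (u n)‖ ^ 2 = c ∧ ‖u n‖ ≤ R₀ ∧ E (u n) ≤ b) →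
      ¬ ∀ v, Tendsto (fun n => inner ℝ (u n) v) atTop (𝓝 0))
    (hsph : ∀ k : ℕ, ∃ h : EuclideanSpace ℝ (Fin (k + 1)) → H,
      ContinuousOn h (Metric.sphere 0 1) ∧ ∀ x ∈ Metric.sphere 0 1,
        h (-x) = -h x ∧ ‖J (h x)‖ ^ 2 = c ∧ ‖h x‖ < R ∧ E (h x) < 0) :
    ∃ u : ℕ → H, (∀ j, ‖J (u j)‖ ^ 2 = c ∧ ‖u j‖ < R ∧ E (u j) < 0 ∧ tgrad J g (u j) = 0) ∧
      StrictMono (fun j => E (u j)) ∧ Tendsto (fun j => E (u j)) atTop (𝓝 0) := by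
  have hgc : Continuous g := by
    rw [continuous_iff_continuousAt]
    intro u
    obtain ⟨L, hL0, hL⟩ := hLip (‖u‖ + 1)
    rw [ContinuousAt, tendsto_iff_norm_sub_tendsto_zero]
    refine squeeze_zero_norm' (a := fun v => L * ‖v - u‖) ?_ ?_
    · filter_upwards [Metric.ball_mem_nhds u one_pos] with v hv
      rw [norm_norm]
      refine hL v u ?_ (by linarith)
      have h1 : ‖v - u‖ < 1 := by simpa [dist_eq_norm] using hv
      have h2 := norm_le_norm_add_norm_sub' v u
      linarith
    · have : Continuous fun v => L * ‖v - u‖ := by fun_prop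
      simpa using this.tendsto u
  have hEc : Continuous E := continuous_iff_continuousAt.2 fun u => (hE u).continuousAt
  obtain ⟨L, hL0, hL⟩ := hLip R
  have hRpos : 0 < R := hR₀.trans_lt hR
  set M := ‖g 0‖ + L * R with hMdef
  have hM0 : 0 ≤ M := by positivity
  have hM : ∀ u, ‖u‖ ≤ R → ‖g u‖ ≤ M := by
    intro u hu
    have h1 := hL u 0 hu (by simpa using hRpos.le)
    have h2 := norm_le_norm_add_norm_sub' (g u) (g 0)
    rw [sub_zero] at h1
    have h3 : L * ‖u‖ ≤ L * R := by gcongr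
    linarith
  obtain ⟨τ, hτ, hdesc⟩ := exists_descend (J := J) hE hc hR₀ hR hL0 hL hM0 hM
  -- `E` is bounded below on the ball
  have hbelow : ∀ u, ‖u‖ ≤ R → E 0 - M * R - L * R ^ 2 ≤ E u := by
    intro u hu
    have h1 := taylor_le hE hL0 hL hu (z := 0) (by simpa using hRpos.le)
    have h2 := (abs_le.1 (abs_real_inner_le_norm (g u) (0 - u))).2
    simp only [zero_sub, norm_neg] at h1 h2
    have h3 : ‖g u‖ * ‖u‖ ≤ M * R := by gcongr; exact hM u hu
    have h4 : L * ‖u‖ ^ 2 ≤ L * R ^ 2 := by gcongr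
    linarith
  let S : (k : ℕ) → Set (EuclideanSpace ℝ (Fin (k + 1))) := fun k => Metric.sphere 0 1
  let Adm : (k : ℕ) → (EuclideanSpace ℝ (Fin (k + 1)) → H) → Prop := fun k h =>
    ContinuousOn h (S k) ∧ ∀ x ∈ S k, h (-x) = -h x ∧ ‖J (h x)‖ ^ 2 = c ∧ ‖h x‖ < R ∧ E (h x) < 0
  -- The upper bounds of the energy over images of admissible odd maps of `S^k`; the infimum `a k`
  -- of this set is the minimax level.
  let A : ℕ → Set ℝ := fun k => {a | ∃ h, Adm k h ∧ ∀ x ∈ S k, E (h x) ≤ a}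
  have hSne : ∀ k, (S k).Nonempty := fun k =>
    NormedSpace.sphere_nonempty.2 zero_le_one
  have hAb : ∀ k, BddBelow (A k) := by
    intro k
    refine ⟨E 0 - M * R - L * R ^ 2, ?_⟩
    rintro a ⟨h, hh, ha⟩
    obtain ⟨x, hx⟩ := hSne k
    exact (hbelow (h x) (hh.2 x hx).2.2.1.le).trans (ha x hx)
  have hAneg : ∀ k, ∃ a ∈ A k, a < 0 := by
    intro k
    obtain ⟨h, hh⟩ := hsph k
    obtain ⟨x, hx, hmax⟩ := (isCompact_sphere (0 : EuclideanSpace ℝ (Fin (k + 1))) 1).exists_isMaxOn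
      (hSne k) (hEc.comp_continuousOn hh.1)
    exact ⟨E (h x), ⟨h, hh, fun y hy => hmax hy⟩, (hh.2 x hx).2.2.2⟩
  let a : ℕ → ℝ := fun k => sInf (A k)
  have haneg : ∀ k, a k < 0 := by
    intro k
    obtain ⟨b, hb, hb0⟩ := hAneg k
    exact (csInf_le (hAb k) hb).trans_lt hb0
  have hcrit : ∀ k, ∃ u, ‖J u‖ ^ 2 = c ∧ ‖u‖ < R ∧ E u = a k ∧ tgrad J g u = 0 := by
    intro k
    have hseq : ∀ n : ℕ, ∃ u, ‖J u‖ ^ 2 = c ∧ ‖u‖ ≤ R₀ ∧ E u < 0 ∧ |E u - a k| ≤ 1 / (n + 1 : ℝ) ∧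
        ‖tgrad J g u‖ ≤ 1 / (n + 1 : ℝ) := by
      intro n
      by_contra! hcon
      set δ : ℝ := 1 / (n + 1 : ℝ) with hδ
      have hδ0 : 0 < δ := by positivity
      have hη0 : 0 < min δ (τ / 2 * δ ^ 2) := by positivity
      obtain ⟨b, ⟨h, hh, hb⟩, hba⟩ := exists_lt_of_csInf_lt ⟨_, (hAneg k).choose_spec.1⟩
        (lt_add_of_pos_right (a k) (half_pos hη0))
      have hstep : ∀ x ∈ S k, ‖h x‖ ≤ R₀ := fun x hx =>
        hV _ (hh.2 x hx).2.1 (hh.2 x hx).2.2.1 (hh.2 x hx).2.2.2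
      -- One descent step applied to an almost optimal map. Points with energy within `δ` of `a k`
      -- have gradient larger than `δ` and lose at least `τδ²/2`. The others lie below `a k - δ`,
      -- since `h` never exceeds `a k` by more than half the minimum. Either way the new maximum is
      -- below the infimum `a k`. The step stays admissible because negative energy forces `‖h x‖ ≤
      -- R₀`.
      have hmem : a k - min δ (τ / 2 * δ ^ 2) / 2 ∈ A k := by
        refine ⟨fun x => descend J g c τ (h x), ⟨?_, ?_⟩, ?_⟩
        · intro x hx
          exact (continuousAt_descend hgc hc (hh.2 x hx).2.1 τ).comp_continuousWithinAt (hh.1 x hx)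
        · intro x hx
          obtain ⟨h1, h2, h3⟩ := hdesc (h x) (hh.2 x hx).2.1 (hstep x hx)
          refine ⟨?_, h1, h2, ?_⟩
          · simp only [(hh.2 x hx).1, descend_neg hg]
          · have : 0 ≤ τ / 2 * ‖tgrad J g (h x)‖ ^ 2 := by positivity
            have := (hh.2 x hx).2.2.2
            linarith
        · intro x hx
          obtain ⟨-, -, h3⟩ := hdesc (h x) (hh.2 x hx).2.1 (hstep x hx)
          have hbx := hb x hx
          have hm1 := min_le_left δ (τ / 2 * δ ^ 2)
          have hm2 := min_le_right δ (τ / 2 * δ ^ 2)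
          by_cases hcase : |E (h x) - a k| ≤ δ
          · have h4 := hcon (h x) (hh.2 x hx).2.1 (hstep x hx) (hh.2 x hx).2.2.2 hcase
            have h5 : τ / 2 * δ ^ 2 ≤ τ / 2 * ‖tgrad J g (h x)‖ ^ 2 := by gcongr
            linarith
          · have h5 : 0 ≤ τ / 2 * ‖tgrad J g (h x)‖ ^ 2 := by positivity
            rw [abs_le, not_and_or, not_le, not_le] at hcase
            rcases hcase with h6 | h6 <;> linarith
      have := csInf_le (hAb k) hmem
      change a k ≤ _ at this
      linarith
    choose u h1 h2 h3 h4 h5 using hseq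
    have hlim0 : Tendsto (fun n : ℕ => 1 / (n + 1 : ℝ)) atTop (𝓝 0) :=
      tendsto_one_div_add_atTop_nhds_zero_nat
    have hEl : Tendsto (fun n => E (u n)) atTop (𝓝 (a k)) := by
      rw [tendsto_iff_norm_sub_tendsto_zero]
      exact squeeze_zero (fun _ => norm_nonneg _) h4 hlim0
    have hGl : Tendsto (fun n => tgrad J g (u n)) atTop (𝓝 0) :=
      squeeze_zero_norm h5 hlim0
    obtain ⟨f, hf, hfle, v, hv⟩ := hPS (a k) (haneg k) u (fun n => ⟨h1 n, h2 n, h3 n⟩) hEl hGl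
    have hJv : ‖J v‖ ^ 2 = c := by
      have := (((J.continuous.tendsto v).comp hv).norm.pow 2)
      refine tendsto_nhds_unique this ?_
      simp only [Function.comp_apply, h1]
      exact tendsto_const_nhds
    refine ⟨v, hJv, ?_, ?_, ?_⟩
    · exact (le_of_tendsto hv.norm (Eventually.of_forall h2)).trans_lt hR
    · exact tendsto_nhds_unique ((hEc.tendsto v).comp hv) (hEl.mono_left hfle)
    · exact tendsto_nhds_unique
        ((continuousAt_tgrad hgc (massGrad_ne_zero hc hJv)).tendsto.comp hv) (hGl.mono_left hfle)
  have hlub : IsLUB (Set.range a) 0 := by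
    refine ⟨?_, ?_⟩
    · rintro _ ⟨k, rfl⟩; exact (haneg k).le
    · intro b hb
      by_contra! hb0
      have hsel : ∀ k, ∃ u : H, ‖J u‖ ^ 2 = c ∧ ‖u‖ ≤ R₀ ∧ E u ≤ b / 2 ∧
          ∀ i < k, inner ℝ u (TopologicalSpace.denseSeq H i) = 0 := by
        intro k
        have hk : a k < b / 2 := lt_of_le_of_lt (hb ⟨k, rfl⟩) (by linarith)
        obtain ⟨b', ⟨h, hh, hb'⟩, hba⟩ := exists_lt_of_csInf_lt ⟨_, (hAneg k).choose_spec.1⟩ hk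
        -- The `k` inner products with the first `k` vectors of a dense sequence form an odd map
        -- from `S^k` to `ℝ^k`, so some point of the image is orthogonal to all of them.
        obtain ⟨x, hx, hx0⟩ := BorsukUlam.exists_zero_sphere k
          (fun x i => inner ℝ (h x) (TopologicalSpace.denseSeq H i))
          (continuousOn_pi.2 fun i => hh.1.inner continuousOn_const)
          (fun x hx => by
            funext i
            simp only [(hh.2 x hx).1, inner_neg_left, Pi.neg_apply])
        refine ⟨h x, (hh.2 x hx).2.1, hV _ (hh.2 x hx).2.1 (hh.2 x hx).2.2.1 (hh.2 x hx).2.2.2,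
          (hb' x hx).trans hba.le, fun i hi => ?_⟩
        exact congrFun hx0 ⟨i, hi⟩
      choose u h1 h2 h3 h4 using hsel
      refine hweak (b / 2) (by linarith) u (fun n => ⟨h1 n, h2 n, h3 n⟩) fun v => ?_
      rw [Metric.tendsto_atTop]
      intro ε hε
      obtain ⟨i, hi⟩ := (TopologicalSpace.denseRange_denseSeq H).exists_dist_lt v
        (show 0 < ε / (R₀ + 1) by positivity)
      refine ⟨i + 1, fun n hn => ?_⟩
      have h5 : inner ℝ (u n) v = inner ℝ (u n) (v - TopologicalSpace.denseSeq H i) := by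
        rw [inner_sub_right, h4 n i (by omega), sub_zero]
      rw [Real.dist_eq, sub_zero, h5]
      rw [dist_eq_norm] at hi
      calc _ ≤ ‖u n‖ * ‖v - TopologicalSpace.denseSeq H i‖ := abs_real_inner_le_norm _ _
        _ ≤ R₀ * (ε / (R₀ + 1)) := by gcongr; exact h2 n
        _ < ε := by
          rw [mul_div_assoc', div_lt_iff₀ (by positivity)]
          nlinarith
  -- Levels with different `k` may coincide. Their supremum `0` is not attained, so a strictly
  -- increasing sequence of levels can be extracted, and no multiplicity count is needed.
  obtain ⟨b, hbmono, hblt, hbtend, hbmem⟩ := hlub.exists_seq_strictMono_tendsto_of_notMem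
    (by rintro ⟨k, hk⟩; exact (haneg k).ne hk) (Set.range_nonempty a)
  choose k hk using hbmem
  choose u h1 h2 h3 h4 using fun j => hcrit (k j)
  have h5 : ∀ j, E (u j) = b j := fun j => (h3 j).trans (hk j)
  refine ⟨u, fun j => ⟨h1 j, h2 j, by rw [h5]; exact hblt j, h4 j⟩, ?_, ?_⟩
  · simpa only [h5] using hbmono
  · simpa only [h5] using hbtend

end ConstrainedCrit

end

noncomputable section

/-! ### Basic properties of `H²` -/

instance fact_two_ne_top : Fact ((2 : ENNReal) ≠ ⊤) := ⟨by simp⟩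

section Pairing

variable {N : ℕ}

lemma integral_mul_eq_inner (u : L2Fun N) {ψ : RN N → ℝ} (hψ : MemLp ψ 2 volume) :
    ∫ x, u x * ψ x = inner ℝ (hψ.toLp ψ) u := by
  rw [L2.inner_def]
  refine integral_congr_ae ?_
  filter_upwards [hψ.coeFn_toLp] with x hx
  rw [hx]; rfl

lemma memLp_smul_const {ψ : RN N → ℝ} (hψ : MemLp ψ 2 volume) (v : RN N) :
    MemLp (fun x => ψ x • v) 2 volume := by
  refine MemLp.of_le_mul (c := ‖v‖) hψ (hψ.1.smul_const v) (Eventually.of_forall fun x => ?_)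
  rw [norm_smul, mul_comm]

lemma integral_inner_mul_eq_inner (g : L2Vec N) (v : RN N) {ψ : RN N → ℝ} (hψ : MemLp ψ 2 volume) :
    ∫ x, inner ℝ (g x) v * ψ x = inner ℝ ((memLp_smul_const hψ v).toLp _) g := by
  rw [L2.inner_def]
  refine integral_congr_ae ?_
  filter_upwards [(memLp_smul_const hψ v).coeFn_toLp] with x hx
  rw [hx, real_inner_smul_left, real_inner_comm]
  ring

/-- For each fixed test function the weak identities equate two continuous `L²` pairings, so the
graph is an intersection of closed sets. Completeness of `H²` follows. -/
lemma isClosed_H2Graph : IsClosed (H2Graph N : Set (WithLp 2 (L2Fun N × WithLp 2 (L2Vec N × L2Fun N)))) := by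
  have e : (H2Graph N : Set (WithLp 2 (L2Fun N × WithLp 2 (L2Vec N × L2Fun N))))
      = {U | IsWeakGradient U.fst U.snd.fst ∧ IsWeakLaplacian U.fst U.snd.snd} := rfl
  have c1 : Continuous fun U : WithLp 2 (L2Fun N × WithLp 2 (L2Vec N × L2Fun N)) => U.fst :=
    (WithLp.fstL 2 ℝ (L2Fun N) (WithLp 2 (L2Vec N × L2Fun N))).continuous
  have c2 : Continuous fun U : WithLp 2 (L2Fun N × WithLp 2 (L2Vec N × L2Fun N)) => U.snd :=
    (WithLp.sndL 2 ℝ (L2Fun N) (WithLp 2 (L2Vec N × L2Fun N))).continuous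
  have c3 : Continuous fun U : WithLp 2 (L2Fun N × WithLp 2 (L2Vec N × L2Fun N)) => U.snd.fst :=
    (WithLp.fstL 2 ℝ (L2Vec N) (L2Fun N)).continuous.comp c2
  have c4 : Continuous fun U : WithLp 2 (L2Fun N × WithLp 2 (L2Vec N × L2Fun N)) => U.snd.snd :=
    (WithLp.sndL 2 ℝ (L2Vec N) (L2Fun N)).continuous.comp c2
  rw [e, Set.ofPred_and]
  refine IsClosed.inter ?_ ?_
  · simp only [IsWeakGradient, Set.ofPred_forall]
    refine isClosed_iInter fun φ => isClosed_iInter fun h => isClosed_iInter fun hc =>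
      isClosed_iInter fun v => ?_
    simp only [integral_mul_eq_inner _ (testFun_fderiv_memLp h hc v),
      integral_inner_mul_eq_inner _ v (testFun_memLp h hc)]
    exact isClosed_eq (continuous_const.inner c1) (continuous_const.inner c3).neg
  · simp only [IsWeakLaplacian, Set.ofPred_forall]
    refine isClosed_iInter fun φ => isClosed_iInter fun h => isClosed_iInter fun hc => ?_
    simp only [integral_mul_eq_inner _ (testFun_laplacian_memLp h hc),
      integral_mul_eq_inner _ (testFun_memLp h hc)]
    exact isClosed_eq (continuous_const.inner c1) (continuous_const.inner c4)

end Pairing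

namespace H2

variable {N : ℕ}

instance : CompleteSpace (H2 N) := isClosed_H2Graph.completeSpace_coe

instance : SecondCountableTopology (H2 N) := by
  have h1 : SecondCountableTopology (L2Fun N) := inferInstance
  have h2 : SecondCountableTopology (L2Vec N) := inferInstance
  have h3 : SecondCountableTopology (WithLp 2 (L2Vec N × L2Fun N)) :=
    (WithLp.homeomorphProd 2 (L2Vec N) (L2Fun N)).secondCountableTopology
  have h4 : SecondCountableTopology (WithLp 2 (L2Fun N × WithLp 2 (L2Vec N × L2Fun N))) :=
    (WithLp.homeomorphProd 2 (L2Fun N) (WithLp 2 (L2Vec N × L2Fun N))).secondCountableTopology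
  exact TopologicalSpace.Subtype.secondCountableTopology _

/-- The function underlying an element of `H²`, as a continuous linear map. -/
def fnL : H2 N →L[ℝ] L2Fun N :=
  (WithLp.fstL 2 ℝ (L2Fun N) (WithLp 2 (L2Vec N × L2Fun N))).comp (H2Graph N).subtypeL

/-- The gradient, as a continuous linear map. -/
def gradL : H2 N →L[ℝ] L2Vec N :=
  ((WithLp.fstL 2 ℝ (L2Vec N) (L2Fun N)).comp
    (WithLp.sndL 2 ℝ (L2Fun N) (WithLp 2 (L2Vec N × L2Fun N)))).comp (H2Graph N).subtypeL

/-- The Laplacian, as a continuous linear map. -/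
def lapL : H2 N →L[ℝ] L2Fun N :=
  ((WithLp.sndL 2 ℝ (L2Vec N) (L2Fun N)).comp
    (WithLp.sndL 2 ℝ (L2Fun N) (WithLp 2 (L2Vec N × L2Fun N)))).comp (H2Graph N).subtypeL

@[simp] lemma fnL_apply (u : H2 N) : fnL u = u.fn := rfl
@[simp] lemma gradL_apply (u : H2 N) : gradL u = u.grad := rfl
@[simp] lemma lapL_apply (u : H2 N) : lapL u = u.lap := rfl

lemma norm_sq_eq (u : H2 N) : ‖u‖ ^ 2 = ‖u.fn‖ ^ 2 + (‖u.grad‖ ^ 2 + ‖u.lap‖ ^ 2) := by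
  have h1 := WithLp.prod_norm_sq_eq_of_L2 u.1
  have h2 := WithLp.prod_norm_sq_eq_of_L2 u.1.snd
  rw [h2] at h1
  exact h1

lemma isWeakGradient (u : H2 N) : IsWeakGradient u.fn u.grad := u.2.1

lemma isWeakLaplacian (u : H2 N) : IsWeakLaplacian u.fn u.lap := u.2.2

lemma norm_fn_le (u : H2 N) : ‖u.fn‖ ≤ ‖u‖ := by
  have h := norm_sq_eq u
  refine abs_le_of_sq_le_sq' ?_ (norm_nonneg u) |>.2
  nlinarith [sq_nonneg ‖u.grad‖, sq_nonneg ‖u.lap‖]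

lemma norm_grad_le (u : H2 N) : ‖u.grad‖ ≤ ‖u‖ := by
  have h := norm_sq_eq u
  refine abs_le_of_sq_le_sq' ?_ (norm_nonneg u) |>.2
  nlinarith [sq_nonneg ‖u.fn‖, sq_nonneg ‖u.lap‖]

lemma norm_lap_le (u : H2 N) : ‖u.lap‖ ≤ ‖u‖ := by
  have h := norm_sq_eq u
  refine abs_le_of_sq_le_sq' ?_ (norm_nonneg u) |>.2
  nlinarith [sq_nonneg ‖u.grad‖, sq_nonneg ‖u.fn‖]

/-- An element of `H²` is determined by the underlying function. -/
lemma eq_zero_of_fn_eq_zero {u : H2 N} (h : u.fn = 0) : u = 0 := by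
  have hloc : LocallyIntegrable u.lap volume := (Lp.memLp u.lap).locallyIntegrable one_le_two
  have h1 : u.lap = 0 := by
    rw [Lp.eq_zero_iff_ae_eq_zero]
    refine ae_eq_zero_of_integral_contDiff_smul_eq_zero hloc fun φ hφ hc => ?_
    have h2 := u.isWeakLaplacian φ hφ hc
    rw [h, l2_integral_zero] at h2
    simp only [smul_eq_mul]
    rw [h2]
    exact integral_congr_ae (Eventually.of_forall fun x => mul_comm _ _)
  have h3 : u.grad = 0 := by
    rw [Lp.eq_zero_iff_ae_eq_zero]
    refine ae_eq_zero_of_integral_contDiff_smul_eq_zero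
      ((Lp.memLp u.grad).locallyIntegrable one_le_two) fun φ hφ hc => ?_
    refine ext_inner_right ℝ fun v => ?_
    have h2 := u.isWeakGradient φ hφ hc v
    rw [h, l2_integral_zero, zero_eq_neg] at h2
    have hInt : Integrable (fun x => φ x • u.grad x) volume := by
      exact memLp_one_iff_integrable.1 ((Lp.memLp u.grad).smul (testFun_memLp hφ hc))
    rw [inner_zero_left, real_inner_comm, ← integral_inner hInt, ← h2]
    refine integral_congr_ae (Eventually.of_forall fun x => ?_)
    simp only [real_inner_smul_right, real_inner_comm v]
    ring
  have h4 := norm_sq_eq u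
  rw [h, h1, h3] at h4
  simpa using h4

end H2

/-- Limits of radial functions are radial. -/
lemma isClosed_H2rad (N : ℕ) : IsClosed (H2rad N : Set (H2 N)) := by
  refine isClosed_of_closure_subset fun u hu => ?_
  obtain ⟨w, hw, hlim⟩ := mem_closure_iff_seq_limit.1 hu
  have hlim' : Tendsto (fun n => (w n).fn) atTop (𝓝 u.fn) := (H2.fnL.continuous.tendsto u).comp hlim
  have hmeas := tendstoInMeasure_of_tendsto_Lp hlim'
  obtain ⟨ns, -, hns⟩ := hmeas.exists_seq_tendsto_ae
  choose f hf hfw using hw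
  have hae : ∀ᵐ x : RN N, ∀ n, (w n).fn x = f n ‖x‖ := ae_all_iff.2 hfw
  -- The `limsup` of the profiles along an almost everywhere convergent subsequence is measurable on
  -- the whole line, whether or not the profiles converge at a given radius.
  refine ⟨fun t => limsup (fun n => f (ns n) t) atTop, .limsup fun n => hf (ns n), ?_⟩
  filter_upwards [hae, hns] with x h1 h2
  simp only [h1] at h2
  exact h2.limsup_eq.symm


/-! ### Test functions -/

section TestFunctions

variable {N : ℕ}

/-- Smooth functions with compact support. -/
def IsTest (φ : RN N → ℝ) : Prop := ContDiff ℝ ∞ φ ∧ HasCompactSupport φ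

namespace IsTest

variable {φ ψ : RN N → ℝ}

lemma continuous (h : IsTest φ) : Continuous φ := h.1.continuous

lemma differentiable (h : IsTest φ) : Differentiable ℝ φ := h.1.differentiable (by simp)

lemma memLp (h : IsTest φ) (q : ENNReal) : MemLp φ q volume :=
  h.continuous.memLp_of_hasCompactSupport h.2

lemma integrable (h : IsTest φ) : Integrable φ volume :=
  h.continuous.integrable_of_hasCompactSupport h.2

lemma fderiv_apply (h : IsTest φ) (v : RN N) : IsTest fun x => fderiv ℝ φ x v :=
  ⟨(h.1.fderiv_right (m := ∞) (by simp)).clm_apply contDiff_const, h.2.fderiv_apply ℝ v⟩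

lemma mul_left (h : IsTest φ) (hψ : ContDiff ℝ ∞ ψ) : IsTest fun x => φ x * ψ x :=
  ⟨h.1.mul hψ, h.2.mul_right⟩

lemma add (h : IsTest φ) (hψ : IsTest ψ) : IsTest fun x => φ x + ψ x :=
  ⟨h.1.add hψ.1, h.2.add hψ.2⟩

lemma const_mul (h : IsTest φ) (a : ℝ) : IsTest fun x => a * φ x :=
  ⟨contDiff_const.mul h.1, h.2.mul_left⟩

lemma sum {ι : Type*} (s : Finset ι) {f : ι → RN N → ℝ} (h : ∀ i ∈ s, IsTest (f i)) :
    IsTest fun x => ∑ i ∈ s, f i x := by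
  classical
  induction s using Finset.induction_on with
  | empty =>
    simp only [Finset.sum_empty]
    exact ⟨contDiff_const, HasCompactSupport.zero⟩
  | insert a s ha ih =>
    simp only [Finset.sum_insert ha]
    exact (h a (by simp)).add (ih fun i hi => h i (by simp [hi]))

lemma integral_mul_fderiv (h : IsTest φ) (hψ : IsTest ψ) (v : RN N) :
    ∫ x, φ x * fderiv ℝ ψ x v = -∫ x, fderiv ℝ φ x v * ψ x := by
  refine integral_mul_fderiv_eq_neg_fderiv_mul_of_integrable ?_ ?_ ?_ ?_ ?_
  · exact ((h.fderiv_apply v).mul_left hψ.1).integrable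
  · exact (h.mul_left (hψ.fderiv_apply v).1).integrable
  · exact (h.mul_left hψ.1).integrable
  · exact fun x _ => h.differentiable x
  · exact fun x _ => hψ.differentiable x

end IsTest

/-- The Laplacian is the sum of the second partial derivatives. -/
lemma laplacian_eq_sum {φ : RN N → ℝ} (h : ContDiff ℝ ∞ φ) (x : RN N) :
    Laplacian.laplacian φ x = ∑ i : Fin N,
      fderiv ℝ (fun y => fderiv ℝ φ y (EuclideanSpace.basisFun (Fin N) ℝ i)) x
        (EuclideanSpace.basisFun (Fin N) ℝ i) := by
  rw [InnerProductSpace.laplacian_eq_iteratedFDeriv_orthonormalBasis φ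
    (EuclideanSpace.basisFun (Fin N) ℝ)]
  refine Finset.sum_congr rfl fun i _ => ?_
  have hd : DifferentiableAt ℝ (fderiv ℝ φ) x :=
    (h.fderiv_right (m := ∞) (by simp)).differentiable (by simp) x
  rw [iteratedFDeriv_two_apply, fderiv_clm_apply hd (differentiableAt_const _)]
  simp

namespace IsTest

variable {φ ψ : RN N → ℝ}

lemma laplacian (h : IsTest φ) : IsTest (Laplacian.laplacian φ) := by
  have e : Laplacian.laplacian φ = fun x => ∑ i : Fin N,
      fderiv ℝ (fun y => fderiv ℝ φ y (EuclideanSpace.basisFun (Fin N) ℝ i)) x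
        (EuclideanSpace.basisFun (Fin N) ℝ i) := funext (laplacian_eq_sum h.1)
  rw [e]
  exact IsTest.sum _ fun i _ => (h.fderiv_apply _).fderiv_apply _

lemma integral_mul_laplacian (h : IsTest φ) (hψ : IsTest ψ) :
    ∫ x, φ x * Laplacian.laplacian ψ x = ∫ x, Laplacian.laplacian φ x * ψ x := by
  simp only [laplacian_eq_sum h.1, laplacian_eq_sum hψ.1, Finset.mul_sum, Finset.sum_mul]
  rw [integral_finsetSum, integral_finsetSum]
  · refine Finset.sum_congr rfl fun i _ => ?_
    set e := EuclideanSpace.basisFun (Fin N) ℝ i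
    rw [h.integral_mul_fderiv (hψ.fderiv_apply e) e, (h.fderiv_apply e).integral_mul_fderiv hψ e,
      neg_neg]
  · exact fun i _ => (((h.fderiv_apply _).fderiv_apply _).mul_left hψ.1).integrable
  · exact fun i _ => (h.mul_left ((hψ.fderiv_apply _).fderiv_apply _).1).integrable

lemma continuous_gradient (h : IsTest φ) : Continuous (gradient φ) :=
  (InnerProductSpace.toDual ℝ (RN N)).symm.continuous.comp
    (h.1.continuous_fderiv (by simp))

lemma hasCompactSupport_gradient (h : IsTest φ) : HasCompactSupport (gradient φ) :=
  (h.2.fderiv ℝ).comp_left (g := (InnerProductSpace.toDual ℝ (RN N)).symm) (map_zero _)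

lemma gradient_memLp (h : IsTest φ) : MemLp (gradient φ) 2 volume :=
  h.continuous_gradient.memLp_of_hasCompactSupport h.hasCompactSupport_gradient

end IsTest

/-- A test function as an element of `H²`. -/
def ofTest {φ : RN N → ℝ} (h : IsTest φ) : H2 N :=
  ⟨WithLp.toLp 2 ((h.memLp 2).toLp φ, WithLp.toLp 2 (h.gradient_memLp.toLp _,
    (h.laplacian.memLp 2).toLp _)), by
    refine ⟨fun ψ hψ hc v => ?_, fun ψ hψ hc => ?_⟩
    · have e1 : ∫ x, (h.memLp 2).toLp φ x * fderiv ℝ ψ x v = ∫ x, φ x * fderiv ℝ ψ x v := by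
        refine integral_congr_ae ?_
        filter_upwards [(h.memLp 2).coeFn_toLp] with x hx
        rw [hx]
      have e2 : ∫ x, inner ℝ (h.gradient_memLp.toLp _ x) v * ψ x = ∫ x, fderiv ℝ φ x v * ψ x := by
        refine integral_congr_ae ?_
        filter_upwards [h.gradient_memLp.coeFn_toLp] with x hx
        rw [hx, inner_gradient_left]
      refine e1.trans ((h.integral_mul_fderiv ⟨hψ, hc⟩ v).trans (congrArg Neg.neg e2.symm))
    · have e1 : ∫ x, (h.memLp 2).toLp φ x * Laplacian.laplacian ψ x
          = ∫ x, φ x * Laplacian.laplacian ψ x := by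
        refine integral_congr_ae ?_
        filter_upwards [(h.memLp 2).coeFn_toLp] with x hx
        rw [hx]
      have e2 : ∫ x, (h.laplacian.memLp 2).toLp _ x * ψ x
          = ∫ x, Laplacian.laplacian φ x * ψ x := by
        refine integral_congr_ae ?_
        filter_upwards [(h.laplacian.memLp 2).coeFn_toLp] with x hx
        rw [hx]
      exact e1.trans ((h.integral_mul_laplacian ⟨hψ, hc⟩).trans e2.symm)⟩

lemma ofTest_fn {φ : RN N → ℝ} (h : IsTest φ) : (ofTest h).fn = (h.memLp 2).toLp φ := rfl

lemma ofTest_grad {φ : RN N → ℝ} (h : IsTest φ) : (ofTest h).grad = h.gradient_memLp.toLp _ := rfl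

lemma ofTest_lap {φ : RN N → ℝ} (h : IsTest φ) :
    (ofTest h).lap = (h.laplacian.memLp 2).toLp _ := rfl

lemma ofTest_coeFn {φ : RN N → ℝ} (h : IsTest φ) : (ofTest h).fn =ᵐ[volume] φ :=
  (h.memLp 2).coeFn_toLp

end TestFunctions

end

noncomputable section

/-! ### Mollification in `L²` -/

section Mollify

variable {N : ℕ} {E : Type*} [NormedAddCommGroup E]

lemma eLpNorm_two_sq {α : Type*} [MeasurableSpace α] (μ : Measure α) (f : α → E) :
    eLpNorm f 2 μ ^ 2 = ∫⁻ x, ‖f x‖ₑ ^ 2 ∂μ := by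
  have h := eLpNorm_nnreal_pow_eq_lintegral (f := f) (μ := μ) (p := 2) two_ne_zero
  simpa using h

/-- Jensen's inequality combined with Tonelli's theorem. -/
lemma lintegral_enorm_integral_sq_le [NormedSpace ℝ E] {X Y : Type*} [MeasurableSpace X]
    [MeasurableSpace Y] {μ : Measure X} {ν : Measure Y} [SFinite μ] [IsProbabilityMeasure ν]
    {F : X → Y → E} (hF : StronglyMeasurable (Function.uncurry F)) :
    ∫⁻ x, ‖∫ y, F x y ∂ν‖ₑ ^ 2 ∂μ ≤ ∫⁻ y, ∫⁻ x, ‖F x y‖ₑ ^ 2 ∂μ ∂ν := by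
  rw [← lintegral_lintegral_swap (hF.enorm.pow_const 2).aemeasurable]
  refine lintegral_mono fun x => ?_
  have hFx : StronglyMeasurable (F x) := hF.comp_measurable measurable_prodMk_left
  have h1 := eLpNorm_le_eLpNorm_of_exponent_le (one_le_two) hFx.aestronglyMeasurable (μ := ν)
  rw [eLpNorm_one_eq_lintegral_enorm] at h1
  calc ‖∫ y, F x y ∂ν‖ₑ ^ 2 ≤ (eLpNorm (F x) 2 ν) ^ 2 := by
        gcongr
        exact (enorm_integral_le_lintegral_enorm _).trans h1
    _ = _ := eLpNorm_two_sq ν (F x)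

/-- The mollification of `f` with kernel `η`. -/
def mollify [NormedSpace ℝ E] (η : RN N → ℝ) (f : RN N → E) (x : RN N) : E := ∫ y, η y • f (x - y)

lemma mollify_eq [NormedSpace ℝ E] (η : RN N → ℝ) (f : RN N → E) (x : RN N) :
    mollify η f x = ∫ y, η (x - y) • f y := by
  rw [mollify, ← integral_sub_left_eq_self _ volume x]
  simp

lemma integrable_mollify_integrand [NormedSpace ℝ E] {η : RN N → ℝ} (hη : IsTest η)
    {f : RN N → E} (hf : MemLp f 2 volume) (x : RN N) :
    Integrable (fun y => η y • f (x - y)) volume := by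
  have h1 : MemLp (fun y => f (x - y)) 2 volume :=
    hf.comp_measurePreserving (Measure.measurePreserving_sub_left volume x)
  exact (h1.locallyIntegrable one_le_two).integrable_smul_left_of_hasCompactSupport
    hη.continuous hη.2

lemma isTest_normed (b : ContDiffBump (0 : RN N)) : IsTest (b.normed volume) :=
  ⟨b.contDiff_normed, b.hasCompactSupport_normed⟩

/-- The `L²` distance from `f` to its mollification is bounded by the `L²` modulus of continuity. -/
lemma eLpNorm_mollify_sub_le [NormedSpace ℝ E] [CompleteSpace E] (b : ContDiffBump (0 : RN N)) {f : RN N → E}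
    (hfm : StronglyMeasurable f) (hf : MemLp f 2 volume) {δ : ENNReal}
    (hδ : ∀ y : RN N, ‖y‖ < b.rOut → eLpNorm (fun x => f (x - y) - f x) 2 volume ≤ δ) :
    eLpNorm (fun x => mollify (b.normed volume) f x - f x) 2 volume ≤ δ := by
  set η := b.normed (volume : Measure (RN N)) with hη
  have hηc : Continuous η := b.continuous_normed
  have hmeas : Measurable fun y => ENNReal.ofReal (η y) := hηc.measurable.ennreal_ofReal
  -- The kernel as a probability measure: the difference between mollification and function becomes
  -- an average of `f (x - y) - f x`, to which Jensen's inequality applies.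
  let ν : Measure (RN N) := volume.withDensity fun y => ENNReal.ofReal (η y)
  have hν : IsProbabilityMeasure ν := by
    refine ⟨?_⟩
    rw [withDensity_apply _ MeasurableSet.univ, Measure.restrict_univ,
      ← ofReal_integral_eq_lintegral_ofReal b.integrable_normed
        (Eventually.of_forall b.nonneg_normed), b.integral_normed, ENNReal.ofReal_one]
  have hInt : ∀ x, mollify η f x - f x = ∫ y, (f (x - y) - f x) ∂ν := by
    intro x
    rw [integral_withDensity_eq_integral_toReal_smul hmeas (Eventually.of_forall fun y =>
      ENNReal.ofReal_lt_top)]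
    have e : ∀ y, (ENNReal.ofReal (η y)).toReal • (f (x - y) - f x) = η y • f (x - y) - η y • f x := by
      intro y
      rw [ENNReal.toReal_ofReal (b.nonneg_normed y), smul_sub]
    simp only [e]
    rw [integral_sub (integrable_mollify_integrand (isTest_normed b) hf x)
      (b.integrable_normed.smul_const _), integral_smul_const, b.integral_normed, one_smul]
    rfl
  have hF : StronglyMeasurable (Function.uncurry fun x y : RN N => f (x - y) - f x) :=
    (hfm.comp_measurable (measurable_fst.sub measurable_snd)).sub (hfm.comp_measurable measurable_fst)
  have h1 := lintegral_enorm_integral_sq_le (μ := (volume : Measure (RN N))) (ν := ν) hF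
  simp only [← hInt] at h1
  rw [← eLpNorm_two_sq] at h1
  have h2 : ∫⁻ y, (∫⁻ x, ‖f (x - y) - f x‖ₑ ^ 2) ∂ν ≤ δ ^ 2 := by
    have h3 : ∀ᵐ y ∂ν, ∫⁻ x, ‖f (x - y) - f x‖ₑ ^ 2 ≤ δ ^ 2 := by
      rw [ae_withDensity_iff hmeas]
      refine Eventually.of_forall fun y hy => ?_
      have hy' : y ∈ Function.support η := by
        intro h0
        exact hy (by rw [h0, ENNReal.ofReal_zero])
      rw [hη, b.support_normed_eq, mem_ball_zero_iff] at hy'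
      rw [← eLpNorm_two_sq]
      gcongr
      exact hδ y hy'
    calc _ ≤ ∫⁻ _, δ ^ 2 ∂ν := lintegral_mono_ae h3
      _ = δ ^ 2 := by simp
  exact (ENNReal.pow_le_pow_left_iff two_ne_zero).1 (h1.trans h2)

/-- Translations are continuous in `L²`. -/
lemma exists_translation_small (u : Lp E 2 (volume : Measure (RN N))) {δ : ℝ} (hδ : 0 < δ) :
    ∃ ε > 0, ∀ y : RN N, ‖y‖ < ε → eLpNorm (fun x => u (x - y) - u x) 2 volume ≤ ENNReal.ofReal δ := by
  have hc : Continuous fun y : RN N => (DomAddAct.mk (-y)) +ᵥ u :=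
    (DomAddAct.continuous_mk.comp continuous_neg).vadd continuous_const
  have h0 : (DomAddAct.mk (-(0 : RN N))) +ᵥ u = u := by
    rw [neg_zero]
    exact zero_vadd _ u
  obtain ⟨ε, hε, h⟩ := Metric.continuousAt_iff.1 (hc.continuousAt (x := (0 : RN N))) δ hδ
  refine ⟨ε, hε, fun y hy => ?_⟩
  have h1 := h (x := y) (by simpa using hy)
  rw [h0] at h1
  have h2 : edist ((DomAddAct.mk (-y)) +ᵥ u) u ≤ ENNReal.ofReal δ := by
    rw [edist_dist]; exact ENNReal.ofReal_le_ofReal h1.le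
  rw [Lp.edist_def] at h2
  refine le_trans (le_of_eq (eLpNorm_congr_ae ?_)) h2
  filter_upwards [DomAddAct.vadd_Lp_ae_eq (DomAddAct.mk (-y)) u] with x hx
  rw [Pi.sub_apply, hx]
  simp [sub_eq_neg_add]

end Mollify

/-! ### Derivatives of mollified functions. -/

section MollifyScalar

variable {N : ℕ}

lemma mollify_eq_convolution (η u : RN N → ℝ) :
    mollify η u = convolution u η (ContinuousLinearMap.mul ℝ ℝ) volume := by
  funext x
  rw [mollify_eq, convolution_def]
  refine integral_congr_ae (Eventually.of_forall fun y => ?_)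
  simp [mul_comm]

lemma contDiff_mollify {η : RN N → ℝ} (hη : IsTest η) {u : RN N → ℝ} (hu : MemLp u 2 volume) :
    ContDiff ℝ ∞ (mollify η u) := by
  rw [mollify_eq_convolution]
  exact hη.2.contDiff_convolution_right _ (hu.locallyIntegrable one_le_two) hη.1

lemma fderiv_mollify {η : RN N → ℝ} (hη : IsTest η) {u : RN N → ℝ} (hu : MemLp u 2 volume)
    (x v : RN N) : fderiv ℝ (mollify η u) x v = mollify (fun y => fderiv ℝ η y v) u x := by
  have hl := hu.locallyIntegrable one_le_two
  rw [mollify_eq_convolution, mollify_eq_convolution,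
    (hη.2.hasFDerivAt_convolution_right _ hl (hη.1.of_le (by simp)) x).fderiv,
    convolution_precompR_apply _ hl (hη.2.fderiv ℝ) (hη.1.continuous_fderiv (by simp))]

lemma mollify_sum {ι : Type*} (s : Finset ι) {η : ι → RN N → ℝ} (hη : ∀ i, IsTest (η i))
    {u : RN N → ℝ} (hu : MemLp u 2 volume) (x : RN N) :
    mollify (fun y => ∑ i ∈ s, η i y) u x = ∑ i ∈ s, mollify (η i) u x := by
  simp only [mollify, Finset.sum_smul]
  exact integral_finsetSum _ fun i _ => integrable_mollify_integrand (hη i) hu x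

lemma laplacian_mollify {η : RN N → ℝ} (hη : IsTest η) {u : RN N → ℝ} (hu : MemLp u 2 volume)
    (x : RN N) : Laplacian.laplacian (mollify η u) x = mollify (Laplacian.laplacian η) u x := by
  have e : Laplacian.laplacian η = fun x => ∑ i : Fin N,
      fderiv ℝ (fun y => fderiv ℝ η y (EuclideanSpace.basisFun (Fin N) ℝ i)) x
        (EuclideanSpace.basisFun (Fin N) ℝ i) := funext (laplacian_eq_sum hη.1)
  rw [laplacian_eq_sum (contDiff_mollify hη hu), e,
    mollify_sum _ (fun i => (hη.fderiv_apply _).fderiv_apply _) hu]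
  refine Finset.sum_congr rfl fun i _ => ?_
  simp only [fderiv_mollify hη hu]
  exact fderiv_mollify (hη.fderiv_apply _) hu x _

lemma fderiv_comp_const_sub_apply {η : RN N → ℝ} (hη : Differentiable ℝ η) (x y v : RN N) :
    fderiv ℝ (fun y => η (x - y)) y v = -fderiv ℝ η (x - y) v := by
  have h := ((hη (x - y)).hasFDerivAt.comp y ((hasFDerivAt_const x y).sub (hasFDerivAt_id y))).fderiv
  refine (congrArg (fun L => L v) h).trans ?_
  simp

lemma IsTest.comp_const_sub {η : RN N → ℝ} (hη : IsTest η) (x : RN N) :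
    IsTest fun y => η (x - y) :=
  ⟨hη.1.comp (contDiff_const.sub contDiff_id), hη.2.comp_homeomorph (Homeomorph.subLeft x)⟩

lemma laplacian_comp_const_sub {η : RN N → ℝ} (hη : IsTest η) (x y : RN N) :
    Laplacian.laplacian (fun y => η (x - y)) y = Laplacian.laplacian η (x - y) := by
  rw [laplacian_eq_sum (hη.comp_const_sub x).1, laplacian_eq_sum hη.1]
  refine Finset.sum_congr rfl fun i _ => ?_
  simp only [fderiv_comp_const_sub_apply hη.differentiable]
  set e := EuclideanSpace.basisFun (Fin N) ℝ i
  have h1 : (fun y => -fderiv ℝ η (x - y) e) = -fun y => (fun z => fderiv ℝ η z e) (x - y) := rfl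
  rw [h1, fderiv_neg, neg_apply,
    fderiv_comp_const_sub_apply (hη.fderiv_apply e).differentiable, neg_neg]

/-- The weak gradient tested against `y ↦ η (x - y)` moves the derivative from the kernel to `u`:
mollification commutes with weak derivatives. `H2.laplacian_mollify` is the same for the Laplacian.
-/
lemma H2.fderiv_mollify (U : H2 N) {η : RN N → ℝ} (hη : IsTest η) (x v : RN N) :
    fderiv ℝ (mollify η U.fn) x v = inner ℝ (mollify η U.grad x) v := by
  have h := U.isWeakGradient (fun y => η (x - y)) (hη.comp_const_sub x).1 (hη.comp_const_sub x).2 v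
  rw [_root_.fderiv_mollify hη (Lp.memLp U.fn), mollify_eq, mollify_eq]
  have hInt : Integrable (fun y => η (x - y) • U.grad y) volume :=
    ((Lp.memLp U.grad).locallyIntegrable one_le_two).integrable_smul_left_of_hasCompactSupport
      (hη.comp_const_sub x).continuous (hη.comp_const_sub x).2
  rw [real_inner_comm, ← integral_inner hInt]
  simp only [fderiv_comp_const_sub_apply hη.differentiable, mul_neg, integral_neg, neg_inj] at h
  calc _ = ∫ y, U.fn y * fderiv ℝ η (x - y) v :=
        integral_congr_ae (Eventually.of_forall fun y => by simp [mul_comm])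
    _ = _ := h
    _ = _ := integral_congr_ae (Eventually.of_forall fun y => by
        simp only [real_inner_smul_right, real_inner_comm v]; ring)

lemma H2.gradient_mollify (U : H2 N) {η : RN N → ℝ} (hη : IsTest η) :
    gradient (mollify η U.fn) = mollify η U.grad := by
  funext x
  refine ext_inner_right ℝ fun v => ?_
  rw [inner_gradient_left, U.fderiv_mollify hη]

lemma H2.laplacian_mollify (U : H2 N) {η : RN N → ℝ} (hη : IsTest η) :
    Laplacian.laplacian (mollify η U.fn) = mollify η U.lap := by
  funext x
  have h := U.isWeakLaplacian (fun y => η (x - y)) (hη.comp_const_sub x).1 (hη.comp_const_sub x).2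
  rw [_root_.laplacian_mollify hη (Lp.memLp U.fn), mollify_eq, mollify_eq]
  simp only [laplacian_comp_const_sub hη] at h
  simpa only [smul_eq_mul, mul_comm] using h

end MollifyScalar

/-! ### Density of test functions -/

section Density

variable {N : ℕ}

lemma fderiv_comp_smul_apply (φ : RN N → ℝ) (t : ℝ) (x v : RN N) :
    fderiv ℝ (fun y => φ (t • y)) x v = t * fderiv ℝ φ (t • x) v := by
  rw [fderiv_comp_smul]; rfl

lemma gradient_comp_smul (φ : RN N → ℝ) (t : ℝ) (x : RN N) :
    gradient (fun y => φ (t • y)) x = t • gradient φ (t • x) := by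
  refine ext_inner_right ℝ fun v => ?_
  rw [inner_gradient_left, fderiv_comp_smul_apply, real_inner_smul_left, inner_gradient_left]

lemma laplacian_comp_smul {φ : RN N → ℝ} (h : ContDiff ℝ ∞ φ) (t : ℝ) (x : RN N) :
    Laplacian.laplacian (fun y => φ (t • y)) x = t ^ 2 * Laplacian.laplacian φ (t • x) := by
  have h' : ContDiff ℝ ∞ fun y => φ (t • y) := h.comp (contDiff_const_smul t)
  rw [laplacian_eq_sum h', laplacian_eq_sum h, Finset.mul_sum]
  refine Finset.sum_congr rfl fun i _ => ?_
  simp only [fderiv_comp_smul_apply]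
  set e := EuclideanSpace.basisFun (Fin N) ℝ i
  have h2 : DifferentiableAt ℝ (fun y => (fun z => fderiv ℝ φ z e) (t • y)) x :=
    (((h.fderiv_right (m := ∞) (by simp)).clm_apply contDiff_const).comp
      (contDiff_const_smul t)).differentiable (by simp) x
  have h3 := fderiv_comp_smul_apply (fun z => fderiv ℝ φ z e) t x e
  rw [fderiv_const_mul h2, smul_apply, h3, smul_eq_mul]
  ring

lemma IsTest.comp_smul {φ : RN N → ℝ} (h : IsTest φ) {t : ℝ} (ht : t ≠ 0) :
    IsTest fun y => φ (t • y) :=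
  ⟨h.1.comp (contDiff_const_smul t), h.2.comp_homeomorph (Homeomorph.smulOfNeZero t ht)⟩

lemma fderiv_mul_apply {f g : RN N → ℝ} (hf : Differentiable ℝ f) (hg : Differentiable ℝ g)
    (x v : RN N) : fderiv ℝ (fun y => f y * g y) x v = f x * fderiv ℝ g x v + fderiv ℝ f x v * g x := by
  rw [fderiv_fun_mul (hf x) (hg x)]
  simp [mul_comm]

lemma gradient_mul {f g : RN N → ℝ} (hf : Differentiable ℝ f) (hg : Differentiable ℝ g)
    (x : RN N) : gradient (fun y => f y * g y) x = f x • gradient g x + g x • gradient f x := by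
  refine ext_inner_right ℝ fun v => ?_
  rw [inner_gradient_left, fderiv_mul_apply hf hg, inner_add_left, real_inner_smul_left,
    real_inner_smul_left, inner_gradient_left, inner_gradient_left]
  ring

lemma laplacian_mul {f g : RN N → ℝ} (hf : ContDiff ℝ ∞ f) (hg : ContDiff ℝ ∞ g) (x : RN N) :
    Laplacian.laplacian (fun y => f y * g y) x = f x * Laplacian.laplacian g x
      + 2 * inner ℝ (gradient f x) (gradient g x) + g x * Laplacian.laplacian f x := by
  have hfd : Differentiable ℝ f := hf.differentiable (by simp)
  have hgd : Differentiable ℝ g := hg.differentiable (by simp)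
  have hf' : ∀ v, Differentiable ℝ fun y => fderiv ℝ f y v := fun v =>
    ((hf.fderiv_right (m := ∞) (by simp)).clm_apply contDiff_const).differentiable (by simp)
  have hg' : ∀ v, Differentiable ℝ fun y => fderiv ℝ g y v := fun v =>
    ((hg.fderiv_right (m := ∞) (by simp)).clm_apply contDiff_const).differentiable (by simp)
  rw [laplacian_eq_sum (hf.mul hg), laplacian_eq_sum hf, laplacian_eq_sum hg,
    ← (EuclideanSpace.basisFun (Fin N) ℝ).sum_inner_mul_inner, Finset.mul_sum, Finset.mul_sum,
    Finset.mul_sum, ← Finset.sum_add_distrib, ← Finset.sum_add_distrib]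
  refine Finset.sum_congr rfl fun i _ => ?_
  set e := EuclideanSpace.basisFun (Fin N) ℝ i
  simp only [fderiv_mul_apply hfd hgd]
  rw [fderiv_fun_add (hfd.fun_mul (hg' e) x) ((hf' e).fun_mul hgd x), add_apply,
    fderiv_mul_apply hfd (hg' e), fderiv_mul_apply (hf' e) hgd, inner_gradient_left,
    real_inner_comm, inner_gradient_left]
  ring

/-- Cut-off functions. -/
lemma exists_cutoff (N : ℕ) : ∃ (χ : ℕ → RN N → ℝ) (C : ℝ), 0 ≤ C ∧ (∀ n, IsTest (χ n)) ∧
    (∀ n x, |χ n x| ≤ 1) ∧ (∀ x, ∀ᶠ n in atTop, χ n x = 1) ∧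
    (∀ n x, ‖gradient (χ n) x‖ ≤ C / (n + 1)) ∧
    ∀ n x, |Laplacian.laplacian (χ n) x| ≤ C / (n + 1) := by
  let b : ContDiffBump (0 : RN N) := ⟨1, 2, one_pos, one_lt_two⟩
  have hb : IsTest (b : RN N → ℝ) := ⟨b.contDiff, b.hasCompactSupport⟩
  obtain ⟨C1, hC1⟩ := hb.continuous_gradient.bounded_above_of_compact_support
    hb.hasCompactSupport_gradient
  obtain ⟨C2, hC2⟩ := hb.laplacian.continuous.bounded_above_of_compact_support hb.laplacian.2
  have hn : ∀ n : ℕ, (0 : ℝ) < (n + 1 : ℝ)⁻¹ := fun n => by positivity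
  refine ⟨fun n x => b ((n + 1 : ℝ)⁻¹ • x), max C1 C2, ?_, fun n => hb.comp_smul (hn n).ne', ?_, ?_,
    ?_, ?_⟩
  · exact (norm_nonneg _).trans ((hC1 0).trans (le_max_left _ _))
  · intro n x
    rw [abs_of_nonneg b.nonneg]
    exact b.le_one
  · intro x
    obtain ⟨M, hM⟩ := exists_nat_ge ‖x‖
    filter_upwards [eventually_ge_atTop M] with n hnM
    apply b.one_of_mem_closedBall
    rw [mem_closedBall_zero_iff, norm_smul, Real.norm_eq_abs, abs_of_pos (hn n)]
    change _ ≤ (1 : ℝ)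
    rw [inv_mul_le_one₀ (by positivity)]
    have : (M : ℝ) ≤ n := by exact_mod_cast hnM
    linarith
  · intro n x
    rw [gradient_comp_smul, norm_smul, Real.norm_eq_abs, abs_of_pos (hn n), div_eq_inv_mul]
    gcongr
    exact (hC1 _).trans (le_max_left _ _)
  · intro n x
    rw [laplacian_comp_smul hb.1, abs_mul, abs_of_nonneg (sq_nonneg _), div_eq_inv_mul]
    have h1 : ((n + 1 : ℝ)⁻¹) ^ 2 ≤ (n + 1 : ℝ)⁻¹ := by
      have h2 : (n + 1 : ℝ)⁻¹ ≤ 1 := inv_le_one_of_one_le₀ (by linarith [n.cast_nonneg (α := ℝ)])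
      nlinarith [hn n]
    have h3 : |Laplacian.laplacian (b : RN N → ℝ) ((n + 1 : ℝ)⁻¹ • x)| ≤ max C1 C2 :=
      (hC2 _).trans (le_max_right _ _)
    gcongr

/-- Dominated convergence for the squares, with majorant `4‖F‖²`. -/
lemma tendsto_eLpNorm_cutoff {E : Type*} [NormedAddCommGroup E] [NormedSpace ℝ E]
    {χ : ℕ → RN N → ℝ} (hχc : ∀ n, Continuous (χ n)) (hχ1 : ∀ n x, |χ n x| ≤ 1)
    (hχ : ∀ x, ∀ᶠ n in atTop, χ n x = 1) {F : RN N → E} (hF : MemLp F 2 volume) :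
    Tendsto (fun n => eLpNorm (fun x => χ n x • F x - F x) 2 volume) atTop (𝓝 0) := by
  have hlim := tendsto_lintegral_of_dominated_convergence'
    (μ := (volume : Measure (RN N))) (F := fun n x => ‖χ n x • F x - F x‖ₑ ^ 2) (f := fun _ => 0)
    (fun x => (2 * ‖F x‖ₑ) ^ 2) (fun n => ?_) (fun n => ?_) ?_ ?_
  · simp only [← eLpNorm_two_sq, lintegral_zero] at hlim
    have h2 := hlim.ennrpow_const (1 / 2)
    simp only [← ENNReal.rpow_natCast, ← ENNReal.rpow_mul] at h2
    simpa using h2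
  · exact ((((hχc n).aestronglyMeasurable.smul hF.1).sub hF.1).enorm.pow_const 2)
  · refine Eventually.of_forall fun x => ?_
    refine pow_le_pow_left₀ zero_le ?_ 2
    refine (enorm_sub_le).trans ?_
    rw [two_mul, enorm_smul]
    refine add_le_add ?_ le_rfl
    have : ‖χ n x‖ₑ ≤ 1 := by
      rw [← ofReal_norm, Real.norm_eq_abs]
      exact ENNReal.ofReal_le_one.2 (hχ1 n x)
    exact mul_le_of_le_one_left' this
  · have e : ∀ x, (2 * ‖F x‖ₑ) ^ 2 = 4 * ‖F x‖ₑ ^ 2 := by intro x; ring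
    simp only [e]
    rw [lintegral_const_mul' _ _ (by simp), ← eLpNorm_two_sq]
    exact ENNReal.mul_ne_top (by simp) (ENNReal.pow_ne_top hF.2.ne)
  · refine Eventually.of_forall fun x => ?_
    refine tendsto_const_nhds.congr' ?_
    filter_upwards [hχ x] with n hn
    simp [hn]

/-- Test functions are dense among the smooth functions with derivatives in `L²`. -/
lemma exists_ofTest_approx {f : RN N → ℝ} (hf : ContDiff ℝ ∞ f) (h0 : MemLp f 2 volume)
    (h1 : MemLp (gradient f) 2 volume) (h2 : MemLp (Laplacian.laplacian f) 2 volume) :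
    ∃ φ : ℕ → RN N → ℝ, (∀ n, IsTest (φ n)) ∧
      Tendsto (fun n => eLpNorm (φ n - f) 2 volume) atTop (𝓝 0) ∧
      Tendsto (fun n => eLpNorm (gradient (φ n) - gradient f) 2 volume) atTop (𝓝 0) ∧
      Tendsto (fun n => eLpNorm (Laplacian.laplacian (φ n) - Laplacian.laplacian f) 2 volume)
        atTop (𝓝 0) := by
  obtain ⟨χ, C, hC, hχ, hχ1, hχe, hχg, hχl⟩ := exists_cutoff N
  have hfd : Differentiable ℝ f := hf.differentiable (by simp)
  have hsmall : Tendsto (fun n : ℕ => ENNReal.ofReal (C / (n + 1))) atTop (𝓝 0) := by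
    have : Tendsto (fun n : ℕ => C / (n + 1 : ℝ)) atTop (𝓝 0) := by
      simpa [div_eq_mul_inv] using (tendsto_one_div_add_atTop_nhds_zero_nat (𝕜 := ℝ)).const_mul C
    simpa using ENNReal.tendsto_ofReal this
  have hmul : ∀ {K : ENNReal}, K ≠ ⊤ →
      Tendsto (fun n : ℕ => ENNReal.ofReal (C / (n + 1)) * K) atTop (𝓝 0) := by
    intro K hK
    simpa using ENNReal.Tendsto.mul_const hsmall (Or.inr hK)
  have c0 := tendsto_eLpNorm_cutoff (fun n => (hχ n).continuous) hχ1 hχe h0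
  have c1 := tendsto_eLpNorm_cutoff (fun n => (hχ n).continuous) hχ1 hχe h1
  have c2 := tendsto_eLpNorm_cutoff (fun n => (hχ n).continuous) hχ1 hχe h2
  have m1 : ∀ n, AEStronglyMeasurable (fun x => χ n x • gradient f x - gradient f x) volume :=
    fun n => ((hχ n).continuous.aestronglyMeasurable.smul h1.1).sub h1.1
  have m2 : ∀ n, AEStronglyMeasurable (fun x => χ n x • Laplacian.laplacian f x
      - Laplacian.laplacian f x) volume :=
    fun n => ((hχ n).continuous.aestronglyMeasurable.smul h2.1).sub h2.1
  have m3 : ∀ n, AEStronglyMeasurable (fun x => f x • gradient (χ n) x) volume :=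
    fun n => h0.1.smul (hχ n).continuous_gradient.aestronglyMeasurable
  have m4 : ∀ n, AEStronglyMeasurable (fun x => 2 * inner ℝ (gradient (χ n) x) (gradient f x)) volume :=
    fun n => ((hχ n).continuous_gradient.aestronglyMeasurable.inner h1.1).const_mul 2
  have m5 : ∀ n, AEStronglyMeasurable (fun x => f x * Laplacian.laplacian (χ n) x) volume :=
    fun n => h0.1.mul (hχ n).laplacian.continuous.aestronglyMeasurable
  refine ⟨fun n x => χ n x * f x, fun n => (hχ n).mul_left hf, c0, ?_, ?_⟩
  -- By the product rule the error is the cut-off error of `∇f` plus a term carrying `∇χ_n`, which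
  -- is `O(1/n)`. The Laplacian below has two such extra terms.
  · have hb : ∀ n, eLpNorm (gradient (fun x => χ n x * f x) - gradient f) 2 volume
        ≤ eLpNorm (fun x => χ n x • gradient f x - gradient f x) 2 volume
          + ENNReal.ofReal (C / (n + 1)) * eLpNorm f 2 volume := by
      intro n
      have e : gradient (fun x => χ n x * f x) - gradient f
          = (fun x => χ n x • gradient f x - gradient f x) + fun x => f x • gradient (χ n) x := by
        funext x
        simp only [Pi.sub_apply, Pi.add_apply, gradient_mul (hχ n).differentiable hfd]
        abel
      rw [e]
      refine (eLpNorm_add_le (m1 n) (m3 n) one_le_two).trans ?_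
      gcongr
      refine eLpNorm_le_mul_eLpNorm_of_ae_le_mul (Eventually.of_forall fun x => ?_) 2
      rw [norm_smul, mul_comm]
      gcongr
      exact hχg n x
    refine tendsto_of_tendsto_of_tendsto_of_le_of_le tendsto_const_nhds ?_ (fun _ => zero_le) hb
    simpa using c1.add (hmul h0.2.ne)
  · have hb : ∀ n, eLpNorm (Laplacian.laplacian (fun x => χ n x * f x) - Laplacian.laplacian f) 2
        volume ≤ eLpNorm (fun x => χ n x • Laplacian.laplacian f x - Laplacian.laplacian f x) 2 volume
          + ENNReal.ofReal (C / (n + 1)) * (2 * eLpNorm (gradient f) 2 volume)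
          + ENNReal.ofReal (C / (n + 1)) * eLpNorm f 2 volume := by
      intro n
      have e : Laplacian.laplacian (fun x => χ n x * f x) - Laplacian.laplacian f
          = ((fun x => χ n x • Laplacian.laplacian f x - Laplacian.laplacian f x)
            + fun x => 2 * inner ℝ (gradient (χ n) x) (gradient f x))
            + fun x => f x * Laplacian.laplacian (χ n) x := by
        funext x
        simp only [Pi.sub_apply, Pi.add_apply, laplacian_mul (hχ n).1 hf, smul_eq_mul]
        ring
      rw [e]
      refine (eLpNorm_add_le ((m2 n).add (m4 n)) (m5 n) one_le_two).trans ?_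
      gcongr
      · refine (eLpNorm_add_le (m2 n) (m4 n) one_le_two).trans ?_
        gcongr
        have e2 : ENNReal.ofReal (C / (n + 1)) * (2 * eLpNorm (gradient f) 2 volume)
            = ENNReal.ofReal (2 * (C / (n + 1))) * eLpNorm (gradient f) 2 volume := by
          rw [ENNReal.ofReal_mul zero_le_two, ENNReal.ofReal_ofNat]; ring
        rw [e2]
        refine eLpNorm_le_mul_eLpNorm_of_ae_le_mul (Eventually.of_forall fun x => ?_) 2
        rw [norm_mul, Real.norm_ofNat, mul_assoc]
        gcongr
        refine (norm_inner_le_norm _ _).trans ?_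
        gcongr
        exact hχg n x
      · refine eLpNorm_le_mul_eLpNorm_of_ae_le_mul (Eventually.of_forall fun x => ?_) 2
        rw [norm_mul, mul_comm]
        gcongr
        exact hχl n x
    refine tendsto_of_tendsto_of_tendsto_of_le_of_le tendsto_const_nhds ?_ (fun _ => zero_le) hb
    simpa using (c2.add (hmul (ENNReal.mul_ne_top (by simp) h1.2.ne))).add (hmul h0.2.ne)

lemma memLp_of_eLpNorm_sub_lt_top {E : Type*} [NormedAddCommGroup E] {f : RN N → E}
    (hfm : AEStronglyMeasurable f volume) (u : Lp E 2 (volume : Measure (RN N)))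
    (h : eLpNorm (fun x => f x - u x) 2 volume < ⊤) : MemLp f 2 volume := by
  have h1 : MemLp (fun x => f x - u x) 2 volume :=
    ⟨hfm.sub (Lp.aestronglyMeasurable u), h⟩
  have h2 := h1.add (Lp.memLp u)
  refine h2.ae_eq (Eventually.of_forall fun x => ?_)
  simp

lemma norm_toLp_sub_le {E : Type*} [NormedAddCommGroup E] {f : RN N → E} (hf : MemLp f 2 volume)
    (u : Lp E 2 (volume : Measure (RN N))) {δ : ℝ} (hδ : 0 ≤ δ)
    (h : eLpNorm (fun x => f x - u x) 2 volume ≤ ENNReal.ofReal δ) : ‖hf.toLp f - u‖ ≤ δ := by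
  rw [Lp.norm_def]
  refine ENNReal.toReal_le_of_le_ofReal hδ (le_trans (le_of_eq (eLpNorm_congr_ae ?_)) h)
  filter_upwards [Lp.coeFn_sub (hf.toLp f) u, hf.coeFn_toLp] with x h1 h2
  rw [h1, Pi.sub_apply, h2]

/-- **Test functions are dense in `H²`.** -/
theorem exists_ofTest_dist_lt (U : H2 N) {δ : ℝ} (hδ : 0 < δ) :
    ∃ (φ : RN N → ℝ) (h : IsTest φ), ‖ofTest h - U‖ < δ := by
  -- Mollification and cut-off each cost at most `κ` in each of the three components, and `3 (2κ)² <
  -- (4κ)² = δ²`.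
  set κ := δ / 4 with hκ
  have hκ0 : 0 < κ := by positivity
  obtain ⟨ε0, hε0, t0⟩ := exists_translation_small U.fn hκ0
  obtain ⟨ε1, hε1, t1⟩ := exists_translation_small U.grad hκ0
  obtain ⟨ε2, hε2, t2⟩ := exists_translation_small U.lap hκ0
  set ε := min ε0 (min ε1 ε2)
  have hε : 0 < ε := lt_min hε0 (lt_min hε1 hε2)
  let b : ContDiffBump (0 : RN N) := ⟨ε / 2, ε, by positivity, by linarith⟩
  have hb := isTest_normed b
  set η := b.normed (volume : Measure (RN N))
  set f := mollify η U.fn with hf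
  have hfs : ContDiff ℝ ∞ f := contDiff_mollify hb (Lp.memLp U.fn)
  have e0 : eLpNorm (fun x => f x - U.fn x) 2 volume ≤ ENNReal.ofReal κ :=
    eLpNorm_mollify_sub_le b (Lp.stronglyMeasurable _) (Lp.memLp _) fun y hy =>
      t0 y (hy.trans_le (min_le_left _ _))
  have e1 : eLpNorm (fun x => gradient f x - U.grad x) 2 volume ≤ ENNReal.ofReal κ := by
    rw [hf, U.gradient_mollify hb]
    exact eLpNorm_mollify_sub_le b (Lp.stronglyMeasurable _) (Lp.memLp _) fun y hy =>
      t1 y (hy.trans_le ((min_le_right _ _).trans (min_le_left _ _)))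
  have e2 : eLpNorm (fun x => Laplacian.laplacian f x - U.lap x) 2 volume ≤ ENNReal.ofReal κ := by
    rw [hf, U.laplacian_mollify hb]
    exact eLpNorm_mollify_sub_le b (Lp.stronglyMeasurable _) (Lp.memLp _) fun y hy =>
      t2 y (hy.trans_le ((min_le_right _ _).trans (min_le_right _ _)))
  have hgc : Continuous (gradient f) := (InnerProductSpace.toDual ℝ (RN N)).symm.continuous.comp
    (hfs.continuous_fderiv (by simp))
  have hlc : Continuous (Laplacian.laplacian f) := by
    rw [funext (laplacian_eq_sum hfs)]
    refine continuous_finsetSum _ fun i _ => ?_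
    exact ((((hfs.fderiv_right (m := ∞) (by simp)).clm_apply contDiff_const).fderiv_right
      (m := ∞) (by simp)).clm_apply contDiff_const).continuous
  have h0 : MemLp f 2 volume := memLp_of_eLpNorm_sub_lt_top hfs.continuous.aestronglyMeasurable U.fn
    (e0.trans_lt ENNReal.ofReal_lt_top)
  have h1 : MemLp (gradient f) 2 volume := memLp_of_eLpNorm_sub_lt_top hgc.aestronglyMeasurable U.grad
    (e1.trans_lt ENNReal.ofReal_lt_top)
  have h2 : MemLp (Laplacian.laplacian f) 2 volume :=
    memLp_of_eLpNorm_sub_lt_top hlc.aestronglyMeasurable U.lap (e2.trans_lt ENNReal.ofReal_lt_top)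
  obtain ⟨φ, hφ, l0, l1, l2⟩ := exists_ofTest_approx hfs h0 h1 h2
  have r0 := norm_toLp_sub_le h0 U.fn hκ0.le e0
  have r1 := norm_toLp_sub_le h1 U.grad hκ0.le e1
  have r2 := norm_toLp_sub_le h2 U.lap hκ0.le e2
  have a0 := (Lp.tendsto_Lp_iff_tendsto_eLpNorm'' φ (fun n => (hφ n).memLp 2) f h0).2 l0
  have a1 := (Lp.tendsto_Lp_iff_tendsto_eLpNorm'' (fun n => gradient (φ n))
    (fun n => (hφ n).gradient_memLp) (gradient f) h1).2 l1
  have a2 := (Lp.tendsto_Lp_iff_tendsto_eLpNorm'' (fun n => Laplacian.laplacian (φ n))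
    (fun n => (hφ n).laplacian.memLp 2) (Laplacian.laplacian f) h2).2 l2
  have b0 := Metric.tendsto_atTop.1 a0 κ hκ0
  have b1 := Metric.tendsto_atTop.1 a1 κ hκ0
  have b2 := Metric.tendsto_atTop.1 a2 κ hκ0
  obtain ⟨n0, b0⟩ := b0
  obtain ⟨n1, b1⟩ := b1
  obtain ⟨n2, b2⟩ := b2
  set n := max n0 (max n1 n2)
  have d0 := b0 n (le_max_left _ _)
  have d1 := b1 n ((le_max_left _ _).trans (le_max_right _ _))
  have d2 := b2 n ((le_max_right _ _).trans (le_max_right _ _))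
  refine ⟨φ n, hφ n, ?_⟩
  have tri : ∀ {E : Type} [NormedAddCommGroup E] (x y z : E), dist x y < κ → ‖y - z‖ ≤ κ →
      ‖x - z‖ < 2 * κ := by
    intro E _ x y z hxy hyz
    have h3 := norm_sub_le_norm_sub_add_norm_sub x y z
    rw [dist_eq_norm] at hxy
    linarith
  have f0 : ‖(ofTest (hφ n) - U).fn‖ < 2 * κ := tri _ _ _ d0 r0
  have f1 : ‖(ofTest (hφ n) - U).grad‖ < 2 * κ := tri _ _ _ d1 r1
  have f2 : ‖(ofTest (hφ n) - U).lap‖ < 2 * κ := tri _ _ _ d2 r2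
  refine lt_of_pow_lt_pow_left₀ 2 hδ.le ?_
  rw [H2.norm_sq_eq]
  have hδκ : δ = 4 * κ := by rw [hκ]; ring
  rw [hδκ]
  have g0 := pow_lt_pow_left₀ f0 (norm_nonneg _) two_ne_zero
  have g1 := pow_lt_pow_left₀ f1 (norm_nonneg _) two_ne_zero
  have g2 := pow_lt_pow_left₀ f2 (norm_nonneg _) two_ne_zero
  nlinarith

end Density

end

noncomputable section

/-! ### Hölder's inequality for products of powers -/

section Hoelder

variable {α : Type*} [MeasurableSpace α] {μ : Measure α}

/-- Hölder's inequality in the form of weighted geometric means. Real integrands with integrability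
as part of the conclusion make each later use a choice of weights summing to `1`. -/
lemma hoelder_prod {ι : Type*} (s : Finset ι) {F : ι → α → ℝ} (hF0 : ∀ i ∈ s, ∀ x, 0 ≤ F i x)
    (hF : ∀ i ∈ s, Integrable (F i) μ) {w : ι → ℝ} (hw0 : ∀ i ∈ s, 0 ≤ w i)
    (hw : ∑ i ∈ s, w i = 1) :
    Integrable (fun x => ∏ i ∈ s, F i x ^ w i) μ ∧
      ∫ x, ∏ i ∈ s, F i x ^ w i ∂μ ≤ ∏ i ∈ s, (∫ x, F i x ∂μ) ^ w i := by
  have h := ENNReal.lintegral_prod_norm_pow_le (μ := μ) s (f := fun i x => ENNReal.ofReal (F i x))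
    (fun i hi => (hF i hi).1.aemeasurable.ennreal_ofReal) hw hw0
  have e : ∀ x, ∏ i ∈ s, ENNReal.ofReal (F i x) ^ w i = ENNReal.ofReal (∏ i ∈ s, F i x ^ w i) := by
    intro x
    rw [ENNReal.ofReal_prod_of_nonneg fun i hi => Real.rpow_nonneg (hF0 i hi x) _]
    exact Finset.prod_congr rfl fun i hi => ENNReal.ofReal_rpow_of_nonneg (hF0 i hi x) (hw0 i hi)
  have hI0 : ∀ i ∈ s, 0 ≤ ∫ x, F i x ∂μ := fun i hi => integral_nonneg (hF0 i hi)
  have e2 : ∏ i ∈ s, (∫⁻ x, ENNReal.ofReal (F i x) ∂μ) ^ w i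
      = ENNReal.ofReal (∏ i ∈ s, (∫ x, F i x ∂μ) ^ w i) := by
    rw [ENNReal.ofReal_prod_of_nonneg fun i hi => Real.rpow_nonneg (hI0 i hi) _]
    refine Finset.prod_congr rfl fun i hi => ?_
    rw [← ofReal_integral_eq_lintegral_ofReal (hF i hi) (Eventually.of_forall (hF0 i hi)),
      ENNReal.ofReal_rpow_of_nonneg (hI0 i hi) (hw0 i hi)]
  simp only [e] at h
  rw [e2] at h
  have hnn : ∀ x, 0 ≤ ∏ i ∈ s, F i x ^ w i := fun x =>
    Finset.prod_nonneg fun i hi => Real.rpow_nonneg (hF0 i hi x) _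
  have hmeas : AEStronglyMeasurable (fun x => ∏ i ∈ s, F i x ^ w i) μ := by
    refine (Finset.aemeasurable_fun_prod s fun i hi => ?_).aestronglyMeasurable
    exact (hF i hi).1.aemeasurable.pow_const _
  have hInt : Integrable (fun x => ∏ i ∈ s, F i x ^ w i) μ := by
    refine ⟨hmeas, ?_⟩
    rw [hasFiniteIntegral_iff_ofReal (Eventually.of_forall hnn)]
    exact h.trans_lt ENNReal.ofReal_lt_top
  refine ⟨hInt, ?_⟩
  rw [← ofReal_integral_eq_lintegral_ofReal hInt (Eventually.of_forall hnn)] at h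
  refine (ENNReal.ofReal_le_ofReal_iff ?_).1 h
  exact Finset.prod_nonneg fun i hi => Real.rpow_nonneg (hI0 i hi) _

lemma hoelder_two {f g : α → ℝ} {q r a b : ℝ} (hq : 0 < q) (hr : 0 < r) (ha : 0 ≤ a) (hb : 0 ≤ b)
    (hab : a / q + b / r = 1) (hf : Integrable (fun x => |f x| ^ q) μ)
    (hg : Integrable (fun x => |g x| ^ r) μ) :
    Integrable (fun x => |f x| ^ a * |g x| ^ b) μ ∧
      ∫ x, |f x| ^ a * |g x| ^ b ∂μ
        ≤ (∫ x, |f x| ^ q ∂μ) ^ (a / q) * (∫ x, |g x| ^ r ∂μ) ^ (b / r) := by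
  have h := hoelder_prod (μ := μ) (Finset.univ : Finset (Fin 2))
    (F := ![fun x => |f x| ^ q, fun x => |g x| ^ r]) (w := ![a / q, b / r])
    (by intro i _ x; fin_cases i <;> simp <;> positivity)
    (by intro i _; fin_cases i <;> simpa)
    (by intro i _; fin_cases i <;> simp <;> positivity)
    (by simpa [Fin.sum_univ_two] using hab)
  simp only [Fin.prod_univ_two, Matrix.cons_val_zero, Matrix.cons_val_one] at h
  have e1 : ∀ x, (|f x| ^ q) ^ (a / q) = |f x| ^ a := fun x => by
    rw [← Real.rpow_mul (abs_nonneg _), mul_div_cancel₀ _ hq.ne']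
  have e2 : ∀ x, (|g x| ^ r) ^ (b / r) = |g x| ^ b := fun x => by
    rw [← Real.rpow_mul (abs_nonneg _), mul_div_cancel₀ _ hr.ne']
  simpa only [e1, e2] using h

lemma hoelder_three {f g h : α → ℝ} {q : ℝ} (hq : 2 ≤ q)
    (hf : Integrable (fun x => |f x| ^ q) μ) (hg : Integrable (fun x => |g x| ^ q) μ)
    (hh : Integrable (fun x => |h x| ^ q) μ) :
    Integrable (fun x => |f x| ^ (q - 2) * |g x| * |h x|) μ ∧
      ∫ x, |f x| ^ (q - 2) * |g x| * |h x| ∂μ ≤ (∫ x, |f x| ^ q ∂μ) ^ ((q - 2) / q)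
        * (∫ x, |g x| ^ q ∂μ) ^ (1 / q) * (∫ x, |h x| ^ q ∂μ) ^ (1 / q) := by
  have hq0 : 0 < q := by linarith
  have hq2 : 0 ≤ q - 2 := by linarith
  have H := hoelder_prod (μ := μ) (Finset.univ : Finset (Fin 3))
    (F := ![fun x => |f x| ^ q, fun x => |g x| ^ q, fun x => |h x| ^ q])
    (w := ![(q - 2) / q, 1 / q, 1 / q])
    (by intro i _ x; fin_cases i <;> simp <;> positivity)
    (by intro i _; fin_cases i <;> simpa)
    (by intro i _; fin_cases i <;> simp <;> positivity)
    (by simp [Fin.sum_univ_three]; field_simp; ring)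
  simp only [Fin.prod_univ_three, Matrix.cons_val_zero, Matrix.cons_val_one,
    Matrix.cons_val_two, Matrix.tail_cons, Matrix.head_cons] at H
  have e1 : ∀ (f : α → ℝ) (x : α) (a : ℝ), (|f x| ^ q) ^ (a / q) = |f x| ^ a := fun f x a => by
    rw [← Real.rpow_mul (abs_nonneg _), mul_div_cancel₀ _ hq0.ne']
  simpa only [e1, Real.rpow_one] using H

end Hoelder

/-! ### The Sobolev inequality on `H²` -/

section Sobolev

variable {N : ℕ}

lemma eLpNorm_two_le_of_integral_sq_le {f g : RN N → ℝ} (hf : MemLp f 2 volume)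
    (hg : MemLp g 2 volume) (h : ∫ x, f x ^ 2 ≤ ∫ x, g x ^ 2) :
    eLpNorm f 2 volume ≤ eLpNorm g 2 volume := by
  have key : ∀ {f : RN N → ℝ}, MemLp f 2 volume →
      eLpNorm f 2 volume ^ 2 = ENNReal.ofReal (∫ x, f x ^ 2) := by
    intro f hf
    rw [eLpNorm_two_sq, ofReal_integral_eq_lintegral_ofReal hf.integrable_sq
      (Eventually.of_forall fun x => sq_nonneg _)]
    refine lintegral_congr fun x => ?_
    rw [← ofReal_norm, ← ENNReal.ofReal_pow (norm_nonneg _), Real.norm_eq_abs, sq_abs]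
  rw [← ENNReal.pow_le_pow_left_iff two_ne_zero, key hf, key hg]
  exact ENNReal.ofReal_le_ofReal h

lemma fderiv_fderiv_apply {φ : RN N → ℝ} (h : IsTest φ) (x v w : RN N) :
    fderiv ℝ (fderiv ℝ φ) x v w = fderiv ℝ (fun y => fderiv ℝ φ y w) x v := by
  have hd : DifferentiableAt ℝ (fderiv ℝ φ) x :=
    (h.1.fderiv_right (m := ∞) (by simp)).differentiable (by simp) x
  rw [fderiv_clm_apply hd (differentiableAt_const _)]
  simp

lemma fderiv_fderiv_comm {φ : RN N → ℝ} (h : IsTest φ) (x v w : RN N) :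
    fderiv ℝ (fun y => fderiv ℝ φ y w) x v = fderiv ℝ (fun y => fderiv ℝ φ y v) x w := by
  rw [← fderiv_fderiv_apply h, ← fderiv_fderiv_apply h]
  exact (h.1.contDiffAt.isSymmSndFDerivAt (by simp; exact WithTop.coe_le_coe.2 le_top)) v w

/-- `∫ (∂ᵢ∂ⱼφ)² ≤ ∫ (Δφ)²`. -/
lemma integral_sq_partial_le {φ : RN N → ℝ} (h : IsTest φ) (i j : Fin N) :
    ∫ x, (fderiv ℝ (fun y => fderiv ℝ φ y (EuclideanSpace.basisFun (Fin N) ℝ j)) x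
        (EuclideanSpace.basisFun (Fin N) ℝ i)) ^ 2
      ≤ ∫ x, (Laplacian.laplacian φ x) ^ 2 := by
  set e := fun i => EuclideanSpace.basisFun (Fin N) ℝ i with he
  let D : Fin N → Fin N → RN N → ℝ := fun i j x => fderiv ℝ (fun y => fderiv ℝ φ y (e j)) x (e i)
  have hD : ∀ i j, IsTest (D i j) := fun i j => (h.fderiv_apply _).fderiv_apply _
  have hDint : ∀ i j k l, Integrable (fun x => D i j x * D k l x) volume := fun i j k l =>
    ((hD i j).mul_left (hD k l).1).integrable
  -- Two integrations by parts and the symmetry of derivatives. Summed over `i, j` this yields `∑ ∫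
  -- (∂ᵢ∂ⱼφ)² = ∫ (Δφ)²`.
  have key : ∀ i j, ∫ x, (D i j x) ^ 2 = ∫ x, D i i x * D j j x := by
    intro i j
    have hcomm : ∀ x, D i j x = D j i x := fun x => fderiv_fderiv_comm h x _ _
    have hsw : (fun y => fderiv ℝ (fun z => fderiv ℝ (fun y => fderiv ℝ φ y (e i)) z (e j)) y (e i))
        = fun y => fderiv ℝ (fun z => fderiv ℝ (fun y => fderiv ℝ φ y (e i)) z (e i)) y (e j) :=
      funext fun y => fderiv_fderiv_comm (h.fderiv_apply (e i)) y _ _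
    have h1 := (hD j i).integral_mul_fderiv (h.fderiv_apply (e j)) (e i)
    have h2 := (h.fderiv_apply (e j)).integral_mul_fderiv (hD i i) (e j)
    calc ∫ x, (D i j x) ^ 2 = ∫ x, D j i x * D i j x := by
          refine integral_congr_ae (Eventually.of_forall fun x => ?_)
          simp only [sq, hcomm x]
      _ = -∫ x, fderiv ℝ (D j i) x (e i) * fderiv ℝ φ x (e j) := h1
      _ = -∫ x, fderiv ℝ φ x (e j) * fderiv ℝ (D i i) x (e j) := by
          congr 1
          refine integral_congr_ae (Eventually.of_forall fun x => ?_)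
          have := congrFun hsw x
          change fderiv ℝ (D j i) x (e i) = fderiv ℝ (D i i) x (e j) at this
          simp only [this, mul_comm]
      _ = ∫ x, D j j x * D i i x := by rw [h2, neg_neg]
      _ = _ := by simp only [mul_comm]
  have hsum : ∑ i, ∑ j, ∫ x, (D i j x) ^ 2 = ∫ x, (Laplacian.laplacian φ x) ^ 2 := by
    simp only [key]
    have e1 : ∀ x, (Laplacian.laplacian φ x) ^ 2 = ∑ i, ∑ j, D i i x * D j j x := by
      intro x
      rw [laplacian_eq_sum h.1, sq, Finset.sum_mul_sum]
    simp only [e1]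
    rw [integral_finsetSum _ fun i _ => integrable_finsetSum _ fun j _ => hDint i i j j]
    exact Finset.sum_congr rfl fun i _ => (integral_finsetSum _ fun j _ => hDint i i j j).symm
  rw [← hsum]
  have hn : ∀ i j, 0 ≤ ∫ x, (D i j x) ^ 2 := fun i j => integral_nonneg fun x => sq_nonneg _
  exact (Finset.single_le_sum (f := fun j => ∫ x, (D i j x) ^ 2) (fun j _ => hn i j)
    (Finset.mem_univ j)).trans (Finset.single_le_sum (f := fun i => ∑ j, ∫ x, (D i j x) ^ 2)
      (fun i _ => Finset.sum_nonneg fun j _ => hn i j) (Finset.mem_univ i))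

lemma norm_le_sum_basis {F : Type*} [NormedAddCommGroup F] [NormedSpace ℝ F] (L : RN N →L[ℝ] F) :
    ‖L‖ ≤ ∑ i, ‖L (EuclideanSpace.basisFun (Fin N) ℝ i)‖ := by
  refine L.opNorm_le_bound (Finset.sum_nonneg fun i _ => norm_nonneg _) fun x => ?_
  conv_lhs => rw [← (EuclideanSpace.basisFun (Fin N) ℝ).sum_repr x, map_sum]
  rw [Finset.sum_mul]
  refine (norm_sum_le _ _).trans (Finset.sum_le_sum fun i _ => ?_)
  rw [map_smul, norm_smul, mul_comm]
  gcongr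
  rw [EuclideanSpace.basisFun_repr]
  exact PiLp.norm_apply_le x i

lemma norm_fderiv_fderiv_le {φ : RN N → ℝ} (h : IsTest φ) (x : RN N) :
    ‖fderiv ℝ (fderiv ℝ φ) x‖ ≤ ∑ ij : Fin N × Fin N,
      |fderiv ℝ (fun y => fderiv ℝ φ y (EuclideanSpace.basisFun (Fin N) ℝ ij.2)) x
        (EuclideanSpace.basisFun (Fin N) ℝ ij.1)| := by
  rw [Fintype.sum_prod_type]
  refine (norm_le_sum_basis _).trans (Finset.sum_le_sum fun i _ => ?_)
  refine (norm_le_sum_basis _).trans (Finset.sum_le_sum fun j _ => ?_)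
  rw [fderiv_fderiv_apply h, Real.norm_eq_abs]

lemma eLpNorm_le_card_mul {ι F : Type*} [Fintype ι] [NormedAddCommGroup F] {g : RN N → F}
    {D : ι → RN N → ℝ} (hD : ∀ i, AEStronglyMeasurable (D i) volume)
    (hg : ∀ x, ‖g x‖ ≤ ∑ i, |D i x|) {B : ENNReal} (hB : ∀ i, eLpNorm (D i) 2 volume ≤ B) :
    eLpNorm g 2 volume ≤ Fintype.card ι * B := by
  calc eLpNorm g 2 volume ≤ eLpNorm (fun x => ∑ i, |D i x|) 2 volume := eLpNorm_mono_real hg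
    _ = eLpNorm (∑ i, fun x => ‖D i x‖) 2 volume := by
        congr 1
        ext x
        simp
    _ ≤ ∑ i, eLpNorm (fun x => ‖D i x‖) 2 volume :=
        eLpNorm_sum_le (fun i _ => (hD i).norm) one_le_two
    _ ≤ ∑ _i : ι, B := Finset.sum_le_sum fun i _ => (eLpNorm_norm (D i)).trans_le (hB i)
    _ = _ := by simp

lemma exists_second_partials {φ : RN N → ℝ} (h : IsTest φ) : ∃ D : Fin N × Fin N → RN N → ℝ,
    (∀ ij, IsTest (D ij)) ∧ (∀ x, ‖fderiv ℝ (fderiv ℝ φ) x‖ ≤ ∑ ij, |D ij x|) ∧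
      ∀ ij, ∫ x, (D ij x) ^ 2 ≤ ∫ x, (Laplacian.laplacian φ x) ^ 2 :=
  ⟨fun ij x => fderiv ℝ (fun y => fderiv ℝ φ y (EuclideanSpace.basisFun (Fin N) ℝ ij.2)) x
      (EuclideanSpace.basisFun (Fin N) ℝ ij.1),
    fun _ => (h.fderiv_apply _).fderiv_apply _, norm_fderiv_fderiv_le h,
    fun ij => integral_sq_partial_le h ij.1 ij.2⟩

lemma eLpNorm_fderiv_fderiv_le {φ : RN N → ℝ} (h : IsTest φ) :
    eLpNorm (fderiv ℝ (fderiv ℝ φ)) 2 volume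
      ≤ Fintype.card (Fin N × Fin N) * eLpNorm (Laplacian.laplacian φ) 2 volume := by
  obtain ⟨D, hD, hpt, hsq⟩ := exists_second_partials h
  have hB : ∀ ij, eLpNorm (D ij) 2 volume ≤ eLpNorm (Laplacian.laplacian φ) 2 volume := by
    intro ij
    have h1 := h.laplacian.memLp 2
    exact eLpNorm_two_le_of_integral_sq_le ((hD ij).memLp 2) h1 (hsq ij)
  exact eLpNorm_le_card_mul (g := fderiv ℝ (fderiv ℝ φ))
    (fun ij => (hD ij).continuous.aestronglyMeasurable) hpt hB

lemma fourStar_pos (hN : 5 ≤ N) : 0 < fourStar N := by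
  have : (5 : ℝ) ≤ N := by exact_mod_cast hN
  unfold fourStar
  exact div_pos (by linarith) (by linarith)

/-- The first-order Sobolev inequality used twice: from `L²` to `L^{2N/(N-2)}` for the gradient,
then to `L^{4^*}` for the function. The Hessian is controlled in `L²` by the Laplacian. -/
lemma exists_sobolev_test (hN : 5 ≤ N) : ∃ C : NNReal, ∀ {φ : RN N → ℝ}, IsTest φ →
    eLpNorm φ (ENNReal.ofReal (fourStar N)) volume ≤ C * eLpNorm (Laplacian.laplacian φ) 2 volume := by
  have hN' : (5 : ℝ) ≤ N := by exact_mod_cast hN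
  set q : NNReal := (fourStar N).toNNReal with hq
  have hqr : (q : ℝ) = 2 * N / (N - 4) := Real.coe_toNNReal _ (fourStar_pos hN).le
  set r : NNReal := (2 * N / (N - 2) : ℝ).toNNReal with hr
  have hrr : (r : ℝ) = 2 * N / (N - 2) :=
    Real.coe_toNNReal _ (div_pos (by linarith) (by linarith)).le
  have hfin : Module.finrank ℝ (RN N) = N := finrank_euclideanSpace_fin
  have hpos : 0 < Module.finrank ℝ (RN N) := by rw [hfin]; omega
  refine ⟨SNormLESNormFDerivOfEqConst ℝ (volume : Measure (RN N)) (r : ℝ) *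
    (SNormLESNormFDerivOfEqConst (RN N →L[ℝ] ℝ) (volume : Measure (RN N)) ((2 : NNReal) : ℝ) * Fintype.card (Fin N × Fin N)),
    fun {φ} h => ?_⟩
  have h1 : eLpNorm φ q volume ≤ SNormLESNormFDerivOfEqConst ℝ (volume : Measure (RN N)) (r : ℝ)
      * eLpNorm (fderiv ℝ φ) r volume := by
    refine eLpNorm_le_eLpNorm_fderiv_of_eq volume (h.1.of_le (by simp)) h.2 ?_ hpos ?_
    · rw [← NNReal.coe_le_coe, hrr, NNReal.coe_one, le_div_iff₀ (by linarith)]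
      linarith
    · rw [hfin, hqr, NNReal.coe_inv, hrr]
      have : (N : ℝ) - 4 ≠ 0 := by linarith
      have : (N : ℝ) - 2 ≠ 0 := by linarith
      field_simp
      ring
  have h2 : eLpNorm (fderiv ℝ φ) r volume
      ≤ SNormLESNormFDerivOfEqConst (RN N →L[ℝ] ℝ) (volume : Measure (RN N)) ((2 : NNReal) : ℝ)
      * eLpNorm (fderiv ℝ (fderiv ℝ φ)) (2 : NNReal) volume := by
    refine eLpNorm_le_eLpNorm_fderiv_of_eq volume ((h.1.fderiv_right (m := ∞) (by simp)).of_le (by simp))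
      (h.2.fderiv ℝ) (by norm_num) hpos ?_
    rw [hfin, hrr, NNReal.coe_inv]
    have : (N : ℝ) - 2 ≠ 0 := by linarith
    push_cast
    field_simp
  have h3 := eLpNorm_fderiv_fderiv_le h
  calc eLpNorm φ q volume ≤ _ := h1
    _ ≤ SNormLESNormFDerivOfEqConst ℝ (volume : Measure (RN N)) (r : ℝ) *
        (SNormLESNormFDerivOfEqConst (RN N →L[ℝ] ℝ) (volume : Measure (RN N)) ((2 : NNReal) : ℝ)
          * (Fintype.card (Fin N × Fin N) * eLpNorm (Laplacian.laplacian φ) 2 volume)) := by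
        gcongr
        refine h2.trans ?_
        gcongr
        exact h3
    _ = _ := by rw [ENNReal.coe_mul, ENNReal.coe_mul, ENNReal.coe_natCast]; ring

/-- A sequence of test functions converging to `u` in `H²` and almost everywhere. -/
lemma exists_test_seq (u : H2 N) : ∃ (φ : ℕ → RN N → ℝ) (h : ∀ n, IsTest (φ n)),
    Tendsto (fun n => ofTest (h n)) atTop (𝓝 u) ∧
    ∀ᵐ x, Tendsto (fun n => φ n x) atTop (𝓝 (u.fn x)) := by
  choose ψ hψ hlt using fun n : ℕ => exists_ofTest_dist_lt u (Nat.one_div_pos_of_nat (n := n) (α := ℝ))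
  have hlim : Tendsto (fun n => ofTest (hψ n)) atTop (𝓝 u) := by
    rw [tendsto_iff_norm_sub_tendsto_zero]
    exact squeeze_zero (fun _ => norm_nonneg _) (fun n => (hlt n).le)
      tendsto_one_div_add_atTop_nhds_zero_nat
  have hmeas := tendstoInMeasure_of_tendsto_Lp ((H2.fnL.continuous.tendsto u).comp hlim)
  obtain ⟨ns, hns, hae⟩ := hmeas.exists_seq_tendsto_ae
  refine ⟨fun n => ψ (ns n), fun n => hψ (ns n), hlim.comp hns.tendsto_atTop, ?_⟩
  have hcoe : ∀ᵐ x, ∀ n, (ofTest (hψ n)).fn x = ψ n x := ae_all_iff.2 fun n => ofTest_coeFn (hψ n)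
  filter_upwards [hae, hcoe] with x h1 h2
  have : ∀ n, (H2.fnL (ofTest (hψ (ns n)))) x = ψ (ns n) x := fun n => h2 (ns n)
  simp only [Function.comp_apply, this] at h1
  exact h1

/-- **The Sobolev inequality** on `H²`. -/
theorem exists_sobolev (hN : 5 ≤ N) : ∃ C : ℝ, 0 < C ∧ ∀ u : H2 N,
    MemLp u.fn (ENNReal.ofReal (fourStar N)) volume ∧
      eLpNorm u.fn (ENNReal.ofReal (fourStar N)) volume ≤ ENNReal.ofReal (C * ‖u.lap‖) := by
  obtain ⟨C, hC⟩ := exists_sobolev_test hN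
  refine ⟨C + 1, by positivity, fun u => ?_⟩
  obtain ⟨φ, hφ, hlim, hae⟩ := exists_test_seq u
  -- Fatou's lemma carries the inequality, and with it membership in `L^{4^*}`, from test functions
  -- to all of `H²`.
  have h1 := Lp.eLpNorm_lim_le_liminf_eLpNorm (p := ENNReal.ofReal (fourStar N))
    (fun n => (hφ n).continuous.aestronglyMeasurable) u.fn hae
  have h2 : ∀ n, eLpNorm (φ n) (ENNReal.ofReal (fourStar N)) volume
      ≤ ENNReal.ofReal (C * ‖(ofTest (hφ n)).lap‖) := by
    intro n
    refine (hC (hφ n)).trans (le_of_eq ?_)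
    rw [ENNReal.ofReal_mul C.coe_nonneg, ENNReal.ofReal_coe_nnreal, ofTest_lap, Lp.norm_toLp,
      ENNReal.ofReal_toReal ((hφ n).laplacian.memLp 2).2.ne]
  have h3 : Tendsto (fun n => ENNReal.ofReal (C * ‖(ofTest (hφ n)).lap‖)) atTop
      (𝓝 (ENNReal.ofReal (C * ‖u.lap‖))) :=
    ENNReal.tendsto_ofReal ((((H2.lapL.continuous.tendsto u).comp hlim).norm).const_mul _)
  have h4 : eLpNorm u.fn (ENNReal.ofReal (fourStar N)) volume ≤ ENNReal.ofReal (C * ‖u.lap‖) := by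
    refine h1.trans ?_
    rw [← h3.liminf_eq]
    exact liminf_le_liminf (Eventually.of_forall h2)
  have h5 : eLpNorm u.fn (ENNReal.ofReal (fourStar N)) volume
      ≤ ENNReal.ofReal ((C + 1) * ‖u.lap‖) :=
    h4.trans (ENNReal.ofReal_le_ofReal (by gcongr; linarith))
  exact ⟨⟨Lp.aestronglyMeasurable _, h5.trans_lt ENNReal.ofReal_lt_top⟩, h5⟩

end Sobolev

end

noncomputable section

/-! ### Exponents -/

section Exponents

variable {N : ℕ} {p : ℝ}

lemma two_lt_fourStar (hN : 5 ≤ N) : 2 < fourStar N := by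
  have : (5 : ℝ) ≤ N := by exact_mod_cast hN
  unfold fourStar
  rw [lt_div_iff₀ (by linarith)]
  linarith

lemma lt_fourStar (hN : 5 ≤ N) (hp' : p < 2 + 4 / (N : ℝ)) : p < fourStar N := by
  have h5 : (5 : ℝ) ≤ N := by exact_mod_cast hN
  refine hp'.trans ?_
  unfold fourStar
  rw [lt_div_iff₀ (by linarith)]
  have h4 : (4 : ℝ) / N * N = 4 := div_mul_cancel₀ _ (by linarith)
  have h6 : (0 : ℝ) < 4 / N := by positivity
  nlinarith

lemma mul_gam (hp : 2 < p) : p * gam N p = N * (p - 2) / 4 := by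
  unfold gam
  have : p ≠ 0 := by linarith
  field_simp
  ring

lemma mul_gam_pos (hN : 5 ≤ N) (hp : 2 < p) : 0 < p * gam N p := by
  have h5 : (5 : ℝ) ≤ N := by exact_mod_cast hN
  rw [mul_gam hp]
  have : 0 < p - 2 := by linarith
  positivity

/-- As `pγ_p = N(p-2)/4`, the hypothesis `p < 2 + 4/N` is equivalent to `pγ_p < 1`. This is stronger
than mass-subcriticality for the bi-Laplacian, which is `pγ_p < 2`; the stronger form is what beats
the gradient term under dilation. -/
lemma mul_gam_lt_one (hN : 5 ≤ N) (hp : 2 < p) (hp' : p < 2 + 4 / (N : ℝ)) : p * gam N p < 1 := by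
  have h5 : (5 : ℝ) ≤ N := by exact_mod_cast hN
  rw [mul_gam hp]
  have h4 : (4 : ℝ) / N * N = 4 := div_mul_cancel₀ _ (by linarith)
  nlinarith

/-- `p` is the convex combination of `2` and `4^*` with weight `p γ_p / 4^*`. -/
lemma exponent_interpolation (hN : 5 ≤ N) (hp : 2 < p) :
    1 - p * gam N p / fourStar N = p * (1 - gam N p) / 2 := by
  have h5 : (5 : ℝ) ≤ N := by exact_mod_cast hN
  have h1 : p * (1 - gam N p) = p - N * (p - 2) / 4 := by rw [mul_sub, mul_gam hp, mul_one]
  rw [mul_gam hp, h1]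
  unfold fourStar
  have : (N : ℝ) - 4 ≠ 0 := by linarith
  have : (N : ℝ) ≠ 0 := by linarith
  field_simp
  ring

end Exponents

/-! ### Interpolation, Gagliardo-Nirenberg and Sobolev inequalities -/

lemma integrable_rpow_interpolation {α : Type*} [MeasurableSpace α] {μ : Measure α} {f : α → ℝ}
    {q r t : ℝ} (hq : 0 < q) (ht0 : 0 ≤ t) (ht1 : t ≤ 1) (hr : r = 2 * (1 - t) + q * t)
    (h2 : Integrable (fun x => |f x| ^ (2 : ℝ)) μ) (hfq : Integrable (fun x => |f x| ^ q) μ) :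
    Integrable (fun x => |f x| ^ r) μ ∧
      ∫ x, |f x| ^ r ∂μ ≤ (∫ x, |f x| ^ (2 : ℝ) ∂μ) ^ (1 - t) * (∫ x, |f x| ^ q ∂μ) ^ t := by
  have h := hoelder_two (μ := μ) (f := f) (g := f) (a := 2 * (1 - t)) (b := q * t) two_pos hq
    (by linarith) (by positivity) (by field_simp; ring) h2 hfq
  have e : ∀ x, |f x| ^ (2 * (1 - t)) * |f x| ^ (q * t) = |f x| ^ r := fun x => by
    rw [hr, Real.rpow_add_of_nonneg (abs_nonneg _) (by linarith) (by positivity)]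
  have e1 : 2 * (1 - t) / 2 = 1 - t := by ring
  have e2 : q * t / q = t := by field_simp
  simpa only [e, e1, e2] using h

namespace H2

variable {N : ℕ}

lemma integrable_rpow_two (u : H2 N) : Integrable (fun x => |u.fn x| ^ (2 : ℝ)) volume := by
  simpa using (Lp.memLp u.fn).integrable_sq

lemma integral_rpow_two (u : H2 N) : ∫ x, |u.fn x| ^ (2 : ℝ) = ‖u.fn‖ ^ 2 := by
  rw [← real_inner_self_eq_norm_sq, L2.inner_def]
  refine integral_congr_ae (Eventually.of_forall fun x => ?_)
  simp

lemma integrable_rpow_fourStar (hN : 5 ≤ N) (u : H2 N) :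
    Integrable (fun x => |u.fn x| ^ fourStar N) volume := by
  obtain ⟨C, _, hC⟩ := exists_sobolev hN
  have h := (hC u).1.integrable_norm_rpow (by simpa using fourStar_pos hN) (by simp)
  simpa [ENNReal.toReal_ofReal (fourStar_pos hN).le] using h

lemma powInt_nonneg (q : ℝ) (u : H2 N) : 0 ≤ u.powInt q :=
  integral_nonneg fun _ => Real.rpow_nonneg (abs_nonneg _) _

/-- Every `q ∈ [2, 4^*]` is a convex combination of `2` and `4^*`. -/
lemma exists_weight (hN : 5 ≤ N) {q : ℝ} (hq : 2 ≤ q) (hq' : q ≤ fourStar N) :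
    ∃ t, 0 ≤ t ∧ t ≤ 1 ∧ q = 2 * (1 - t) + fourStar N * t := by
  have h := two_lt_fourStar hN
  refine ⟨(q - 2) / (fourStar N - 2), div_nonneg (by linarith) (by linarith),
    (div_le_one (by linarith)).2 (by linarith), ?_⟩
  have : fourStar N - 2 ≠ 0 := by linarith
  field_simp
  ring

lemma integrable_rpow (hN : 5 ≤ N) {q : ℝ} (hq : 2 ≤ q) (hq' : q ≤ fourStar N) (u : H2 N) :
    Integrable (fun x => |u.fn x| ^ q) volume := by
  obtain ⟨t, h0, h1, ht⟩ := exists_weight hN hq hq'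
  exact (integrable_rpow_interpolation (fourStar_pos hN) h0 h1 ht u.integrable_rpow_two
    (u.integrable_rpow_fourStar hN)).1

lemma exists_powInt_fourStar_le (hN : 5 ≤ N) : ∃ C : ℝ, 0 < C ∧ ∀ u : H2 N,
    u.powInt (fourStar N) ≤ (C * ‖u.lap‖) ^ fourStar N := by
  obtain ⟨C, hC0, hC⟩ := exists_sobolev hN
  refine ⟨C, hC0, fun u => ?_⟩
  have hq := fourStar_pos hN
  have h := (hC u).2
  rw [(hC u).1.eLpNorm_eq_integral_rpow_norm (by simpa using hq) (by simp),
    ENNReal.toReal_ofReal hq.le, ENNReal.ofReal_le_ofReal_iff (by positivity)] at h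
  exact (Real.rpow_inv_le_iff_of_pos (u.powInt_nonneg _) (by positivity) hq).1 h

lemma powInt_le_interpolation (hN : 5 ≤ N) {q t : ℝ} (h0 : 0 ≤ t) (h1 : t ≤ 1)
    (ht : q = 2 * (1 - t) + fourStar N * t) (u : H2 N) :
    u.powInt q ≤ (‖u.fn‖ ^ 2) ^ (1 - t) * u.powInt (fourStar N) ^ t := by
  have h := (integrable_rpow_interpolation (fourStar_pos hN) h0 h1 ht u.integrable_rpow_two
    (u.integrable_rpow_fourStar hN)).2
  rwa [integral_rpow_two] at h

/-- `L^q` bounds with separate powers of the mass and of the Laplacian. -/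
lemma exists_powInt_le_mul (hN : 5 ≤ N) {q t : ℝ} (h0 : 0 ≤ t) (h1 : t ≤ 1)
    (ht : q = 2 * (1 - t) + fourStar N * t) : ∃ C : ℝ, 0 < C ∧ ∀ u : H2 N,
      u.powInt q ≤ C * ‖u.lap‖ ^ (fourStar N * t) * ‖u.fn‖ ^ (2 * (1 - t)) := by
  obtain ⟨C, hC0, hC⟩ := exists_powInt_fourStar_le hN
  refine ⟨C ^ (fourStar N * t), by positivity, fun u => ?_⟩
  refine (powInt_le_interpolation hN h0 h1 ht u).trans ?_
  have e1 : (‖u.fn‖ ^ 2) ^ (1 - t) = ‖u.fn‖ ^ (2 * (1 - t)) := by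
    rw [Real.rpow_mul (norm_nonneg _), Real.rpow_two]
  have e2 : C ^ (fourStar N * t) * ‖u.lap‖ ^ (fourStar N * t) = ((C * ‖u.lap‖) ^ fourStar N) ^ t := by
    rw [← Real.mul_rpow hC0.le (norm_nonneg _), Real.rpow_mul (by positivity)]
  rw [e1, e2, mul_comm]
  gcongr
  · exact u.powInt_nonneg _
  · exact hC u

lemma exists_powInt_le (hN : 5 ≤ N) {q : ℝ} (hq : 2 ≤ q) (hq' : q ≤ fourStar N) :
    ∃ C : ℝ, 0 < C ∧ ∀ u : H2 N, u.powInt q ^ (1 / q) ≤ C * ‖u‖ := by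
  obtain ⟨t, h0, h1, ht⟩ := exists_weight hN hq hq'
  obtain ⟨C, hC0, hC⟩ := exists_powInt_le_mul hN h0 h1 ht
  have hq0 : 0 < q := by linarith
  refine ⟨C ^ (1 / q), by positivity, fun u => ?_⟩
  have h4 := fourStar_pos hN
  have h2 : u.powInt q ≤ C * ‖u‖ ^ q := by
    refine (hC u).trans ?_
    conv_rhs => rw [ht]
    rw [mul_assoc, add_comm, Real.rpow_add_of_nonneg (norm_nonneg _) (by positivity) (by linarith)]
    gcongr
    · exact u.norm_lap_le
    · exact u.norm_fn_le
  calc u.powInt q ^ (1 / q) ≤ (C * ‖u‖ ^ q) ^ (1 / q) :=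
        Real.rpow_le_rpow (u.powInt_nonneg _) h2 (by positivity)
    _ = C ^ (1 / q) * ‖u‖ := by
        rw [Real.mul_rpow hC0.le (by positivity), ← Real.rpow_mul (norm_nonneg _),
          mul_one_div_cancel hq0.ne', Real.rpow_one]

lemma powInt_pos (hN : 5 ≤ N) {q : ℝ} (hq : 2 ≤ q) (hq' : q ≤ fourStar N) {u : H2 N} (hu : u ≠ 0) :
    0 < u.powInt q := by
  refine (u.powInt_nonneg q).lt_of_ne' fun h => hu ?_
  refine eq_zero_of_fn_eq_zero ?_
  rw [Lp.eq_zero_iff_ae_eq_zero]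
  have h1 := (integral_eq_zero_iff_of_nonneg (fun x => Real.rpow_nonneg (abs_nonneg (u.fn x)) q)
    (u.integrable_rpow hN hq hq')).1 h
  filter_upwards [h1] with x hx
  have := (Real.rpow_eq_zero (abs_nonneg (u.fn x)) (by linarith)).1 hx
  simpa using this

lemma exists_ne_zero (N : ℕ) : ∃ u : H2 N, u ≠ 0 := by
  let b : ContDiffBump (0 : RN N) := ⟨1, 2, one_pos, one_lt_two⟩
  have hb : IsTest b := ⟨b.contDiff, b.hasCompactSupport⟩
  refine ⟨ofTest hb, fun h => ?_⟩
  have h1 : (ofTest hb).fn = 0 := by rw [h]; rfl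
  have h2 : (b : RN N → ℝ) =ᵐ[volume] 0 :=
    (ofTest_coeFn hb).symm.trans ((Lp.eq_zero_iff_ae_eq_zero).1 h1)
  have h3 : ∫ x, b x = 0 := by rw [integral_congr_ae h2]; simp
  exact (b.integral_pos (μ := volume)).ne' h3

end H2

/-! ### The best constants in the Gagliardo–Nirenberg and Sobolev inequalities. -/

section Constants

variable {N : ℕ} {p : ℝ}

/-- Interpolation of `L^p` between `L²` and `L^{4^*}` with weight `pγ_p/4^*`, followed by Sobolev.
It shows that the infimum defining `gnConst` runs over a nonempty set. -/
lemma exists_gagliardoNirenberg (hN : 5 ≤ N) (hp : 2 < p) (hp' : p < 2 + 4 / (N : ℝ)) :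
    ∃ C : ℝ, 0 ≤ C ∧ ∀ u : H2 N,
      u.powInt p ^ (1 / p) ≤ C * ‖u.lap‖ ^ gam N p * ‖u.fn‖ ^ (1 - gam N p) := by
  have hq := fourStar_pos hN
  have hg := mul_gam_pos hN hp
  have hp0 : 0 < p := by linarith
  have e := exponent_interpolation hN hp
  have ht0 : 0 ≤ p * gam N p / fourStar N := by positivity
  have ht1 : p * gam N p / fourStar N ≤ 1 :=
    (div_le_one hq).2 (by linarith [mul_gam_lt_one hN hp hp', two_lt_fourStar hN])
  have e1 : fourStar N * (p * gam N p / fourStar N) = p * gam N p := by field_simp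
  have e2 : 2 * (1 - p * gam N p / fourStar N) = p * (1 - gam N p) := by rw [e]; ring
  obtain ⟨C, hC0, hC⟩ := H2.exists_powInt_le_mul hN (q := p) ht0 ht1 (by rw [e1, e2]; ring)
  rw [e1, e2] at hC
  refine ⟨C ^ (1 / p), by positivity, fun u => ?_⟩
  calc u.powInt p ^ (1 / p)
      ≤ (C * ‖u.lap‖ ^ (p * gam N p) * ‖u.fn‖ ^ (p * (1 - gam N p))) ^ (1 / p) :=
        Real.rpow_le_rpow (u.powInt_nonneg _) (hC u) (by positivity)
    _ = _ := by
        rw [Real.mul_rpow (by positivity) (by positivity), Real.mul_rpow hC0.le (by positivity),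
          ← Real.rpow_mul (norm_nonneg _), ← Real.rpow_mul (norm_nonneg _)]
        congr 3 <;> field_simp

/-- The admissible constants form a nonempty closed set bounded below, so the infimum is itself
admissible. -/
lemma gnConst_spec (hN : 5 ≤ N) (hp : 2 < p) (hp' : p < 2 + 4 / (N : ℝ)) :
    0 ≤ gnConst N p ∧ ∀ u : H2 N,
      u.powInt p ^ (1 / p) ≤ gnConst N p * ‖u.lap‖ ^ gam N p * ‖u.fn‖ ^ (1 - gam N p) := by
  have hcl : IsClosed {C : ℝ | 0 ≤ C ∧ ∀ u : H2 N,
      u.powInt p ^ (1 / p) ≤ C * ‖u.lap‖ ^ gam N p * ‖u.fn‖ ^ (1 - gam N p)} := by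
    have h : IsClosed (Set.Ici 0 ∩ ⋂ u : H2 N, {C : ℝ |
        u.powInt p ^ (1 / p) ≤ C * ‖u.lap‖ ^ gam N p * ‖u.fn‖ ^ (1 - gam N p)}) :=
      isClosed_Ici.inter <| isClosed_iInter fun u =>
        isClosed_le continuous_const (by fun_prop)
    convert h using 1
    ext C
    simp
  exact hcl.csInf_mem (exists_gagliardoNirenberg hN hp hp') ⟨0, fun C hC => hC.1⟩

lemma gnConst_pos (hN : 5 ≤ N) (hp : 2 < p) (hp' : p < 2 + 4 / (N : ℝ)) : 0 < gnConst N p := by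
  obtain ⟨h0, h⟩ := gnConst_spec hN hp hp'
  refine h0.lt_of_ne' fun h1 => ?_
  obtain ⟨u, hu⟩ := H2.exists_ne_zero N
  have h2 := h u
  rw [h1, zero_mul, zero_mul] at h2
  have := H2.powInt_pos hN hp.le (lt_fourStar hN hp').le hu
  exact absurd h2 (not_le.2 (by positivity))

lemma powInt_le_gnConst (hN : 5 ≤ N) (hp : 2 < p) (hp' : p < 2 + 4 / (N : ℝ)) (u : H2 N) :
    u.powInt p ≤ gnConst N p ^ p * ‖u.lap‖ ^ (p * gam N p) * ‖u.fn‖ ^ (p * (1 - gam N p)) := by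
  obtain ⟨h0, h⟩ := gnConst_spec hN hp hp'
  have hp0 : 0 < p := by linarith
  have h1 := h u
  rw [one_div, Real.rpow_inv_le_iff_of_pos (u.powInt_nonneg _) (by positivity) hp0,
    Real.mul_rpow (by positivity) (by positivity), Real.mul_rpow h0 (by positivity),
    ← Real.rpow_mul (norm_nonneg _), ← Real.rpow_mul (norm_nonneg _)] at h1
  rwa [mul_comm p, mul_comm p]

/-- The Sobolev inequality with constant `C` bounds every quotient below by `1 / C²`. Positivity is
essential, since `S` occurs in denominators. -/
lemma sobolevS_pos (hN : 5 ≤ N) : 0 < sobolevS N := by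
  obtain ⟨C, hC0, hC⟩ := H2.exists_powInt_fourStar_le hN
  have hq := fourStar_pos hN
  have hle : 1 / C ^ 2 ≤ sobolevS N := by
    obtain ⟨u₀, hu₀⟩ := H2.exists_ne_zero N
    refine le_csInf ⟨_, u₀, hu₀, rfl⟩ ?_
    rintro _ ⟨u, hu, rfl⟩
    have hpos : 0 < u.powInt (fourStar N) := H2.powInt_pos hN (two_lt_fourStar hN).le le_rfl hu
    rw [div_le_div_iff₀ (by positivity) (by positivity), one_mul]
    calc u.powInt (fourStar N) ^ (2 / fourStar N)
        ≤ ((C * ‖u.lap‖) ^ fourStar N) ^ (2 / fourStar N) :=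
          Real.rpow_le_rpow hpos.le (hC u) (by positivity)
      _ = ‖u.lap‖ ^ 2 * C ^ 2 := by
          rw [← Real.rpow_mul (by positivity), mul_div_cancel₀ _ hq.ne', Real.rpow_two]
          ring
  exact lt_of_lt_of_le (by positivity) hle

lemma sobolevS_mul_powInt_le (hN : 5 ≤ N) (u : H2 N) :
    sobolevS N ^ (fourStar N / 2) * u.powInt (fourStar N) ≤ ‖u.lap‖ ^ fourStar N := by
  have hq := fourStar_pos hN
  have hS := sobolevS_pos hN
  by_cases hu : u = 0
  -- `u = 0` is excluded from the infimum, so this case is read off from the Sobolev inequality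
  -- itself.
  · obtain ⟨C, hC0, hC⟩ := H2.exists_powInt_fourStar_le hN
    have h1 : u.lap = 0 := by rw [hu]; rfl
    have h2 := hC u
    rw [h1, norm_zero, mul_zero, Real.zero_rpow hq.ne'] at h2
    have := mul_nonpos_of_nonneg_of_nonpos (Real.rpow_nonneg hS.le (fourStar N / 2)) h2
    exact this.trans (by positivity)
  · have hpos : 0 < u.powInt (fourStar N) := H2.powInt_pos hN (two_lt_fourStar hN).le le_rfl hu
    have h1 : sobolevS N ≤ ‖u.lap‖ ^ 2 / u.powInt (fourStar N) ^ (2 / fourStar N) := by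
      refine csInf_le ⟨0, ?_⟩ ⟨u, hu, rfl⟩
      rintro _ ⟨v, _, rfl⟩
      have := v.powInt_nonneg (fourStar N)
      positivity
    rw [le_div_iff₀ (by positivity)] at h1
    have h2 := Real.rpow_le_rpow (by positivity) h1 (z := fourStar N / 2) (by positivity)
    rw [Real.mul_rpow hS.le (by positivity), ← Real.rpow_mul hpos.le,
      ← Real.rpow_two ‖u.lap‖, ← Real.rpow_mul (norm_nonneg _)] at h2
    have e1 : 2 / fourStar N * (fourStar N / 2) = 1 := by field_simp
    have e2 : 2 * (fourStar N / 2) = fourStar N := by ring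
    rwa [e1, e2, Real.rpow_one] at h2

end Constants

end

noncomputable section

/-! ### Pointwise estimates for powers -/

section Pointwise

/-- Bernoulli's inequality `(1 + s)^{r+1} ≥ 1 + (r+1)s` at `s = y/x - 1`. The extra factor `y`
compensates for the failure of `t ↦ t^r` to be Lipschitz at `0` when `r < 1`, so one argument covers
all `r > 0`. -/
lemma rpow_sub_rpow_mul_le {r x y : ℝ} (hr : 0 < r) (hy : 0 ≤ y) (hyx : y ≤ x) :
    (x ^ r - y ^ r) * y ≤ r * x ^ r * (x - y) := by
  rcases hy.eq_or_lt with rfl | hy0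
  · have := Real.rpow_nonneg hyx r
    simp only [mul_zero, sub_zero]
    positivity
  have hx : 0 < x := hy0.trans_le hyx
  have h := one_add_mul_self_le_rpow_one_add (s := y / x - 1) (by linarith [div_pos hy0 hx])
    (p := r + 1) (by linarith)
  rw [add_sub_cancel, Real.div_rpow hy0.le hx.le, le_div_iff₀ (by positivity),
    Real.rpow_add hx, Real.rpow_add hy0, Real.rpow_one, Real.rpow_one] at h
  have e : (1 + (r + 1) * (y / x - 1)) * (x ^ r * x) = x ^ r * (x + (r + 1) * (y - x)) := by
    field_simp
  rw [e] at h
  nlinarith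

/-- Split `|a|^{q-2}a - |b|^{q-2}b` as `|a|^{q-2}(a - b) + (|a|^{q-2} - |b|^{q-2})b` with `|b| ≤
|a|`; the previous lemma handles the second summand. -/
lemma abs_signedPow_sub_le {q a b M : ℝ} (hq : 2 < q) (ha : |a| ≤ M) (hb : |b| ≤ M) :
    |(|a| ^ (q - 2) * a - |b| ^ (q - 2) * b)| ≤ (q - 1) * M ^ (q - 2) * |a - b| := by
  wlog hab : |b| ≤ |a| generalizing a b
  · have := this hb ha (not_le.1 hab).le
    rwa [abs_sub_comm, abs_sub_comm a]
  have hr : 0 < q - 2 := by linarith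
  have h1 := rpow_sub_rpow_mul_le hr (abs_nonneg b) hab
  have h2 : |a| - |b| ≤ |a - b| := abs_sub_abs_le_abs_sub a b
  have h3 : |a| ^ (q - 2) ≤ M ^ (q - 2) := Real.rpow_le_rpow (abs_nonneg _) ha hr.le
  have h4 : |b| ^ (q - 2) ≤ |a| ^ (q - 2) := Real.rpow_le_rpow (abs_nonneg _) hab hr.le
  have h5 : 0 ≤ |a| ^ (q - 2) := Real.rpow_nonneg (abs_nonneg _) _
  calc |(|a| ^ (q - 2) * a - |b| ^ (q - 2) * b)|
      = |(|a| ^ (q - 2) * (a - b) + (|a| ^ (q - 2) - |b| ^ (q - 2)) * b)| := by congr 1; ring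
    _ ≤ |a| ^ (q - 2) * |a - b| + (|a| ^ (q - 2) - |b| ^ (q - 2)) * |b| := by
        refine (abs_add_le _ _).trans (le_of_eq ?_)
        rw [abs_mul, abs_mul, abs_of_nonneg h5, abs_of_nonneg (sub_nonneg.2 h4)]
    _ ≤ |a| ^ (q - 2) * |a - b| + (q - 2) * |a| ^ (q - 2) * |a - b| := by
        have h6 := mul_le_mul_of_nonneg_left h2 (mul_nonneg hr.le h5)
        linarith
    _ = (q - 1) * |a| ^ (q - 2) * |a - b| := by ring
    _ ≤ _ := by gcongr; linarith

/-- A second-order Taylor bound obtained without a second derivative: the mean value inequality on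
`[-|b|, |b|]`, with the Lipschitz bound for the signed power. -/
lemma abs_rpow_add_sub_le {q : ℝ} (hq : 2 < q) (a b : ℝ) :
    |(|a + b| ^ q - |a| ^ q - q * (|a| ^ (q - 2) * a * b))|
      ≤ q * (q - 1) * ((|a| + |b|) ^ (q - 2) * |b| * |b|) := by
  have hder : ∀ t ∈ Set.Icc (-|b|) |b|, HasDerivWithinAt
      (fun t => |a + t| ^ q - q * (|a| ^ (q - 2) * a * t))
      (q * (|a + t| ^ (q - 2) * (a + t) - |a| ^ (q - 2) * a)) (Set.Icc (-|b|) |b|) t := by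
    intro t _
    have h1 := (hasDerivAt_abs_rpow (a + t) (p := q) (by linarith)).comp t
      ((hasDerivAt_id t).const_add a)
    have h2 := ((hasDerivAt_id t).const_mul (|a| ^ (q - 2) * a)).const_mul q
    refine ((h1.sub h2).congr_deriv ?_).hasDerivWithinAt
    ring
  have hbd : ∀ t ∈ Set.Icc (-|b|) |b|, ‖q * (|a + t| ^ (q - 2) * (a + t) - |a| ^ (q - 2) * a)‖
      ≤ q * ((q - 1) * (|a| + |b|) ^ (q - 2) * |b|) := by
    intro t ht
    have htb : |t| ≤ |b| := abs_le.2 ht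
    rw [Real.norm_eq_abs, abs_mul, abs_of_pos (by linarith : 0 < q)]
    refine mul_le_mul_of_nonneg_left ?_ (by linarith)
    refine (abs_signedPow_sub_le hq (M := |a| + |b|) ((abs_add_le a t).trans (by linarith))
      (by linarith [abs_nonneg b])).trans ?_
    have : 0 ≤ (q - 1) * (|a| + |b|) ^ (q - 2) := mul_nonneg (by linarith) (by positivity)
    refine mul_le_mul_of_nonneg_left ?_ this
    rwa [add_sub_cancel_left]
  have h := Convex.norm_image_sub_le_of_norm_hasDerivWithin_le hder hbd (convex_Icc _ _)
    (x := 0) (y := b) ⟨by simp, by simp⟩ ⟨neg_abs_le b, le_abs_self b⟩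
  simp only [add_zero, mul_zero, sub_zero, Real.norm_eq_abs] at h
  calc _ = |(|a + b| ^ q - q * (|a| ^ (q - 2) * a * b) - |a| ^ q)| := by congr 1; ring
    _ ≤ _ := h
    _ = _ := by ring

lemma add_rpow_le_two_rpow_mul {r a b : ℝ} (hr : 0 ≤ r) (ha : 0 ≤ a) (hb : 0 ≤ b) :
    (a + b) ^ r ≤ 2 ^ r * (a ^ r + b ^ r) := by
  have hm : a + b ≤ 2 * max a b := by linarith [le_max_left a b, le_max_right a b]
  have h0 : 0 ≤ max a b := ha.trans (le_max_left a b)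
  calc (a + b) ^ r ≤ (2 * max a b) ^ r := Real.rpow_le_rpow (by positivity) hm hr
    _ = 2 ^ r * max a b ^ r := Real.mul_rpow (by norm_num) h0
    _ ≤ _ := by
        refine mul_le_mul_of_nonneg_left ?_ (by positivity)
        rcases max_cases a b with ⟨h, _⟩ | ⟨h, _⟩ <;> rw [h]
        · linarith [Real.rpow_nonneg hb r]
        · linarith [Real.rpow_nonneg ha r]

end Pointwise

/-! ### Differentiability of `u ↦ ∫ |u|^q` -/

namespace H2

variable {N : ℕ} {q : ℝ}

lemma coeFn_add (u v : H2 N) : ∀ᵐ x, (u + v).fn x = u.fn x + v.fn x := Lp.coeFn_add u.fn v.fn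

lemma coeFn_sub (u v : H2 N) : ∀ᵐ x, (u - v).fn x = u.fn x - v.fn x := Lp.coeFn_sub u.fn v.fn

lemma coeFn_smul (a : ℝ) (u : H2 N) : ∀ᵐ x, (a • u).fn x = a * u.fn x := Lp.coeFn_smul a u.fn

lemma coeFn_neg (u : H2 N) : ∀ᵐ x, (-u).fn x = -u.fn x := Lp.coeFn_neg u.fn

lemma aemeasurable_fn (u : H2 N) : AEMeasurable u.fn volume := (Lp.aestronglyMeasurable u.fn).aemeasurable

/-- Hölder with three factors and the embedding of `H²` into `L^q`. Continuity, differentiability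
and the Lipschitz property of the power functionals reduce to this bound. -/
lemma exists_integral_three_le (hN : 5 ≤ N) (hq : 2 < q) (hq' : q ≤ fourStar N) :
    ∃ K : ℝ, 0 ≤ K ∧ ∀ u v w : H2 N,
      Integrable (fun x => |u.fn x| ^ (q - 2) * |v.fn x| * |w.fn x|) volume ∧
      ∫ x, |u.fn x| ^ (q - 2) * |v.fn x| * |w.fn x| ≤ K * (‖u‖ ^ (q - 2) * ‖v‖ * ‖w‖) := by
  obtain ⟨C, hC0, hC⟩ := exists_powInt_le hN hq.le hq'
  refine ⟨C ^ (q - 2) * C * C, by positivity, fun u v w => ?_⟩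
  have h := hoelder_three hq.le (u.integrable_rpow hN hq.le hq') (v.integrable_rpow hN hq.le hq')
    (w.integrable_rpow hN hq.le hq')
  refine ⟨h.1, h.2.trans ?_⟩
  have hr : 0 ≤ q - 2 := by linarith
  have e : (∫ x, |u.fn x| ^ q) ^ ((q - 2) / q) = (u.powInt q ^ (1 / q)) ^ (q - 2) := by
    rw [← Real.rpow_mul (u.powInt_nonneg q), one_div_mul_eq_div]
    rfl
  rw [e]
  have n1 : ∀ u : H2 N, 0 ≤ u.powInt q ^ (1 / q) := fun u => Real.rpow_nonneg (u.powInt_nonneg q) _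
  calc (u.powInt q ^ (1 / q)) ^ (q - 2) * v.powInt q ^ (1 / q) * w.powInt q ^ (1 / q)
      ≤ (C * ‖u‖) ^ (q - 2) * (C * ‖v‖) * (C * ‖w‖) := by
        have := n1 u
        have := n1 v
        have := n1 w
        gcongr
        exacts [hC u, hC v, hC w]
    _ = _ := by
        rw [Real.mul_rpow hC0.le (norm_nonneg _)]
        ring

lemma exists_integral_add_three_le (hN : 5 ≤ N) (hq : 2 < q) (hq' : q ≤ fourStar N) :
    ∃ K : ℝ, 0 ≤ K ∧ ∀ u v w z : H2 N,
      Integrable (fun x => (|u.fn x| + |v.fn x|) ^ (q - 2) * |w.fn x| * |z.fn x|) volume ∧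
      ∫ x, (|u.fn x| + |v.fn x|) ^ (q - 2) * |w.fn x| * |z.fn x|
        ≤ K * ((‖u‖ ^ (q - 2) + ‖v‖ ^ (q - 2)) * ‖w‖ * ‖z‖) := by
  obtain ⟨K, hK0, hK⟩ := exists_integral_three_le hN hq hq'
  refine ⟨2 ^ (q - 2) * K, by positivity, fun u v w z => ?_⟩
  have hr : 0 ≤ q - 2 := by linarith
  have hpt : ∀ x, (|u.fn x| + |v.fn x|) ^ (q - 2) * |w.fn x| * |z.fn x|
      ≤ 2 ^ (q - 2) * (|u.fn x| ^ (q - 2) * |w.fn x| * |z.fn x|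
        + |v.fn x| ^ (q - 2) * |w.fn x| * |z.fn x|) := by
    intro x
    have h := mul_le_mul_of_nonneg_right (mul_le_mul_of_nonneg_right
      (add_rpow_le_two_rpow_mul hr (abs_nonneg (u.fn x)) (abs_nonneg (v.fn x)))
      (abs_nonneg (w.fn x))) (abs_nonneg (z.fn x))
    linarith
  have hI : Integrable (fun x => 2 ^ (q - 2) * (|u.fn x| ^ (q - 2) * |w.fn x| * |z.fn x|
        + |v.fn x| ^ (q - 2) * |w.fn x| * |z.fn x|)) volume :=
    ((hK u w z).1.add (hK v w z).1).const_mul _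
  have hJ : Integrable (fun x => (|u.fn x| + |v.fn x|) ^ (q - 2) * |w.fn x| * |z.fn x|) volume := by
    refine hI.mono' ?_ (Eventually.of_forall fun x => ?_)
    · have := u.aemeasurable_fn
      have := v.aemeasurable_fn
      have := w.aemeasurable_fn
      have := z.aemeasurable_fn
      exact AEMeasurable.aestronglyMeasurable (by fun_prop)
    · rw [Real.norm_of_nonneg (by positivity)]
      exact hpt x
  refine ⟨hJ, (integral_mono hJ hI hpt).trans ?_⟩
  rw [integral_const_mul, integral_add (hK u w z).1 (hK v w z).1, mul_assoc]
  refine mul_le_mul_of_nonneg_left ?_ (by positivity)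
  linarith [(hK u w z).2, (hK v w z).2]

lemma integrable_signedPow_mul (hN : 5 ≤ N) (hq : 2 < q) (hq' : q ≤ fourStar N) (u v : H2 N) :
    Integrable (fun x => |u.fn x| ^ (q - 2) * u.fn x * v.fn x) volume := by
  have h := (hoelder_three hq.le (u.integrable_rpow hN hq.le hq')
    (u.integrable_rpow hN hq.le hq') (v.integrable_rpow hN hq.le hq')).1
  refine h.mono' ?_ (Eventually.of_forall fun x => ?_)
  · have := u.aemeasurable_fn
    have := v.aemeasurable_fn
    exact AEMeasurable.aestronglyMeasurable (by fun_prop)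
  · rw [Real.norm_eq_abs, abs_mul, abs_mul, abs_of_nonneg (Real.rpow_nonneg (abs_nonneg _) _)]

/-- The functionals `v ↦ ∫ |u|^{q-2} u v`; `q` times them is the derivative of `u ↦ ∫ |u|^q`, and
they depend on `u` in a locally Lipschitz way. -/
theorem exists_powDual (hN : 5 ≤ N) (hq : 2 < q) (hq' : q ≤ fourStar N) :
    ∃ G : H2 N → (H2 N →L[ℝ] ℝ), (∀ u v, G u v = ∫ x, |u.fn x| ^ (q - 2) * u.fn x * v.fn x) ∧
      (∀ u, HasFDerivAt (powInt q) (q • G u) u) ∧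
      ∀ r, ∃ L, 0 ≤ L ∧ ∀ u v, ‖u‖ ≤ r → ‖v‖ ≤ r → ‖G u - G v‖ ≤ L * ‖u - v‖ := by
  obtain ⟨K, hK0, hK⟩ := exists_integral_three_le hN hq hq'
  obtain ⟨K', hK'0, hK'⟩ := exists_integral_add_three_le hN hq hq'
  have hr : 0 ≤ q - 2 := by linarith
  have hInt := integrable_signedPow_mul hN hq hq'
  have hG : ∀ u : H2 N, ∃ G : H2 N →L[ℝ] ℝ,
      ∀ v, G v = ∫ x, |u.fn x| ^ (q - 2) * u.fn x * v.fn x := by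
    intro u
    refine ⟨LinearMap.mkContinuous
      { toFun := fun v => ∫ x, |u.fn x| ^ (q - 2) * u.fn x * v.fn x
        map_add' := fun v w => ?_
        map_smul' := fun a v => ?_ } (K * (‖u‖ ^ (q - 2) * ‖u‖)) fun v => ?_, fun v => rfl⟩
    · rw [← integral_add (hInt u v) (hInt u w)]
      refine integral_congr_ae ?_
      filter_upwards [coeFn_add v w] with x hx
      rw [hx]
      ring
    · rw [RingHom.id_apply, smul_eq_mul, ← integral_const_mul]
      refine integral_congr_ae ?_
      filter_upwards [coeFn_smul a v] with x hx
      rw [hx]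
      ring
    · refine (norm_integral_le_integral_norm _).trans ?_
      have e : ∀ x, ‖|u.fn x| ^ (q - 2) * u.fn x * v.fn x‖
          = |u.fn x| ^ (q - 2) * |u.fn x| * |v.fn x| := fun x => by
        rw [Real.norm_eq_abs, abs_mul, abs_mul, abs_of_nonneg (Real.rpow_nonneg (abs_nonneg _) _)]
      simp only [e]
      exact (hK u u v).2.trans (le_of_eq (by ring))
  choose G hG using hG
  refine ⟨G, hG, fun u => ?_, fun r => ?_⟩
  · have hbd : ∀ v, |(u + v).powInt q - u.powInt q - (q • G u) v|
        ≤ q * (q - 1) * (K' * ((‖u‖ ^ (q - 2) + ‖v‖ ^ (q - 2)) * ‖v‖ * ‖v‖)) := by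
      intro v
      have h1 := (u + v).integrable_rpow hN hq.le hq'
      have h2 := u.integrable_rpow hN hq.le hq'
      have e : (u + v).powInt q - u.powInt q - (q • G u) v
          = ∫ x, (|(u + v).fn x| ^ q - |u.fn x| ^ q
            - q * (|u.fn x| ^ (q - 2) * u.fn x * v.fn x)) := by
        have i1 := integral_sub (h1.sub h2) ((hInt u v).const_mul q)
        have i2 := integral_sub h1 h2
        rw [integral_const_mul, ← hG] at i1
        refine Eq.trans ?_ i1.symm
        exact congrArg (fun t => t - q * G u v) i2.symm
      rw [e]
      refine (abs_integral_le_integral_abs).trans ?_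
      calc ∫ x, |(|(u + v).fn x| ^ q - |u.fn x| ^ q
            - q * (|u.fn x| ^ (q - 2) * u.fn x * v.fn x))|
          ≤ ∫ x, q * (q - 1) * ((|u.fn x| + |v.fn x|) ^ (q - 2) * |v.fn x| * |v.fn x|) := by
            refine integral_mono_ae ((h1.sub h2).sub ((hInt u v).const_mul q)).abs
              ((hK' u v v v).1.const_mul _) ?_
            filter_upwards [coeFn_add u v] with x hx
            simp only [hx]
            exact abs_rpow_add_sub_le hq _ _
        _ ≤ _ := by
            rw [integral_const_mul]
            exact mul_le_mul_of_nonneg_left (hK' u v v v).2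
              (mul_nonneg (by linarith) (by linarith))
    rw [hasFDerivAt_iff_isLittleO_nhds_zero]
    have hO : (fun h : H2 N => (u + h).powInt q - u.powInt q - (q • G u) h)
        =O[𝓝 0] fun h => ‖h‖ ^ 2 := by
      refine Asymptotics.IsBigO.of_bound (q * (q - 1) * (K' * (‖u‖ ^ (q - 2) + 1))) ?_
      filter_upwards [Metric.ball_mem_nhds (0 : H2 N) one_pos] with v hv
      have hv1 : ‖v‖ ≤ 1 := by simpa using (mem_ball_zero_iff.1 hv).le
      have hv2 : ‖v‖ ^ (q - 2) ≤ 1 := Real.rpow_le_one (norm_nonneg _) hv1 hr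
      rw [Real.norm_eq_abs, norm_pow, norm_norm]
      refine (hbd v).trans ?_
      rw [mul_assoc _ (K' * _) _, mul_assoc K', sq, mul_assoc _ ‖v‖ ‖v‖]
      have : 0 ≤ q * (q - 1) := mul_nonneg (by linarith) (by linarith)
      gcongr
    refine hO.trans_isLittleO ?_
    refine Asymptotics.IsLittleO.of_norm_right ?_
    exact (Asymptotics.isLittleO_pow_id (𝕜 := ℝ) one_lt_two).comp_tendsto
      (tendsto_norm_zero (E := H2 N))
  · refine ⟨(q - 1) * (K' * (|r| ^ (q - 2) + |r| ^ (q - 2))),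
      mul_nonneg (by linarith) (by positivity), fun u v hu hv => ?_⟩
    refine ContinuousLinearMap.opNorm_le_bound _ (by
      have : 0 ≤ q - 1 := by linarith
      positivity) fun w => ?_
    rw [sub_apply, hG, hG, ← integral_sub (hInt u w) (hInt v w)]
    refine (norm_integral_le_integral_norm _).trans ?_
    calc ∫ x, ‖|u.fn x| ^ (q - 2) * u.fn x * w.fn x - |v.fn x| ^ (q - 2) * v.fn x * w.fn x‖
        ≤ ∫ x, (q - 1) * ((|u.fn x| + |v.fn x|) ^ (q - 2) * |(u - v).fn x| * |w.fn x|) := by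
          refine integral_mono_ae ((hInt u w).sub (hInt v w)).norm
            ((hK' u v (u - v) w).1.const_mul _) ?_
          filter_upwards [coeFn_sub u v] with x hx
          simp only [hx]
          rw [← sub_mul, Real.norm_eq_abs, abs_mul, ← mul_assoc, ← mul_assoc]
          refine mul_le_mul_of_nonneg_right ?_ (abs_nonneg _)
          exact abs_signedPow_sub_le hq (by linarith [abs_nonneg (v.fn x)])
            (by linarith [abs_nonneg (u.fn x)])
      _ ≤ (q - 1) * (K' * ((‖u‖ ^ (q - 2) + ‖v‖ ^ (q - 2)) * ‖u - v‖ * ‖w‖)) := by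
          rw [integral_const_mul]
          exact mul_le_mul_of_nonneg_left (hK' u v (u - v) w).2 (by linarith)
      _ ≤ (q - 1) * (K' * ((|r| ^ (q - 2) + |r| ^ (q - 2)) * ‖u - v‖ * ‖w‖)) := by
          have := hu.trans (le_abs_self r)
          have := hv.trans (le_abs_self r)
          have : 0 ≤ q - 1 := by linarith
          gcongr
      _ = _ := by ring

end H2

end

noncomputable section

/-! ### The `L²` modulus of continuity of functions with gradient in `L²` -/

section Translation

variable {N : ℕ}

lemma norm_gradient_eq (φ : RN N → ℝ) (x : RN N) : ‖gradient φ x‖ = ‖fderiv ℝ φ x‖ := by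
  rw [gradient, LinearIsometryEquiv.norm_map]

/-- The increment is the average over `t ∈ (0, 1]` of directional derivatives along the segment.
Jensen, Tonelli and translation invariance give the bound. -/
lemma eLpNorm_translation_test_le {φ : RN N → ℝ} (h : IsTest φ) (y : RN N) :
    eLpNorm (fun x => φ (x - y) - φ x) 2 volume ≤ ‖y‖ₑ * eLpNorm (gradient φ) 2 volume := by
  have hfc : Continuous (fderiv ℝ φ) := h.1.continuous_fderiv (by simp)
  let F : RN N → ℝ → ℝ := fun x t => fderiv ℝ φ (x - t • y) (-y)
  have hFc : Continuous (Function.uncurry F) := by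
    have h1 : Continuous fun z : RN N × ℝ => z.1 - z.2 • y := by fun_prop
    exact (hfc.comp h1).clm_apply continuous_const
  have hder : ∀ x t, HasDerivAt (fun t : ℝ => φ (x - t • y)) (F x t) t := by
    intro x t
    have h1 : HasDerivAt (fun t : ℝ => x - t • y) (-y) t := by
      simpa using ((hasDerivAt_id t).smul_const y).const_sub x
    exact (h.differentiable _).hasFDerivAt.comp_hasDerivAt t h1
  let ν : Measure ℝ := volume.restrict (Set.Ioc 0 1)
  have hν : IsProbabilityMeasure ν := ⟨by simp [ν]⟩
  have hInt : ∀ x, φ (x - y) - φ x = ∫ t, F x t ∂ν := by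
    intro x
    have hc : Continuous (F x) := hFc.comp (Continuous.prodMk_right x)
    have h1 := intervalIntegral.integral_eq_sub_of_hasDerivAt (a := 0) (b := 1)
      (fun t _ => hder x t) (hc.intervalIntegrable _ _)
    rw [intervalIntegral.integral_of_le zero_le_one] at h1
    rw [h1]
    simp
  have h1 := lintegral_enorm_integral_sq_le (μ := (volume : Measure (RN N))) (ν := ν)
    hFc.stronglyMeasurable
  simp only [← hInt] at h1
  rw [← eLpNorm_two_sq] at h1
  have h2 : ∀ t, ∫⁻ x, ‖F x t‖ₑ ^ 2 ≤ (‖y‖ₑ * eLpNorm (gradient φ) 2 volume) ^ 2 := by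
    intro t
    calc ∫⁻ x, ‖F x t‖ₑ ^ 2 ≤ ∫⁻ x, ‖y‖ₑ ^ 2 * ‖gradient φ (x - t • y)‖ₑ ^ 2 := by
          refine lintegral_mono fun x => ?_
          rw [← mul_pow]
          gcongr
          rw [← ofReal_norm, ← ofReal_norm, ← ofReal_norm, ← ENNReal.ofReal_mul (norm_nonneg _),
            norm_gradient_eq, mul_comm]
          refine ENNReal.ofReal_le_ofReal ?_
          simpa [F] using (fderiv ℝ φ (x - t • y)).le_opNorm (-y)
      _ = ‖y‖ₑ ^ 2 * ∫⁻ x, ‖gradient φ (x - t • y)‖ₑ ^ 2 :=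
          lintegral_const_mul' _ _ (by finiteness)
      _ = (‖y‖ₑ * eLpNorm (gradient φ) 2 volume) ^ 2 := by
          rw [mul_pow, eLpNorm_two_sq, lintegral_sub_right_eq_self (fun x => ‖gradient φ x‖ₑ ^ 2)]
  refine (ENNReal.pow_le_pow_left_iff two_ne_zero).1 (h1.trans ?_)
  calc _ ≤ ∫⁻ _, (‖y‖ₑ * eLpNorm (gradient φ) 2 volume) ^ 2 ∂ν := lintegral_mono h2
    _ = _ := by simp

lemma H2.eLpNorm_translation_le (u : H2 N) (y : RN N) :
    eLpNorm (fun x => u.fn (x - y) - u.fn x) 2 volume ≤ ENNReal.ofReal (‖y‖ * ‖u.grad‖) := by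
  obtain ⟨φ, hφ, hlim, hae⟩ := exists_test_seq u
  have hae' : ∀ᵐ x, Tendsto (fun n => φ n (x - y)) atTop (𝓝 (u.fn (x - y))) :=
    (measurePreserving_sub_right volume y).quasiMeasurePreserving.ae hae
  have h1 := Lp.eLpNorm_lim_le_liminf_eLpNorm (p := 2) (μ := (volume : Measure (RN N)))
    (f := fun n x => φ n (x - y) - φ n x)
    (fun n => (((hφ n).continuous.comp (continuous_id.sub continuous_const)).sub
      (hφ n).continuous).aestronglyMeasurable) (fun x => u.fn (x - y) - u.fn x) (by
        filter_upwards [hae, hae'] with x h1 h2 using h2.sub h1)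
  have h2 : ∀ n, eLpNorm (fun x => φ n (x - y) - φ n x) 2 volume
      ≤ ENNReal.ofReal (‖y‖ * ‖(ofTest (hφ n)).grad‖) := by
    intro n
    refine (eLpNorm_translation_test_le (hφ n) y).trans (le_of_eq ?_)
    rw [ENNReal.ofReal_mul (norm_nonneg _), ofReal_norm, ofTest_grad, Lp.norm_toLp,
      ENNReal.ofReal_toReal (hφ n).gradient_memLp.2.ne]
  have h3 : Tendsto (fun n => ENNReal.ofReal (‖y‖ * ‖(ofTest (hφ n)).grad‖)) atTop
      (𝓝 (ENNReal.ofReal (‖y‖ * ‖u.grad‖))) :=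
    ENNReal.tendsto_ofReal ((((H2.gradL.continuous.tendsto u).comp hlim).norm).const_mul _)
  refine h1.trans ?_
  rw [← h3.liminf_eq]
  exact liminf_le_liminf (Eventually.of_forall h2)

lemma H2.eLpNorm_mollify_sub_le (b : ContDiffBump (0 : RN N)) (u : H2 N) :
    eLpNorm (fun x => mollify (b.normed volume) u.fn x - u.fn x) 2 volume
      ≤ ENNReal.ofReal (b.rOut * ‖u.grad‖) := by
  refine _root_.eLpNorm_mollify_sub_le b (Lp.stronglyMeasurable _) (Lp.memLp _) fun y hy => ?_
  refine (u.eLpNorm_translation_le y).trans (ENNReal.ofReal_le_ofReal ?_)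
  gcongr

lemma integral_rpow_two_le_of_eLpNorm_le {f : RN N → ℝ} (hf : AEStronglyMeasurable f volume)
    {δ : ℝ} (hδ : 0 ≤ δ) (h : eLpNorm f 2 volume ≤ ENNReal.ofReal δ) :
    Integrable (fun x => |f x| ^ (2 : ℝ)) volume ∧ ∫ x, |f x| ^ (2 : ℝ) ≤ δ ^ 2 := by
  have hm : MemLp f 2 volume := ⟨hf, h.trans_lt ENNReal.ofReal_lt_top⟩
  refine ⟨by simpa using hm.integrable_sq, ?_⟩
  rw [hm.eLpNorm_eq_integral_rpow_norm (by simp) (by simp), ENNReal.ofReal_le_ofReal_iff hδ,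
    ENNReal.toReal_ofNat, Real.rpow_inv_le_iff_of_pos (by positivity) hδ two_pos,
    Real.rpow_two] at h
  exact h

lemma abs_integral_mul_le {f : RN N → ℝ} (hf : AEStronglyMeasurable f volume)
    {δ : ℝ} (hδ : 0 ≤ δ) (h : eLpNorm f 2 volume ≤ ENNReal.ofReal δ) (u : L2Fun N) :
    |∫ x, u x * f x| ≤ δ * ‖u‖ := by
  have hm : MemLp f 2 volume := ⟨hf, h.trans_lt ENNReal.ofReal_lt_top⟩
  rw [integral_mul_eq_inner u hm]
  refine (abs_real_inner_le_norm _ _).trans ?_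
  gcongr
  rw [Lp.norm_toLp]
  exact ENNReal.toReal_le_of_le_ofReal hδ h

end Translation

/-! ### Decay of the local mass of radial functions -/

section Radial

variable {N : ℕ}

/-- A connected set with two points is infinite. It provides as many distinct directions as needed
in `exists_radial_decay`. -/
lemma infinite_sphere (hN : 5 ≤ N) : (Metric.sphere (0 : RN N) 1).Infinite := by
  have hr : 1 < Module.rank ℝ (RN N) := by
    rw [← Module.finrank_eq_rank, finrank_euclideanSpace_fin]
    exact_mod_cast (by omega : 1 < N)
  refine (isPreconnected_sphere hr 0 1).infinite_of_nontrivial ?_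
  let i : Fin N := ⟨0, by omega⟩
  let j : Fin N := ⟨1, by omega⟩
  refine ⟨EuclideanSpace.single i 1, by simp, EuclideanSpace.single j 1, by simp, fun h => ?_⟩
  have := congrArg (fun v : RN N => v i) h
  simp [i, j] at this

/-- The reflection in the hyperplane orthogonal to `x - y` preserves measure and norms and exchanges
the two balls. -/
lemma integral_ball_comp_norm {g : ℝ → ℝ} {x y : RN N} (hxy : ‖x‖ = ‖y‖) (ρ : ℝ) :
    ∫ z in Metric.ball y ρ, g ‖z‖ = ∫ z in Metric.ball x ρ, g ‖z‖ := by
  let A := (ℝ ∙ (x - y))ᗮ.reflection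
  have hA : A x = y := Submodule.reflection_sub hxy
  have h := A.measurePreserving.setIntegral_preimage_emb A.toHomeomorph.measurableEmbedding
    (fun z => g ‖z‖) (Metric.ball y ρ)
  have e : A ⁻¹' Metric.ball y ρ = Metric.ball x ρ := by
    ext z
    rw [Set.mem_preimage, Metric.mem_ball, Metric.mem_ball, ← hA, A.dist_map]
  rw [e] at h
  simpa using h.symm

/-- A radial function carries at most the fraction `1 / m` of its mass in a ball of fixed radius
centred far from the origin. -/
lemma exists_radial_decay (hN : 5 ≤ N) (ρ : ℝ) (m : ℕ) : ∃ R : ℝ, ∀ g : ℝ → ℝ, (∀ t, 0 ≤ g t) →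
    Integrable (fun x : RN N => g ‖x‖) volume → ∀ x : RN N, R ≤ ‖x‖ →
      m * ∫ y in Metric.ball x ρ, g ‖y‖ ≤ ∫ y : RN N, g ‖y‖ := by
  -- The balls of radius `ρ` centred at multiples `‖x‖ • e` of `m` distinct directions are disjoint
  -- once `‖x‖` is large, and all carry the same mass.
  obtain ⟨T, hT, hcard⟩ := (infinite_sphere hN).exists_subset_card_eq m
  have hev : ∀ᶠ R : ℝ in atTop, ∀ e ∈ T, ∀ e' ∈ T, e ≠ e' → 2 * ρ ≤ R * ‖e - e'‖ := by
    rw [eventually_all_finset]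
    intro e _
    rw [eventually_all_finset]
    intro e' _
    by_cases he : e = e'
    · exact Eventually.of_forall fun _ h => absurd he h
    · have hpos : 0 < ‖e - e'‖ := norm_pos_iff.2 (sub_ne_zero.2 he)
      filter_upwards [eventually_ge_atTop (2 * ρ / ‖e - e'‖)] with R hR _
      rwa [div_le_iff₀ hpos] at hR
  obtain ⟨R, hR⟩ := eventually_atTop.1 hev
  refine ⟨R, fun g hg hInt x hx => ?_⟩
  have hdisj : Set.PairwiseDisjoint (T : Set (RN N)) fun e => Metric.ball (‖x‖ • e) ρ := by
    intro e he e' he' hne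
    refine Metric.ball_disjoint_ball ?_
    rw [dist_eq_norm, ← smul_sub, norm_smul, norm_norm]
    linarith [hR ‖x‖ hx e he e' he' hne]
  have hball : ∀ e ∈ T, ∫ y in Metric.ball (‖x‖ • e) ρ, g ‖y‖ = ∫ y in Metric.ball x ρ, g ‖y‖ := by
    intro e he
    refine integral_ball_comp_norm ?_ ρ
    rw [norm_smul, norm_norm, mem_sphere_zero_iff_norm.1 (hT he), mul_one]
  calc (m : ℝ) * ∫ y in Metric.ball x ρ, g ‖y‖
      = ∑ e ∈ T, ∫ y in Metric.ball (‖x‖ • e) ρ, g ‖y‖ := by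
        rw [Finset.sum_congr rfl hball, Finset.sum_const, hcard, nsmul_eq_mul]
    _ = ∫ y in ⋃ e ∈ T, Metric.ball (‖x‖ • e) ρ, g ‖y‖ :=
        (integral_biUnion_finset T (fun e _ => Metric.isOpen_ball.measurableSet) hdisj
          fun e _ => hInt.integrableOn).symm
    _ ≤ _ := setIntegral_le_integral hInt (Eventually.of_forall fun y => hg _)

end Radial

end

noncomputable section

/-! ### Compactness of the embedding of radial functions into `L^p` -/

section Compactness

variable {N : ℕ}

lemma mollify_eq_integral_mul (η : RN N → ℝ) (f : RN N → ℝ) (x : RN N) :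
    mollify η f x = ∫ y, f y * η (x - y) := by
  rw [mollify_eq]
  exact integral_congr_ae (Eventually.of_forall fun y => mul_comm _ _)

/-- Cauchy–Schwarz; the kernel vanishes off the ball of radius `rOut`, so only the local mass of `u`
enters. -/
lemma abs_mollify_le_local (b : ContDiffBump (0 : RN N)) (u : H2 N) (x : RN N) :
    |mollify (b.normed volume) u.fn x| ≤ (∫ y, |b.normed volume y| ^ (2 : ℝ)) ^ (1 / 2 : ℝ)
      * (∫ y in Metric.ball x b.rOut, |u.fn y| ^ (2 : ℝ)) ^ (1 / 2 : ℝ) := by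
  set η := b.normed (volume : Measure (RN N)) with hη
  set s := Metric.ball x b.rOut
  have hs : MeasurableSet s := Metric.isOpen_ball.measurableSet
  have hψ : IsTest fun y => η (x - y) := (isTest_normed b).comp_const_sub x
  have h0 : ∀ y, y ∉ s → η (x - y) = 0 := by
    intro y hy
    by_contra hne
    have h1 : x - y ∈ Function.support η := hne
    rw [hη, b.support_normed_eq, mem_ball_zero_iff] at h1
    exact hy (by rwa [Metric.mem_ball, dist_comm, dist_eq_norm])
  have e : ∀ y, |s.indicator u.fn y| ^ (2 : ℝ) = s.indicator (fun y => |u.fn y| ^ (2 : ℝ)) y := by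
    intro y
    by_cases hy : y ∈ s <;> simp [hy]
  have hψ2 : Integrable (fun y => |η (x - y)| ^ (2 : ℝ)) volume := by
    simpa using (hψ.memLp 2).integrable_sq
  have h := hoelder_two (μ := volume) (f := fun y => η (x - y)) (g := s.indicator u.fn) (q := 2)
    (r := 2) (a := 1) (b := 1) two_pos two_pos zero_le_one zero_le_one (by norm_num) hψ2 (by
      simp only [e]
      exact u.integrable_rpow_two.indicator hs)
  simp only [e, Real.rpow_one] at h
  rw [integral_indicator hs, integral_sub_left_eq_self (fun y => |η y| ^ (2 : ℝ)) volume x] at h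
  refine le_trans ?_ h.2
  rw [mollify_eq_integral_mul]
  refine (abs_integral_le_integral_abs).trans (le_of_eq ?_)
  refine integral_congr_ae (Eventually.of_forall fun y => ?_)
  by_cases hy : y ∈ s
  · simp [hy, abs_mul, mul_comm]
  · simp [hy, h0 y hy]

lemma exists_radial_mollify_small (hN : 5 ≤ N) (b : ContDiffBump (0 : RN N)) (B : ℝ) {ε : ℝ}
    (hε : 0 < ε) : ∃ R : ℝ, ∀ u ∈ H2rad N, ‖u‖ ≤ B → ∀ x, R ≤ ‖x‖ →
      |mollify (b.normed volume) u.fn x| ≤ ε := by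
  set A := ∫ y, |b.normed (volume : Measure (RN N)) y| ^ (2 : ℝ) with hA
  have hA0 : 0 ≤ A := integral_nonneg fun y => by positivity
  -- The square of the mollification is at most `A` times the local mass, and far out the local mass
  -- is at most `B²/m`. This `m` makes the product at most `ε²`.
  obtain ⟨m, hm⟩ := exists_nat_gt (A * B ^ 2 / ε ^ 2)
  have hm0 : (0 : ℝ) < m := lt_of_le_of_lt (by positivity) hm
  obtain ⟨R, hR⟩ := exists_radial_decay hN b.rOut m
  refine ⟨R, fun u hu huB x hx => (abs_mollify_le_local b u x).trans ?_⟩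
  obtain ⟨f, _, hf⟩ := hu
  have hae : (fun y => |u.fn y| ^ (2 : ℝ)) =ᵐ[volume] fun y => |f ‖y‖| ^ (2 : ℝ) := by
    filter_upwards [hf] with y hy
    rw [hy]
  have h1 := hR (fun t => |f t| ^ (2 : ℝ)) (fun t => by positivity)
    (u.integrable_rpow_two.congr hae) x hx
  rw [← integral_congr_ae hae, ← setIntegral_congr_ae (g := fun y => |f ‖y‖| ^ (2 : ℝ))
    Metric.isOpen_ball.measurableSet (hae.mono fun y hy _ => hy), u.integral_rpow_two] at h1
  set I := ∫ y in Metric.ball x b.rOut, |u.fn y| ^ (2 : ℝ) with hI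
  have hI0 : 0 ≤ I := integral_nonneg fun y => by positivity
  rw [← Real.mul_rpow hA0 hI0, ← Real.sqrt_eq_rpow]
  refine Real.sqrt_le_iff.2 ⟨hε.le, ?_⟩
  have h2 : (m : ℝ) * I ≤ B ^ 2 := h1.trans (by gcongr; exact u.norm_fn_le.trans huB)
  rw [div_lt_iff₀ (by positivity)] at hm
  have h3 : m * (A * I) ≤ m * ε ^ 2 := by nlinarith
  exact le_of_mul_le_mul_left h3 hm0

/-- At the fixed point `x₀` the mollification is an `L²` pairing and tends to zero by weak
convergence. Replacing `x₀` by `x n` costs the `L²` norm of a small translate difference of the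
kernel, uniformly in the bounded sequence. -/
lemma tendsto_mollify_of_tendsto (F : Ultrafilter ℕ) {u : ℕ → H2 N} {B : ℝ} (hB : ∀ n, ‖u n‖ ≤ B)
    (hw : ∀ f : L2Fun N, Tendsto (fun n => inner ℝ (u n).fn f) F (𝓝 0))
    {η : RN N → ℝ} (hη : IsTest η) {x : ℕ → RN N} {x₀ : RN N} (hx : Tendsto x F (𝓝 x₀)) :
    Tendsto (fun n => mollify η (u n).fn (x n)) F (𝓝 0) := by
  have hψ := hη.comp_const_sub x₀
  have hB0 : 0 ≤ B := (norm_nonneg _).trans (hB 0)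
  have h1 : Tendsto (fun n => mollify η (u n).fn x₀) F (𝓝 0) := by
    refine (hw ((hψ.memLp 2).toLp _)).congr fun n => ?_
    rw [mollify_eq_integral_mul, integral_mul_eq_inner _ (hψ.memLp 2), real_inner_comm]
  have h2 : Tendsto (fun n => mollify η (u n).fn (x n) - mollify η (u n).fn x₀) F (𝓝 0) := by
    rw [Metric.tendsto_nhds]
    intro ε hε
    obtain ⟨δ, hδ, h⟩ := exists_translation_small ((hψ.memLp 2).toLp _)
      (δ := ε / (B + 1) / 2) (by positivity)
    filter_upwards [Metric.tendsto_nhds.1 hx δ hδ] with n hn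
    have h3 := h (x n - x₀) (by rwa [← dist_eq_norm])
    have hae := (hψ.memLp 2).coeFn_toLp
    have hae' := (measurePreserving_sub_right (volume : Measure (RN N))
      (x n - x₀)).quasiMeasurePreserving.ae hae
    have e : eLpNorm (fun y => η (x n - y) - η (x₀ - y)) 2 volume
        ≤ ENNReal.ofReal (ε / (B + 1) / 2) := by
      refine le_trans (le_of_eq (eLpNorm_congr_ae ?_)) h3
      filter_upwards [hae, hae'] with y h4 h5
      rw [h4, h5]
      congr 2
      abel
    have hψn := hη.comp_const_sub (x n)
    have h6 := abs_integral_mul_le (hψn.continuous.sub hψ.continuous).aestronglyMeasurable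
      (by positivity) e (u n).fn
    rw [dist_zero_right, Real.norm_eq_abs, mollify_eq_integral_mul, mollify_eq_integral_mul,
      ← integral_sub (l2_mul_integrable _ (hψn.memLp 2)) (l2_mul_integrable _ (hψ.memLp 2))]
    simp only [← mul_sub]
    refine h6.trans_lt ?_
    calc ε / (B + 1) / 2 * ‖(u n).fn‖ ≤ ε / (B + 1) / 2 * (B + 1) := by
          gcongr
          linarith [(u n).norm_fn_le.trans (hB n)]
      _ = ε / 2 := by field_simp
      _ < ε := by linarith
  simpa using h2.add h1

/-- If uniform smallness failed, there would be bad points `x n`. Radial decay confines them to a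
fixed ball, so they converge along the ultrafilter, contradicting `tendsto_mollify_of_tendsto`. -/
lemma eventually_mollify_small (hN : 5 ≤ N) (b : ContDiffBump (0 : RN N)) (F : Ultrafilter ℕ)
    {u : ℕ → H2 N} (hrad : ∀ n, u n ∈ H2rad N) {B : ℝ} (hB : ∀ n, ‖u n‖ ≤ B)
    (hw : ∀ f : L2Fun N, Tendsto (fun n => inner ℝ (u n).fn f) F (𝓝 0)) {ε : ℝ} (hε : 0 < ε) :
    ∀ᶠ n in F, ∀ x, |mollify (b.normed volume) (u n).fn x| ≤ ε := by
  by_contra hcon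
  have h1 : ∀ᶠ n in F, ∃ x, ε < |mollify (b.normed volume) (u n).fn x| := by
    have := Ultrafilter.eventually_not.2 hcon
    filter_upwards [this] with n hn
    push Not at hn
    exact hn
  obtain ⟨R, hR⟩ := exists_radial_mollify_small hN b B hε
  -- A bad point when there is one, and the default `0` otherwise, so that the choice is defined for
  -- every `n`.
  have h2 : ∀ n, ∃ x, (∃ x, ε < |mollify (b.normed volume) (u n).fn x|) →
      ε < |mollify (b.normed volume) (u n).fn x| := by
    intro n
    by_cases h : ∃ x, ε < |mollify (b.normed volume) (u n).fn x|
    · exact ⟨h.choose, fun _ => h.choose_spec⟩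
    · exact ⟨0, fun h' => absurd h' h⟩
  choose x hx using h2
  have h3 : ∀ᶠ n in F, x n ∈ Metric.closedBall (0 : RN N) R := by
    filter_upwards [h1] with n hn
    rw [mem_closedBall_zero_iff]
    by_contra hlt
    exact (hx n hn).not_ge (hR (u n) (hrad n) (hB n) (x n) (not_le.1 hlt).le)
  obtain ⟨x₀, _, hx₀⟩ := (isCompact_closedBall (0 : RN N) R).ultrafilter_le_nhds (F.map x)
    (le_principal_iff.2 h3)
  have h4 := tendsto_mollify_of_tendsto F hB hw (isTest_normed b) (x := x) (x₀ := x₀) hx₀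
  have h5 := Metric.tendsto_nhds.1 h4 ε hε
  obtain ⟨n, hn1, hn2⟩ := (h1.and h5).exists
  rw [dist_zero_right, Real.norm_eq_abs] at hn2
  exact (hx n hn1).not_gt hn2

/-- Either `|v| ≤ 2s`, and `p - 2` powers are absorbed by `2s`; or `|v| > 2s ≥ 2|w|`, and then `|v|
≤ 2|w - v|`. In the application `w` is a uniformly small mollification of `v`. -/
lemma rpow_le_split {p a b s v w : ℝ} (hp : 2 < p) (ha : 0 ≤ a) (hb : 0 ≤ b) (hab : a + b = p)
    (hw : |w| ≤ s) :
    |v| ^ p ≤ (2 * s) ^ (p - 2) * |v| ^ (2 : ℝ) + 2 ^ a * (|w - v| ^ a * |v| ^ b) := by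
  have hs : 0 ≤ s := (abs_nonneg w).trans hw
  rcases le_total |v| (2 * s) with h | h
  · have h1 : |v| ^ p ≤ (2 * s) ^ (p - 2) * |v| ^ (2 : ℝ) := by
      calc |v| ^ p = |v| ^ (p - 2) * |v| ^ (2 : ℝ) := by
            rw [← Real.rpow_add_of_nonneg (abs_nonneg _) (by linarith) (by norm_num), sub_add_cancel]
        _ ≤ _ := by gcongr
    have : 0 ≤ 2 ^ a * (|w - v| ^ a * |v| ^ b) := by positivity
    linarith
  · have h2 : |v| ≤ 2 * |w - v| := by
      have := abs_sub_abs_le_abs_sub v w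
      rw [abs_sub_comm] at this
      linarith
    have h1 : |v| ^ p ≤ 2 ^ a * (|w - v| ^ a * |v| ^ b) := by
      rw [← mul_assoc, ← Real.mul_rpow (by norm_num) (abs_nonneg _), ← hab,
        Real.rpow_add_of_nonneg (abs_nonneg _) ha hb]
      gcongr
    have : 0 ≤ (2 * s) ^ (p - 2) * |v| ^ (2 : ℝ) := by positivity
    linarith

lemma H2.powInt_le_split (hN : 5 ≤ N) {p t : ℝ} (hp : 2 < p) (h0 : 0 ≤ t) (h1 : t ≤ 1)
    (ht : p = 2 * (1 - t) + fourStar N * t) (u : H2 N) {w : RN N → ℝ}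
    (hwm : AEStronglyMeasurable w volume) {s δ : ℝ} (hδ : 0 ≤ δ) (hs : ∀ x, |w x| ≤ s)
    (hw : eLpNorm (fun x => w x - u.fn x) 2 volume ≤ ENNReal.ofReal δ) :
    u.powInt p ≤ (2 * s) ^ (p - 2) * ‖u.fn‖ ^ 2
      + 2 ^ (2 * (1 - t)) * ((δ ^ 2) ^ (1 - t) * u.powInt (fourStar N) ^ t) := by
  have hq := fourStar_pos hN
  obtain ⟨i1, i2⟩ := integral_rpow_two_le_of_eLpNorm_le
    (hwm.sub (Lp.aestronglyMeasurable u.fn)) hδ hw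
  have h := hoelder_two (μ := volume) (f := fun x => w x - u.fn x) (g := u.fn)
    (a := 2 * (1 - t)) (b := fourStar N * t) two_pos hq (by linarith) (by positivity)
    (by field_simp; ring) i1 (u.integrable_rpow_fourStar hN)
  have e1 : 2 * (1 - t) / 2 = 1 - t := by ring
  have e2 : fourStar N * t / fourStar N = t := by field_simp
  rw [e1, e2] at h
  have hp4 : p ≤ fourStar N := by
    rw [ht]
    nlinarith [two_lt_fourStar hN]
  have hI : Integrable (fun x => (2 * s) ^ (p - 2) * |u.fn x| ^ (2 : ℝ)
      + 2 ^ (2 * (1 - t)) * (|w x - u.fn x| ^ (2 * (1 - t)) * |u.fn x| ^ (fourStar N * t))) volume :=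
    (u.integrable_rpow_two.const_mul _).add (h.1.const_mul _)
  have h2 : u.powInt p ≤ _ := integral_mono (u.integrable_rpow hN hp.le hp4) hI fun x =>
    rpow_le_split hp (by linarith) (by positivity) ht.symm (hs x)
  rw [integral_add (u.integrable_rpow_two.const_mul _) (h.1.const_mul _), integral_const_mul,
    integral_const_mul, u.integral_rpow_two] at h2
  refine h2.trans ?_
  gcongr
  refine h.2.trans ?_
  have := u.powInt_nonneg (fourStar N)
  have hn : 0 ≤ ∫ x, |w x - u.fn x| ^ (2 : ℝ) := integral_nonneg fun x => by positivity
  exact mul_le_mul_of_nonneg_right (Real.rpow_le_rpow hn i2 (by linarith)) (Real.rpow_nonneg this t)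

/-- **Compactness**: a bounded sequence of radial functions converging weakly to zero
converges to zero in `L^p` for `2 < p < 4^*`. -/
theorem tendsto_powInt_of_weak (hN : 5 ≤ N) {p : ℝ} (hp : 2 < p) (hp4 : p < fourStar N)
    (F : Ultrafilter ℕ) {u : ℕ → H2 N} (hrad : ∀ n, u n ∈ H2rad N) {B : ℝ} (hB : ∀ n, ‖u n‖ ≤ B)
    (hw : ∀ f : L2Fun N, Tendsto (fun n => inner ℝ (u n).fn f) F (𝓝 0)) :
    Tendsto (fun n => (u n).powInt p) F (𝓝 0) := by
  obtain ⟨t, h0, h1, ht⟩ := H2.exists_weight hN hp.le hp4.le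
  have ht1 : t < 1 := by
    refine h1.lt_of_ne fun h => ?_
    rw [h] at ht
    linarith
  have hB0 : 0 ≤ B := (norm_nonneg _).trans (hB 0)
  obtain ⟨C, hC0, hC⟩ := H2.exists_powInt_fourStar_le hN
  set M := (C * B) ^ fourStar N with hM
  have hM0 : 0 ≤ M := by positivity
  have hq := fourStar_pos hN
  have hpM : ∀ n, (u n).powInt (fourStar N) ≤ M := fun n =>
    (hC (u n)).trans (by
      refine Real.rpow_le_rpow (by positivity) ?_ hq.le
      gcongr
      exact (u n).norm_lap_le.trans (hB n))
  rw [Metric.tendsto_nhds]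
  intro ε hε
  have l1 : Tendsto (fun s : ℝ => (2 * s) ^ (p - 2) * B ^ 2) (𝓝[>] 0) (𝓝 0) := by
    have hc : ContinuousAt (fun s : ℝ => (2 * s) ^ (p - 2) * B ^ 2) 0 :=
      ((continuousAt_const.mul continuousAt_id).rpow_const (Or.inr (by linarith))).mul
        continuousAt_const
    have := hc.tendsto
    simp only [mul_zero, Real.zero_rpow (by linarith : p - 2 ≠ 0), zero_mul] at this
    exact this.mono_left nhdsWithin_le_nhds
  have l2 : Tendsto (fun δ : ℝ => (2 : ℝ) ^ (2 * (1 - t)) * (((δ * B) ^ 2) ^ (1 - t) * M ^ t))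
      (𝓝[>] 0) (𝓝 0) := by
    have hc : ContinuousAt
        (fun δ : ℝ => (2 : ℝ) ^ (2 * (1 - t)) * (((δ * B) ^ 2) ^ (1 - t) * M ^ t)) 0 :=
      continuousAt_const.mul ((((continuousAt_id.mul continuousAt_const).pow 2).rpow_const
        (Or.inr (by linarith))).mul continuousAt_const)
    have := hc.tendsto
    simp only [zero_mul, ne_eq, OfNat.ofNat_ne_zero, not_false_eq_true, zero_pow,
      Real.zero_rpow (by linarith : 1 - t ≠ 0), mul_zero] at this
    exact this.mono_left nhdsWithin_le_nhds
  -- `s` bounds the mollified function and `δ` is the mollification radius. Each is chosen to make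
  -- its share of the bound less than `ε/2`, uniformly in `n`; only then does weak convergence make
  -- the mollification at scale `δ` smaller than `s`.
  obtain ⟨s, hs1, hs0⟩ := (((tendsto_order.1 l1).2 (ε / 2) (by positivity)).and
    self_mem_nhdsWithin).exists
  obtain ⟨δ, hδ1, hδ0⟩ := (((tendsto_order.1 l2).2 (ε / 2) (by positivity)).and
    self_mem_nhdsWithin).exists
  have hs0 : 0 < s := hs0
  have hδ0 : 0 < δ := hδ0
  let b : ContDiffBump (0 : RN N) := ⟨δ / 2, δ, by positivity, by linarith⟩
  filter_upwards [eventually_mollify_small hN b F hrad hB hw hs0] with n hn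
  have hwd : eLpNorm (fun x => mollify (b.normed volume) (u n).fn x - (u n).fn x) 2 volume
      ≤ ENNReal.ofReal (δ * B) :=
    ((u n).eLpNorm_mollify_sub_le b).trans (ENNReal.ofReal_le_ofReal (by
      change δ * _ ≤ _
      gcongr
      exact (u n).norm_grad_le.trans (hB n)))
  have h2 := (u n).powInt_le_split hN hp h0 h1 ht
    (contDiff_mollify (isTest_normed b) (Lp.memLp _)).continuous.aestronglyMeasurable
    (by positivity) hn hwd
  rw [dist_zero_right, Real.norm_of_nonneg ((u n).powInt_nonneg p)]
  refine h2.trans_lt ?_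
  have h3 : (2 * s) ^ (p - 2) * ‖(u n).fn‖ ^ 2 ≤ (2 * s) ^ (p - 2) * B ^ 2 := by
    gcongr
    exact (u n).norm_fn_le.trans (hB n)
  have h4 : (2 : ℝ) ^ (2 * (1 - t)) * (((δ * B) ^ 2) ^ (1 - t) * (u n).powInt (fourStar N) ^ t)
      ≤ 2 ^ (2 * (1 - t)) * (((δ * B) ^ 2) ^ (1 - t) * M ^ t) := by
    have := (u n).powInt_nonneg (fourStar N)
    gcongr
    exact hpM n
  linarith

end Compactness

end

noncomputable section

/-! ### The threshold constants -/

section Thresholds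

variable {N : ℕ} {p μ c : ℝ}

/-- With `E = (q-s)/(2-s) a^{(q-2)/(q-s)} D^{(s-2)/(q-s)}`, `k^{…} = 1/(2E)` and `r^{q-s} = aDk`,
the two terms `r^{q-2}/D` and `a k r^{s-2}` are explicit. -/
lemma threshold_identities {s q a D k r E : ℝ} (hs : s < 2) (hq : 2 < q) (ha : 0 < a) (hD : 0 < D)
    (hE : E = (q - s) / (2 - s) * a ^ ((q - 2) / (q - s)) * D ^ ((s - 2) / (q - s)))
    (hk : k = (1 / (2 * E)) ^ ((q - s) / (q - 2))) (hr : r = (a * D * k) ^ (1 / (q - s))) :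
    0 < k ∧ 0 < r ∧ r ^ (q - 2) = (2 - s) / (2 * (q - s)) * D ∧
      a * k * r ^ (s - 2) = (2 - s) / (2 * (q - s)) := by
  have h1 : 0 < q - s := by linarith
  have h2 : 0 < 2 - s := by linarith
  have h3 : 0 < q - 2 := by linarith
  have hE0 : 0 < E := by rw [hE]; positivity
  have hk0 : 0 < k := by rw [hk]; positivity
  have hr0 : 0 < r := by rw [hr]; positivity
  have e1 : r ^ (q - s) = a * D * k := by
    rw [hr, ← Real.rpow_mul (by positivity), one_div_mul_cancel h1.ne', Real.rpow_one]
  have e2 : k ^ ((q - 2) / (q - s)) = 1 / (2 * E) := by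
    rw [hk, ← Real.rpow_mul (by positivity)]
    have : (q - s) / (q - 2) * ((q - 2) / (q - s)) = 1 := by field_simp
    rw [this, Real.rpow_one]
  have e3 : r ^ (q - 2) = (2 - s) / (2 * (q - s)) * D := by
    have : r ^ (q - 2) = (r ^ (q - s)) ^ ((q - 2) / (q - s)) := by
      rw [← Real.rpow_mul hr0.le]
      congr 1
      field_simp
    rw [this, e1, Real.mul_rpow (by positivity) hk0.le, Real.mul_rpow ha.le hD.le, e2, hE]
    have e4 : D ^ ((q - 2) / (q - s)) = D * D ^ ((s - 2) / (q - s)) := by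
      nth_rewrite 2 [← Real.rpow_one D]
      rw [← Real.rpow_add hD]
      congr 1
      field_simp
      ring
    rw [e4]
    have := (Real.rpow_pos_of_pos hD ((s - 2) / (q - s))).ne'
    have := (Real.rpow_pos_of_pos ha ((q - 2) / (q - s))).ne'
    field_simp
  refine ⟨hk0, hr0, e3, ?_⟩
  have e5 : r ^ (q - s) * r ^ (s - 2) = r ^ (q - 2) := by
    rw [← Real.rpow_add hr0]
    congr 1
    ring
  rw [e1, e3] at e5
  refine mul_right_cancel₀ hD.ne' ?_
  linarith

lemma one_sub_gam_pos (hN : 5 ≤ N) (hp : 2 < p) (hp' : p < 2 + 4 / (N : ℝ)) :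
    0 < p * (1 - gam N p) := by
  have := mul_gam_lt_one hN hp hp'
  rw [mul_sub]
  linarith

/-- The constants `K₁ = (μ/p) C_{N,p}^p c^{p(1-γ_p)/2}` and `K₂ = 1 / (4^* S^{4^*/2})` at `r_*`. -/
lemma rStar_spec (hN : 5 ≤ N) (hp : 2 < p) (hp' : p < 2 + 4 / (N : ℝ)) (hμ : 0 < μ) :
    0 < cStar N p μ ∧ 0 < rStar N p μ ∧
      1 / (fourStar N * sobolevS N ^ (fourStar N / 2)) * rStar N p μ ^ (fourStar N - 2)
        = (2 - p * gam N p) / (2 * (fourStar N - p * gam N p)) ∧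
      μ / p * gnConst N p ^ p * cStar N p μ ^ (p * (1 - gam N p) / 2)
        * rStar N p μ ^ (p * gam N p - 2)
        = (fourStar N - 2) / (2 * (fourStar N - p * gam N p)) := by
  have hC := gnConst_pos hN hp hp'
  have hS := sobolevS_pos hN
  have hq := two_lt_fourStar hN
  have hs := mul_gam_lt_one hN hp hp'
  have hg := one_sub_gam_pos hN hp hp'
  have h1 : 0 < fourStar N - p * gam N p := by linarith
  have h2 : 0 < 2 - p * gam N p := by linarith
  have h3 : 0 < fourStar N - 2 := by linarith
  have hp0 : 0 < p := by linarith
  have hD : 0 < fourStar N * sobolevS N ^ (fourStar N / 2) := by positivity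
  have ha : 0 < (2 - p * gam N p) * μ * gnConst N p ^ p / ((fourStar N - 2) * p) := by positivity
  have hE : 0 < constE N p μ := by
    unfold constE
    positivity
  have hc : 0 < cStar N p μ := by
    unfold cStar
    positivity
  obtain ⟨_, h4, h5, h6⟩ := threshold_identities (s := p * gam N p) (q := fourStar N)
    (E := constE N p μ) (k := cStar N p μ ^ (p * (1 - gam N p) / 2)) (r := rStar N p μ)
    (by linarith) hq ha hD rfl (by
      unfold cStar
      rw [← Real.rpow_mul (by positivity)]
      congr 1
      have hg' : 1 - gam N p ≠ 0 := fun h => by simp [h] at hg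
      field_simp) (by
      unfold rStar rOf
      congr 1
      ring)
  refine ⟨hc, h4, ?_, ?_⟩
  · rw [h5]
    field_simp
  · calc _ = (fourStar N - 2) / (2 - p * gam N p)
          * ((2 - p * gam N p) * μ * gnConst N p ^ p / ((fourStar N - 2) * p)
            * cStar N p μ ^ (p * (1 - gam N p) / 2) * rStar N p μ ^ (p * gam N p - 2)) := by
          field_simp
      _ = _ := by
          rw [h6]
          field_simp

/-- Two consequences of the explicit value of `r_*^{4^*-2}`. The first, which rests on `pγ_p > 0`
and `4^* > 2`, makes the critical term a strict contraction in the Palais–Smale argument. The second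
lets the quadratic part dominate the critical term throughout the ball. -/
lemma rStar_rpow_lt (hN : 5 ≤ N) (hp : 2 < p) (hp' : p < 2 + 4 / (N : ℝ)) (hμ : 0 < μ) :
    rStar N p μ ^ (fourStar N - 2) < sobolevS N ^ (fourStar N / 2) ∧
      1 / (fourStar N * sobolevS N ^ (fourStar N / 2)) * rStar N p μ ^ (fourStar N - 2)
        ≤ 1 / 2 := by
  obtain ⟨_, _, h, _⟩ := rStar_spec hN hp hp' hμ
  have hS := Real.rpow_pos_of_pos (sobolevS_pos hN) (fourStar N / 2)
  have hq := two_lt_fourStar hN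
  have hs := mul_gam_lt_one hN hp hp'
  have hs0 := mul_gam_pos hN hp
  have h1 : 0 < fourStar N - p * gam N p := by linarith
  have hq0 := fourStar_pos hN
  constructor
  · have h2 : rStar N p μ ^ (fourStar N - 2) = fourStar N * sobolevS N ^ (fourStar N / 2)
        * ((2 - p * gam N p) / (2 * (fourStar N - p * gam N p))) := by
      rw [← h]
      field_simp
    have h3 : fourStar N * ((2 - p * gam N p) / (2 * (fourStar N - p * gam N p))) < 1 := by
      rw [← mul_div_assoc, div_lt_one (by positivity)]
      nlinarith
    rw [h2]
    nlinarith
  · rw [h, div_le_div_iff₀ (by positivity) two_pos]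
    linarith

/-- Below the mass threshold the lower bound for the energy is nonnegative in a shell below `r_*`. -/
lemma exists_shell (hN : 5 ≤ N) (hp : 2 < p) (hp' : p < 2 + 4 / (N : ℝ)) (hμ : 0 < μ)
    (hc : 0 < c) (hcs : c < cStar N p μ) : ∃ r₀, 0 ≤ r₀ ∧ r₀ < rStar N p μ ∧
      ∀ ρ, r₀ < ρ → ρ ≤ rStar N p μ →
        0 ≤ 1 / 2 * ρ ^ 2 - μ / p * gnConst N p ^ p * c ^ (p * (1 - gam N p) / 2)
          * ρ ^ (p * gam N p)
          - 1 / (fourStar N * sobolevS N ^ (fourStar N / 2)) * ρ ^ fourStar N := by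
  obtain ⟨_, hr, h1, h2⟩ := rStar_spec hN hp hp' hμ
  have hC := gnConst_pos hN hp hp'
  have hs := mul_gam_lt_one hN hp hp'
  have hq := two_lt_fourStar hN
  have hg := one_sub_gam_pos hN hp hp'
  have hp0 : 0 < p := by linarith
  set K₁ := μ / p * gnConst N p ^ p * c ^ (p * (1 - gam N p) / 2) with hK₁
  set K₂ := 1 / (fourStar N * sobolevS N ^ (fourStar N / 2)) with hK₂
  set r := rStar N p μ
  have h3 : K₁ * r ^ (p * gam N p - 2) < (fourStar N - 2) / (2 * (fourStar N - p * gam N p)) := by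
    rw [← h2, hK₁]
    gcongr
  -- At `c = c_*` the two subtracted terms add up to exactly `1/2`. A smaller mass leaves a positive
  -- remainder at `r_*`, and continuity spreads this to a shell.
  have hpos : 0 < 1 / 2 - K₁ * r ^ (p * gam N p - 2) - K₂ * r ^ (fourStar N - 2) := by
    rw [h1]
    have : (fourStar N - 2) / (2 * (fourStar N - p * gam N p))
        + (2 - p * gam N p) / (2 * (fourStar N - p * gam N p)) = 1 / 2 := by
      have : fourStar N - p * gam N p ≠ 0 := by linarith
      field_simp
      ring
    linarith
  have hcont : ContinuousAt
      (fun ρ : ℝ => 1 / 2 - K₁ * ρ ^ (p * gam N p - 2) - K₂ * ρ ^ (fourStar N - 2)) r :=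
    (continuousAt_const.sub (continuousAt_const.mul
      (Real.continuousAt_rpow_const _ _ (Or.inl hr.ne')))).sub
        (continuousAt_const.mul (Real.continuousAt_rpow_const _ _ (Or.inl hr.ne')))
  obtain ⟨ε, hε, h4⟩ := Metric.eventually_nhds_iff.1 (hcont.eventually_const_lt hpos)
  refine ⟨max (r - ε / 2) (r / 2), le_max_of_le_right (by positivity), ?_, fun ρ hρ hρr => ?_⟩
  · exact max_lt (by linarith) (by linarith)
  · have hρ0 : 0 < ρ := lt_of_le_of_lt (by positivity) ((le_max_right _ _).trans_lt hρ)
    have h5 := h4 (y := ρ) (by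
      rw [Real.dist_eq, abs_sub_lt_iff]
      have := (le_max_left (r - ε / 2) (r / 2)).trans_lt hρ
      constructor <;> linarith)
    have e1 : ρ ^ (p * gam N p) = ρ ^ 2 * ρ ^ (p * gam N p - 2) := by
      rw [← Real.rpow_two, ← Real.rpow_add hρ0, add_sub_cancel]
    have e2 : ρ ^ fourStar N = ρ ^ 2 * ρ ^ (fourStar N - 2) := by
      rw [← Real.rpow_two, ← Real.rpow_add hρ0, add_sub_cancel]
    rw [e1, e2]
    have h6 := mul_nonneg (sq_nonneg ρ) h5.le
    linarith

/-- Lower bound of the critical term by the Sobolev inequality. -/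
lemma powInt_fourStar_le (hN : 5 ≤ N) (u : H2 N) {ρ : ℝ} (hρ : ‖u.lap‖ ≤ ρ) :
    1 / fourStar N * u.powInt (fourStar N)
      ≤ 1 / (fourStar N * sobolevS N ^ (fourStar N / 2)) * ρ ^ fourStar N := by
  have hS := Real.rpow_pos_of_pos (sobolevS_pos hN) (fourStar N / 2)
  have hq := fourStar_pos hN
  have h := (sobolevS_mul_powInt_le hN u).trans (Real.rpow_le_rpow (norm_nonneg _) hρ hq.le)
  rw [one_div_mul_eq_div, one_div_mul_eq_div, div_le_div_iff₀ hq (by positivity)]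
  nlinarith

/-- Gagliardo–Nirenberg for the subcritical term and Sobolev for the critical one, both with `‖Δu‖ ≤
ρ`. -/
lemma energy_ge (hN : 5 ≤ N) (hp : 2 < p) (hp' : p < 2 + 4 / (N : ℝ)) (hμ : 0 < μ) (u : H2 N)
    {ρ : ℝ} (hρ0 : 0 ≤ ρ) (hρ : ‖u.lap‖ ^ 2 + ‖u.grad‖ ^ 2 = ρ ^ 2) :
    1 / 2 * ρ ^ 2 - μ / p * gnConst N p ^ p * (‖u.fn‖ ^ 2) ^ (p * (1 - gam N p) / 2)
        * ρ ^ (p * gam N p)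
        - 1 / (fourStar N * sobolevS N ^ (fourStar N / 2)) * ρ ^ fourStar N
      ≤ energy N p μ u := by
  have hlap : ‖u.lap‖ ≤ ρ := by
    refine abs_le_of_sq_le_sq' ?_ hρ0 |>.2
    nlinarith [sq_nonneg ‖u.grad‖]
  have h1 := powInt_fourStar_le hN u hlap
  have h2 := powInt_le_gnConst hN hp hp' u
  have hC := gnConst_pos hN hp hp'
  have hs0 := mul_gam_pos hN hp
  have hp0 : 0 < p := by linarith
  have e : (‖u.fn‖ ^ 2) ^ (p * (1 - gam N p) / 2) = ‖u.fn‖ ^ (p * (1 - gam N p)) := by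
    rw [← Real.rpow_two, ← Real.rpow_mul (norm_nonneg _)]
    congr 1
    ring
  have h3 : μ / p * u.powInt p
      ≤ μ / p * gnConst N p ^ p * (‖u.fn‖ ^ 2) ^ (p * (1 - gam N p) / 2) * ρ ^ (p * gam N p) := by
    rw [e]
    calc μ / p * u.powInt p ≤ μ / p * (gnConst N p ^ p * ‖u.lap‖ ^ (p * gam N p)
          * ‖u.fn‖ ^ (p * (1 - gam N p))) := by gcongr
      _ ≤ μ / p * (gnConst N p ^ p * ρ ^ (p * gam N p) * ‖u.fn‖ ^ (p * (1 - gam N p))) := by gcongr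
      _ = _ := by ring
  unfold energy
  linarith

/-- In the ball of radius `r_*` the quadratic part dominates the critical term. -/
lemma energy_ge_neg_powInt (hN : 5 ≤ N) (hp : 2 < p) (hp' : p < 2 + 4 / (N : ℝ)) (hμ : 0 < μ)
    (u : H2 N) (hu : ‖u.lap‖ ^ 2 + ‖u.grad‖ ^ 2 ≤ rStar N p μ ^ 2) :
    -(μ / p * u.powInt p) ≤ energy N p μ u := by
  have hr := (rStar_spec hN hp hp' hμ).2.1
  have hK := (rStar_rpow_lt hN hp hp' hμ).2
  have hq := two_lt_fourStar hN
  have hlap : ‖u.lap‖ ≤ rStar N p μ := by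
    refine abs_le_of_sq_le_sq' ?_ hr.le |>.2
    nlinarith [sq_nonneg ‖u.grad‖]
  have h1 := powInt_fourStar_le hN u le_rfl
  have hK2 : 0 ≤ 1 / (fourStar N * sobolevS N ^ (fourStar N / 2)) := by
    have := sobolevS_pos hN
    have := fourStar_pos hN
    positivity
  have e : ‖u.lap‖ ^ fourStar N = ‖u.lap‖ ^ (fourStar N - 2) * ‖u.lap‖ ^ 2 := by
    rw [← Real.rpow_two, ← Real.rpow_add_of_nonneg (norm_nonneg _) (by linarith) (by norm_num),
      sub_add_cancel]
  have h2 : ‖u.lap‖ ^ (fourStar N - 2) ≤ rStar N p μ ^ (fourStar N - 2) :=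
    Real.rpow_le_rpow (norm_nonneg _) hlap (by linarith)
  have h3 : 1 / (fourStar N * sobolevS N ^ (fourStar N / 2)) * ‖u.lap‖ ^ fourStar N
      ≤ 1 / 2 * ‖u.lap‖ ^ 2 := by
    rw [e, ← mul_assoc]
    refine mul_le_mul_of_nonneg_right ?_ (sq_nonneg _)
    exact (mul_le_mul_of_nonneg_left h2 hK2).trans hK
  unfold energy
  nlinarith [sq_nonneg ‖u.grad‖]

end Thresholds

end

noncomputable section

/-! ### The derivative of the energy -/

section EnergyDerivative

variable {N : ℕ} {p : ℝ}

lemma norm_sub_smul_sub_sub_le {X : Type*} [NormedAddCommGroup X] [NormedSpace ℝ X] (μ : ℝ)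
    (a b k a' b' k' : X) : ‖a - μ • b - k - (a' - μ • b' - k')‖
      ≤ ‖a - a'‖ + |μ| * ‖b - b'‖ + ‖k - k'‖ := by
  have e : a - μ • b - k - (a' - μ • b' - k') = (a - a') - μ • (b - b') - (k - k') := by
    rw [smul_sub]
    abel
  rw [e]
  refine (norm_sub_le _ _).trans ?_
  gcongr
  refine (norm_sub_le _ _).trans ?_
  rw [norm_smul, Real.norm_eq_abs]

theorem exists_energyDeriv (hN : 5 ≤ N) (hp : 2 < p) (hp' : p < 2 + 4 / (N : ℝ)) (μ : ℝ) :
    ∃ dE : H2 N → (H2 N →L[ℝ] ℝ),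
      (∀ u v, dE u v = inner ℝ u.lap v.lap + inner ℝ u.grad v.grad
        - μ * (∫ x, |u.fn x| ^ (p - 2) * u.fn x * v.fn x)
        - ∫ x, |u.fn x| ^ (fourStar N - 2) * u.fn x * v.fn x) ∧
      (∀ u, HasFDerivAt (energy N p μ) (dE u) u) ∧
      ∀ r, ∃ L, 0 ≤ L ∧ ∀ u v, ‖u‖ ≤ r → ‖v‖ ≤ r → ‖dE u - dE v‖ ≤ L * ‖u - v‖ := by
  obtain ⟨G, hG, hGd, hGl⟩ := H2.exists_powDual hN hp (lt_fourStar hN hp').le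
  obtain ⟨K, hK, hKd, hKl⟩ := H2.exists_powDual hN (two_lt_fourStar hN) le_rfl
  let A : H2 N → (H2 N →L[ℝ] ℝ) := fun u =>
    (innerSL ℝ u.lap).comp H2.lapL + (innerSL ℝ u.grad).comp H2.gradL
  have hA : ∀ u v, A u v = inner ℝ u.lap v.lap + inner ℝ u.grad v.grad := fun u v => rfl
  have hA_sub : ∀ u v, A u - A v = A (u - v) := by
    intro u v
    ext w
    have e1 : (u - v).lap = u.lap - v.lap := rfl
    have e2 : (u - v).grad = u.grad - v.grad := rfl
    rw [sub_apply, hA, hA, hA, e1, e2, inner_sub_left, inner_sub_left]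
    ring
  have hA_norm : ∀ u, ‖A u‖ ≤ 2 * ‖u‖ := by
    intro u
    refine ContinuousLinearMap.opNorm_le_bound _ (by positivity) fun v => ?_
    rw [hA, Real.norm_eq_abs]
    have h1 := abs_real_inner_le_norm u.lap v.lap
    have h2 := abs_real_inner_le_norm u.grad v.grad
    have h3 := mul_le_mul u.norm_lap_le v.norm_lap_le (norm_nonneg _) (norm_nonneg _)
    have h4 := mul_le_mul u.norm_grad_le v.norm_grad_le (norm_nonneg _) (norm_nonneg _)
    have h5 := abs_add_le (inner ℝ u.lap v.lap) (inner ℝ u.grad v.grad)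
    linarith
  have hp0 : p ≠ 0 := by linarith
  have hq0 : fourStar N ≠ 0 := (fourStar_pos hN).ne'
  refine ⟨fun u => A u - μ • G u - K u, fun u v => ?_, fun u => ?_, fun r => ?_⟩
  · rw [← hG, ← hK, ← hA]
    rfl
  · have h1 : HasFDerivAt (fun u : H2 N => 1 / 2 * ‖u.lap‖ ^ 2) _ u :=
      (HasFDerivAt.norm_sq H2.lapL.hasFDerivAt).const_mul (1 / 2 : ℝ)
    have h2 : HasFDerivAt (fun u : H2 N => 1 / 2 * ‖u.grad‖ ^ 2) _ u :=
      (HasFDerivAt.norm_sq H2.gradL.hasFDerivAt).const_mul (1 / 2 : ℝ)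
    have h3 := (hGd u).const_mul (μ / p)
    have h4 := (hKd u).const_mul (1 / fourStar N)
    refine (((h1.add h2).sub h3).sub h4).congr_fderiv ?_
    ext v
    simp only [sub_apply, add_apply, smul_apply, hA, smul_eq_mul, ContinuousLinearMap.comp_apply,
      innerSL_apply_apply, H2.lapL_apply, H2.gradL_apply]
    field_simp
    simp only [nsmul_eq_mul]
    push_cast
    ring
  · obtain ⟨L₁, hL₁, h₁⟩ := hGl r
    obtain ⟨L₂, hL₂, h₂⟩ := hKl r
    refine ⟨2 + |μ| * L₁ + L₂, by positivity, fun u v hu hv => ?_⟩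
    clear_value A
    have h5 := norm_sub_smul_sub_sub_le μ (A u) (G u) (K u) (A v) (G v) (K v)
    refine h5.trans ?_
    have h3 := hA_norm (u - v)
    rw [← hA_sub] at h3
    have h4 := mul_le_mul_of_nonneg_left (h₁ u v hu hv) (abs_nonneg μ)
    linarith [h₂ u v hu hv]

end EnergyDerivative

/-! ### Convergence of the nonlinear terms -/

section NonlinearTerms

variable {N : ℕ} {p : ℝ}

lemma tendsto_powInt_rpow_zero {ι : Type*} {l : Filter ι} {f : ι → ℝ} (h : Tendsto f l (𝓝 0))
    {a : ℝ} (ha : 0 < a) : Tendsto (fun n => f n ^ a) l (𝓝 0) := by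
  have := h.rpow_const (p := a) (Or.inr ha.le)
  rwa [Real.zero_rpow ha.ne'] at this

/-- `∫ |u_n|^{p-2} u_n v_n → 0` when `v_n ⇀ 0` is radial and `p` is subcritical. -/
lemma tendsto_subcritical_term (hN : 5 ≤ N) (hp : 2 < p) (hp4 : p < fourStar N)
    (F : Ultrafilter ℕ) {u v : ℕ → H2 N} {B : ℝ} (hu : ∀ n, ‖u n‖ ≤ B)
    (hv : Tendsto (fun n => (v n).powInt p) F (𝓝 0)) :
    Tendsto (fun n => ∫ x, |(u n).fn x| ^ (p - 2) * (u n).fn x * (v n).fn x) F (𝓝 0) := by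
  obtain ⟨C, hC0, hC⟩ := H2.exists_powInt_le hN hp.le hp4.le
  have hB0 : 0 ≤ B := (norm_nonneg _).trans (hu 0)
  have hp0 : 0 < p := by linarith
  have h1 : Tendsto (fun n => (C * B) ^ (p - 2) * (C * B) * (v n).powInt p ^ (1 / p)) F (𝓝 0) := by
    simpa using (tendsto_powInt_rpow_zero hv (by positivity : 0 < 1 / p)).const_mul
      ((C * B) ^ (p - 2) * (C * B))
  refine squeeze_zero_norm (fun n => ?_) h1
  have h := (hoelder_three hp.le ((u n).integrable_rpow hN hp.le hp4.le)
    ((u n).integrable_rpow hN hp.le hp4.le) ((v n).integrable_rpow hN hp.le hp4.le)).2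
  have e : (∫ x, |(u n).fn x| ^ p) ^ ((p - 2) / p) = ((u n).powInt p ^ (1 / p)) ^ (p - 2) := by
    rw [← Real.rpow_mul ((u n).powInt_nonneg p), one_div_mul_eq_div]
    rfl
  have hb : (u n).powInt p ^ (1 / p) ≤ C * B := (hC (u n)).trans (by gcongr; exact hu n)
  have h0 : 0 ≤ (u n).powInt p ^ (1 / p) := Real.rpow_nonneg ((u n).powInt_nonneg p) _
  have h0' : 0 ≤ (v n).powInt p ^ (1 / p) := Real.rpow_nonneg ((v n).powInt_nonneg p) _
  refine (norm_integral_le_integral_norm _).trans ?_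
  have e2 : ∀ x, ‖|(u n).fn x| ^ (p - 2) * (u n).fn x * (v n).fn x‖
      = |(u n).fn x| ^ (p - 2) * |(u n).fn x| * |(v n).fn x| := fun x => by
    rw [Real.norm_eq_abs, abs_mul, abs_mul, abs_of_nonneg (Real.rpow_nonneg (abs_nonneg _) _)]
  simp only [e2]
  refine h.trans ?_
  rw [e]
  change ((u n).powInt p ^ (1 / p)) ^ (p - 2) * (u n).powInt p ^ (1 / p) * (v n).powInt p ^ (1 / p)
    ≤ _
  have : 0 ≤ p - 2 := by linarith
  gcongr

/-- `∫ |u|^{q-2} v² ≤ S^{-q/2} ‖Δu‖^{q-2} ‖Δv‖²`, `q = 4^*`. -/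
lemma integral_critical_sq_le (hN : 5 ≤ N) (u v : H2 N) :
    ∫ x, |u.fn x| ^ (fourStar N - 2) * |v.fn x| * |v.fn x|
      ≤ ‖u.lap‖ ^ (fourStar N - 2) / sobolevS N ^ (fourStar N / 2) * ‖v.lap‖ ^ 2 := by
  set q := fourStar N with hq
  have hq2 : 2 < q := two_lt_fourStar hN
  have hq0 : 0 < q := by linarith
  set T := sobolevS N ^ (q / 2) with hT
  have hT0 : 0 < T := Real.rpow_pos_of_pos (sobolevS_pos hN) _
  have hb : ∀ w : H2 N, w.powInt q ≤ ‖w.lap‖ ^ q / T := fun w => by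
    rw [le_div_iff₀ hT0, mul_comm]
    exact sobolevS_mul_powInt_le hN w
  have h := (hoelder_three hq2.le (u.integrable_rpow_fourStar hN) (v.integrable_rpow_fourStar hN)
    (v.integrable_rpow_fourStar hN)).2
  refine h.trans ?_
  have hv0 : 0 ≤ v.powInt q := v.powInt_nonneg q
  have hr : 0 ≤ (q - 2) / q := div_nonneg (by linarith) hq0.le
  have hsq : v.powInt q ^ (1 / q) * v.powInt q ^ (1 / q) = v.powInt q ^ (2 / q) := by
    rw [← Real.rpow_add_of_nonneg hv0 (by positivity) (by positivity)]
    congr 1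
    ring
  calc u.powInt q ^ ((q - 2) / q) * v.powInt q ^ (1 / q) * v.powInt q ^ (1 / q)
      = u.powInt q ^ ((q - 2) / q) * v.powInt q ^ (2 / q) := by rw [mul_assoc, hsq]
    _ ≤ (‖u.lap‖ ^ q / T) ^ ((q - 2) / q) * (‖v.lap‖ ^ q / T) ^ (2 / q) := by
        have := u.powInt_nonneg q
        have h1 := hb u
        have h2 := hb v
        gcongr
    _ = ‖u.lap‖ ^ (q - 2) / T * ‖v.lap‖ ^ 2 := by
        rw [Real.div_rpow (by positivity) hT0.le, Real.div_rpow (by positivity) hT0.le,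
          ← Real.rpow_mul (norm_nonneg _), ← Real.rpow_mul (norm_nonneg _),
          mul_div_cancel₀ _ hq0.ne', mul_div_cancel₀ _ hq0.ne', Real.rpow_two]
        have : T ^ ((q - 2) / q) * T ^ (2 / q) = T := by
          rw [← Real.rpow_add hT0]
          have : (q - 2) / q + 2 / q = 1 := by field_simp; ring
          rw [this, Real.rpow_one]
        rw [div_mul_div_comm, this]
        ring

/-- `∫ |u_n|^{q-2} |w| |v_n| → 0` for a test function `w`, `q = 4^*`. -/
lemma tendsto_critical_test_term (hN : 5 ≤ N) (F : Ultrafilter ℕ) {u v : ℕ → H2 N} {B : ℝ}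
    (hu : ∀ n, ‖u n‖ ≤ B)
    (hv : ∀ m, 2 < m → m < fourStar N → Tendsto (fun n => (v n).powInt m) F (𝓝 0))
    {w : RN N → ℝ} (hw : IsTest w) :
    Tendsto (fun n => ∫ x, |(u n).fn x| ^ (fourStar N - 2) * |w x| * |(v n).fn x|) F (𝓝 0) := by
  set q := fourStar N with hq
  have hq2 : 2 < q := two_lt_fourStar hN
  have hq0 : 0 < q := by linarith
  obtain ⟨C, hC0, hC⟩ := H2.exists_powInt_le hN hq2.le le_rfl
  have hB0 : 0 ≤ B := (norm_nonneg _).trans (hu 0)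
  -- An exponent strictly between `2` and `q` in which `v_n → 0`. The test function takes the
  -- remaining Hölder weight `τ`, which is positive because `m > q/2`.
  set m := (q + 2) / 2 with hm
  have hm2 : 2 < m := by linarith
  have hm0 : 0 < m := by linarith
  have hmq : m < q := by linarith
  set τ := 2 / q - 1 / m with hτ
  have hτ0 : 0 < τ := by
    rw [hτ, sub_pos, div_lt_div_iff₀ hm0 hq0]
    linarith
  have hwt : Integrable (fun x => |w x| ^ (1 / τ)) volume := by
    have hc : Continuous fun x => |w x| ^ (1 / τ) :=
      hw.continuous.abs.rpow_const fun x => Or.inr (by positivity)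
    refine hc.integrable_of_hasCompactSupport (hw.2.mono fun x hx h0 => hx ?_)
    simp [h0, hτ0.ne']
  set W := (∫ x, |w x| ^ (1 / τ)) ^ τ with hW
  have hW0 : 0 ≤ W := Real.rpow_nonneg (integral_nonneg fun x => by positivity) _
  have h1 : Tendsto (fun n => (C * B) ^ (q - 2) * W * (v n).powInt m ^ (1 / m)) F (𝓝 0) := by
    simpa using (tendsto_powInt_rpow_zero (hv m hm2 hmq) (by positivity : 0 < 1 / m)).const_mul
      ((C * B) ^ (q - 2) * W)
  refine squeeze_zero (fun n => integral_nonneg fun x => by positivity) (fun n => ?_) h1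
  have H := hoelder_prod (μ := (volume : Measure (RN N))) (Finset.univ : Finset (Fin 3))
    (F := ![fun x => |(u n).fn x| ^ q, fun x => |w x| ^ (1 / τ), fun x => |(v n).fn x| ^ m])
    (w := ![(q - 2) / q, τ, 1 / m])
    (by intro i _ x; fin_cases i <;> simp <;> positivity)
    (by
      intro i _
      fin_cases i
      · exact (u n).integrable_rpow_fourStar hN
      · exact hwt
      · exact (v n).integrable_rpow hN hm2.le hmq.le)
    (by
      intro i _
      fin_cases i
      · exact div_nonneg (by linarith) hq0.le
      · exact hτ0.le
      · exact (one_div_pos.2 hm0).le)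
    (by
      simp only [Fin.sum_univ_three, Matrix.cons_val_zero, Matrix.cons_val_one,
        Matrix.cons_val_two, Matrix.tail_cons, Matrix.head_cons]
      rw [hτ]
      field_simp
      ring)
  simp only [Fin.prod_univ_three, Matrix.cons_val_zero, Matrix.cons_val_one,
    Matrix.cons_val_two, Matrix.tail_cons, Matrix.head_cons] at H
  have e1 : ∀ x, (|(u n).fn x| ^ q) ^ ((q - 2) / q) = |(u n).fn x| ^ (q - 2) := fun x => by
    rw [← Real.rpow_mul (abs_nonneg _), mul_div_cancel₀ _ hq0.ne']
  have e2 : ∀ x, (|w x| ^ (1 / τ)) ^ τ = |w x| := fun x => by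
    rw [← Real.rpow_mul (abs_nonneg _), one_div_mul_cancel hτ0.ne', Real.rpow_one]
  have e3 : ∀ x, (|(v n).fn x| ^ m) ^ (1 / m) = |(v n).fn x| := fun x => by
    rw [← Real.rpow_mul (abs_nonneg _), mul_one_div_cancel hm0.ne', Real.rpow_one]
  simp only [e1, e2, e3] at H
  refine H.2.trans ?_
  have e : (∫ x, |(u n).fn x| ^ q) ^ ((q - 2) / q) = ((u n).powInt q ^ (1 / q)) ^ (q - 2) := by
    rw [← Real.rpow_mul ((u n).powInt_nonneg q), one_div_mul_eq_div]
    rfl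
  rw [e]
  have hb : (u n).powInt q ^ (1 / q) ≤ C * B := (hC (u n)).trans (by gcongr; exact hu n)
  have h0 : 0 ≤ (u n).powInt q ^ (1 / q) := Real.rpow_nonneg ((u n).powInt_nonneg q) _
  have h0' : 0 ≤ (v n).powInt m ^ (1 / m) := Real.rpow_nonneg ((v n).powInt_nonneg m) _
  change ((u n).powInt q ^ (1 / q)) ^ (q - 2) * W * (v n).powInt m ^ (1 / m) ≤ _
  have : 0 ≤ q - 2 := by linarith
  gcongr

/-- `∫ |u_n|^{q-2} |w| |v_n| → 0` for `w ∈ H²`, `q = 4^*`. -/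
lemma tendsto_critical_term (hN : 5 ≤ N) (F : Ultrafilter ℕ) {u v : ℕ → H2 N} {B : ℝ}
    (hu : ∀ n, ‖u n‖ ≤ B) (hvB : ∀ n, ‖v n‖ ≤ B)
    (hv : ∀ m, 2 < m → m < fourStar N → Tendsto (fun n => (v n).powInt m) F (𝓝 0)) (w : H2 N) :
    Tendsto (fun n => ∫ x, |(u n).fn x| ^ (fourStar N - 2) * |w.fn x| * |(v n).fn x|)
      F (𝓝 0) := by
  have hq2 := two_lt_fourStar hN
  obtain ⟨K, hK0, hK⟩ := H2.exists_integral_three_le hN hq2 le_rfl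
  have hB0 : 0 ≤ B := (norm_nonneg _).trans (hu 0)
  rw [Metric.tendsto_nhds]
  intro ε hε
  set A := K * (B ^ (fourStar N - 2) * B) with hA
  have hA0 : 0 ≤ A := by positivity
  -- Approximating `w` by a test function leaves an error at most `A ε/(2(A+1)) ≤ ε/2`, uniformly in
  -- `n`.
  obtain ⟨φ, hφ, hlt⟩ := exists_ofTest_dist_lt w (δ := ε / (2 * (A + 1))) (by positivity)
  have h1 := tendsto_critical_test_term hN F hu hv hφ
  filter_upwards [Metric.tendsto_nhds.1 h1 (ε / 2) (by positivity)] with n hn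
  rw [dist_zero_right, Real.norm_of_nonneg (integral_nonneg fun x => by positivity)] at hn ⊢
  have i1 := hK (u n) (ofTest hφ) (v n)
  have i2 := hK (u n) (ofTest hφ - w) (v n)
  have e1 : ∫ x, |(u n).fn x| ^ (fourStar N - 2) * |(ofTest hφ).fn x| * |(v n).fn x|
      = ∫ x, |(u n).fn x| ^ (fourStar N - 2) * |φ x| * |(v n).fn x| := by
    refine integral_congr_ae ?_
    filter_upwards [ofTest_coeFn hφ] with x hx
    rw [hx]
  have h2 : ∫ x, |(u n).fn x| ^ (fourStar N - 2) * |w.fn x| * |(v n).fn x|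
      ≤ (∫ x, |(u n).fn x| ^ (fourStar N - 2) * |(ofTest hφ).fn x| * |(v n).fn x|)
        + ∫ x, |(u n).fn x| ^ (fourStar N - 2) * |(ofTest hφ - w).fn x| * |(v n).fn x| := by
    rw [← integral_add i1.1 i2.1]
    refine integral_mono_ae (hK (u n) w (v n)).1 (i1.1.add i2.1) ?_
    filter_upwards [H2.coeFn_sub (ofTest hφ) w] with x hx
    simp only [hx]
    have h3 : |w.fn x| ≤ |(ofTest hφ).fn x| + |(ofTest hφ).fn x - w.fn x| := by
      have := abs_sub_abs_le_abs_sub (w.fn x) ((ofTest hφ).fn x)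
      rw [abs_sub_comm] at this
      linarith
    calc _ ≤ |(u n).fn x| ^ (fourStar N - 2)
          * (|(ofTest hφ).fn x| + |(ofTest hφ).fn x - w.fn x|) * |(v n).fn x| := by gcongr
      _ = _ := by ring
  have h4 : ∫ x, |(u n).fn x| ^ (fourStar N - 2) * |(ofTest hφ - w).fn x| * |(v n).fn x|
      ≤ ε / 2 := by
    refine i2.2.trans ?_
    have hr : 0 ≤ fourStar N - 2 := by linarith
    calc K * (‖u n‖ ^ (fourStar N - 2) * ‖ofTest hφ - w‖ * ‖v n‖)
        ≤ K * (B ^ (fourStar N - 2) * (ε / (2 * (A + 1))) * B) := by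
          have := hu n
          have := hvB n
          gcongr
      _ = A * (ε / (2 * (A + 1))) := by rw [hA]; ring
      _ ≤ (A + 1) * (ε / (2 * (A + 1))) := by gcongr; linarith
      _ = ε / 2 := by field_simp
  rw [e1] at h2
  linarith

end NonlinearTerms

end

noncomputable section

/-! ### The Palais-Smale condition -/

/-- Bounded sequences in a Hilbert space converge weakly along an ultrafilter. -/
lemma exists_weak_limit {H : Type*} [NormedAddCommGroup H] [InnerProductSpace ℝ H]
    [CompleteSpace H] (F : Ultrafilter ℕ) {u : ℕ → H} {B : ℝ} (hB : ∀ n, ‖u n‖ ≤ B) :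
    ∃ v, ∀ L : H →L[ℝ] ℝ, Tendsto (fun n => L (u n - v)) F (𝓝 0) := by
  let T : ℕ → WeakDual ℝ H := fun n => StrongDual.toWeakDual (InnerProductSpace.toDual ℝ H (u n))
  have hmem : ∀ n, T n ∈ WeakDual.toStrongDual ⁻¹' Metric.closedBall (0 : StrongDual ℝ H) B := by
    intro n
    rw [Set.mem_preimage, mem_closedBall_zero_iff]
    change ‖InnerProductSpace.toDual ℝ H (u n)‖ ≤ B
    rw [LinearIsometryEquiv.norm_map]
    exact hB n
  obtain ⟨ℓ, _, hℓ⟩ := (WeakDual.isCompact_closedBall (𝕜 := ℝ) (0 : StrongDual ℝ H) B).ultrafilter_le_nhds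
    (F.map T) (le_principal_iff.2 (Filter.mem_map.2 (Filter.univ_mem' hmem)))
  have hT : Tendsto T F (𝓝 ℓ) := hℓ
  refine ⟨(InnerProductSpace.toDual ℝ H).symm (WeakDual.toStrongDual ℓ), fun L => ?_⟩
  set w := (InnerProductSpace.toDual ℝ H).symm L with hw
  have h1 : Tendsto (fun n => T n w) F (𝓝 (ℓ w)) := ((WeakDual.eval_continuous w).tendsto ℓ).comp hT
  have h2 : Tendsto (fun n => T n w - ℓ w) F (𝓝 0) := by simpa using h1.sub_const (ℓ w)
  refine h2.congr fun n => ?_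
  have e1 : T n w = inner ℝ (u n) w := rfl
  have e2 : ℓ w = inner ℝ ((InnerProductSpace.toDual ℝ H).symm (WeakDual.toStrongDual ℓ)) w := by
    rw [InnerProductSpace.toDual_symm_apply]
    rfl
  rw [e1, e2, ← inner_sub_left, real_inner_comm, hw, InnerProductSpace.toDual_symm_apply]

section PalaisSmale

variable {N : ℕ} {p μ : ℝ}

/-- The almost-critical equation is tested with `u_n - v`. Weak convergence removes the cross terms
with `v` and radial compactness the subcritical term. The critical term costs at most a fraction `θ
< 1` of `‖Δ(u_n - v)‖²`. The negative multiplier contributes `κ‖u_n - v‖₂²`, so the left side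
controls the full `H²` norm. -/
lemma tendsto_zero_of_almost_critical (hN : 5 ≤ N) (hp : 2 < p) (hp' : p < 2 + 4 / (N : ℝ))
    (hμ : 0 < μ) (F : Ultrafilter ℕ) {u : ℕ → H2 N} {v : H2 N} {B : ℝ} (hB : ∀ n, ‖u n‖ ≤ B)
    (hrad : ∀ n, u n - v ∈ H2rad N)
    (hr : ∀ n, ‖(u n).lap‖ ^ 2 + ‖(u n).grad‖ ^ 2 ≤ rStar N p μ ^ 2)
    (hw : ∀ L : H2 N →L[ℝ] ℝ, Tendsto (fun n => L (u n - v)) F (𝓝 0))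
    {l : ℕ → ℝ} {κ M : ℝ} (hκ : 0 < κ) (hl : ∀ᶠ n in F, l n ≤ -κ) (hM : ∀ᶠ n in F, |l n| ≤ M)
    (hG : Tendsto (fun n => inner ℝ (u n).lap (u n - v).lap + inner ℝ (u n).grad (u n - v).grad
        - μ * (∫ x, |(u n).fn x| ^ (p - 2) * (u n).fn x * (u n - v).fn x)
        - (∫ x, |(u n).fn x| ^ (fourStar N - 2) * (u n).fn x * (u n - v).fn x)
        - l n * inner ℝ (u n).fn (u n - v).fn) F (𝓝 0)) :
    Tendsto (fun n => u n - v) F (𝓝 0) := by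
  have hq2 := two_lt_fourStar hN
  have hvB : ∀ n, ‖u n - v‖ ≤ B + ‖v‖ := fun n => (norm_sub_le _ _).trans (by linarith [hB n])
  have hB' : ∀ n, ‖u n‖ ≤ B + ‖v‖ := fun n => by linarith [hB n, norm_nonneg v]
  have hwf : ∀ f : L2Fun N, Tendsto (fun n => inner ℝ (u n - v).fn f) F (𝓝 0) := by
    intro f
    refine (hw ((innerSL ℝ f).comp H2.fnL)).congr fun n => ?_
    simp [real_inner_comm]
  have hpow : ∀ m, 2 < m → m < fourStar N →
      Tendsto (fun n => (u n - v).powInt m) F (𝓝 0) := fun m h2 h4 =>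
    tendsto_powInt_of_weak hN h2 h4 F hrad hvB hwf
  have hp4 := lt_fourStar hN hp'
  have t1 := tendsto_subcritical_term hN hp hp4 F hB (hpow p hp hp4)
  have t2 := tendsto_critical_term hN F hB' hvB hpow v
  have t3 : Tendsto (fun n => inner ℝ v.lap (u n - v).lap) F (𝓝 0) :=
    hw ((innerSL ℝ v.lap).comp H2.lapL)
  have t4 : Tendsto (fun n => inner ℝ v.grad (u n - v).grad) F (𝓝 0) :=
    hw ((innerSL ℝ v.grad).comp H2.gradL)
  have t5 : Tendsto (fun n => l n * inner ℝ v.fn (u n - v).fn) F (𝓝 0) := by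
    have h := hw ((innerSL ℝ v.fn).comp H2.fnL)
    have h1 : Tendsto (fun n => M * ‖inner ℝ v.fn (u n - v).fn‖) F (𝓝 0) := by
      have := h.norm.const_mul M
      rw [norm_zero, mul_zero] at this
      exact this
    refine squeeze_zero_norm' ?_ h1
    filter_upwards [hM] with n hn
    rw [norm_mul, Real.norm_eq_abs (l n)]
    exact mul_le_mul_of_nonneg_right hn (norm_nonneg _)
  set T := sobolevS N ^ (fourStar N / 2) with hT
  have hT0 : 0 < T := Real.rpow_pos_of_pos (sobolevS_pos hN) _
  have hr0 := (rStar_spec hN hp hp' hμ).2.1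
  set θ := rStar N p μ ^ (fourStar N - 2) / T with hθ
  have hθ1 : θ < 1 := (div_lt_one hT0).2 (rStar_rpow_lt hN hp hp' hμ).1
  -- One factor `u_n` is written as `(u_n - v) + v`. The first part is estimated by Sobolev inside
  -- the ball of radius `r_*`; the second tends to zero.
  have hcrit : ∀ n, ∫ x, |(u n).fn x| ^ (fourStar N - 2) * (u n).fn x * (u n - v).fn x
      ≤ θ * ‖(u n - v).lap‖ ^ 2
        + ∫ x, |(u n).fn x| ^ (fourStar N - 2) * |v.fn x| * |(u n - v).fn x| := by
    intro n
    obtain ⟨K, _, hK⟩ := H2.exists_integral_three_le hN hq2 le_rfl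
    have i1 := (hK (u n) (u n - v) (u n - v)).1
    have i2 := (hK (u n) v (u n - v)).1
    have hlap : ‖(u n).lap‖ ≤ rStar N p μ := by
      refine abs_le_of_sq_le_sq' ?_ hr0.le |>.2
      nlinarith [hr n, sq_nonneg ‖(u n).grad‖]
    have h1 : ∫ x, |(u n).fn x| ^ (fourStar N - 2) * |(u n - v).fn x| * |(u n - v).fn x|
        ≤ θ * ‖(u n - v).lap‖ ^ 2 := by
      refine (integral_critical_sq_le hN (u n) (u n - v)).trans ?_
      rw [hθ]
      have : 0 ≤ fourStar N - 2 := by linarith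
      gcongr
    refine le_trans ?_ (add_le_add_left h1 _)
    rw [← integral_add i1 i2]
    refine integral_mono_ae (H2.integrable_signedPow_mul hN hq2 le_rfl _ _) (i1.add i2) ?_
    filter_upwards [H2.coeFn_sub (u n) v] with x hx
    have e : (u n).fn x = (u n - v).fn x + v.fn x := by rw [hx]; ring
    have h2 : (u n).fn x * (u n - v).fn x
        ≤ |(u n - v).fn x| * |(u n - v).fn x| + |v.fn x| * |(u n - v).fn x| := by
      nth_rewrite 1 [e]
      rw [add_mul, ← abs_mul, ← abs_mul]
      exact add_le_add (le_abs_self _) (le_abs_self _)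
    have h3 := mul_le_mul_of_nonneg_left h2 (Real.rpow_nonneg (abs_nonneg ((u n).fn x))
      (fourStar N - 2))
    linarith
  set ε : ℕ → ℝ := fun n => (inner ℝ (u n).lap (u n - v).lap + inner ℝ (u n).grad (u n - v).grad
        - μ * (∫ x, |(u n).fn x| ^ (p - 2) * (u n).fn x * (u n - v).fn x)
        - (∫ x, |(u n).fn x| ^ (fourStar N - 2) * (u n).fn x * (u n - v).fn x)
        - l n * inner ℝ (u n).fn (u n - v).fn)
      + μ * (∫ x, |(u n).fn x| ^ (p - 2) * (u n).fn x * (u n - v).fn x)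
      + (∫ x, |(u n).fn x| ^ (fourStar N - 2) * |v.fn x| * |(u n - v).fn x|)
      - inner ℝ v.lap (u n - v).lap - inner ℝ v.grad (u n - v).grad
      + l n * inner ℝ v.fn (u n - v).fn with hε
  have hε0 : Tendsto ε F (𝓝 0) := by
    have := ((((hG.add (t1.const_mul μ)).add t2).sub t3).sub t4).add t5
    simpa using this
  -- The coercivity constant: the weights of the Laplacian, gradient and mass parts are `1 - θ`, `1`
  -- and `κ`.
  set m := min (1 - θ) (min 1 κ) with hm
  have hm0 : 0 < m := lt_min (by linarith) (lt_min one_pos hκ)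
  have hbd : ∀ᶠ n in F, ‖u n - v‖ ^ 2 ≤ m⁻¹ * ε n := by
    filter_upwards [hl] with n hn
    have e1 : inner ℝ (u n).lap (u n - v).lap
        = ‖(u n - v).lap‖ ^ 2 + inner ℝ v.lap (u n - v).lap := by
      rw [← real_inner_self_eq_norm_sq, ← inner_add_left]
      congr 1
      exact (sub_add_cancel (u n).lap v.lap).symm
    have e2 : inner ℝ (u n).grad (u n - v).grad
        = ‖(u n - v).grad‖ ^ 2 + inner ℝ v.grad (u n - v).grad := by
      rw [← real_inner_self_eq_norm_sq, ← inner_add_left]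
      congr 1
      exact (sub_add_cancel (u n).grad v.grad).symm
    have e3 : inner ℝ (u n).fn (u n - v).fn
        = ‖(u n - v).fn‖ ^ 2 + inner ℝ v.fn (u n - v).fn := by
      rw [← real_inner_self_eq_norm_sq, ← inner_add_left]
      congr 1
      exact (sub_add_cancel (u n).fn v.fn).symm
    have h1 : (1 - θ) * ‖(u n - v).lap‖ ^ 2 + ‖(u n - v).grad‖ ^ 2 + κ * ‖(u n - v).fn‖ ^ 2
        ≤ ε n := by
      have h2 := hcrit n
      have h3 := mul_le_mul_of_nonneg_right hn (sq_nonneg ‖(u n - v).fn‖)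
      simp only [hε]
      rw [e1, e2, e3]
      linarith
    rw [← div_eq_inv_mul, le_div_iff₀ hm0, H2.norm_sq_eq, mul_comm]
    have m1 : m ≤ 1 - θ := min_le_left _ _
    have m2 : m ≤ 1 := (min_le_right _ _).trans (min_le_left _ _)
    have m3 : m ≤ κ := (min_le_right _ _).trans (min_le_right _ _)
    have := mul_le_mul_of_nonneg_right m1 (sq_nonneg ‖(u n - v).lap‖)
    have := mul_le_mul_of_nonneg_right m2 (sq_nonneg ‖(u n - v).grad‖)
    have := mul_le_mul_of_nonneg_right m3 (sq_nonneg ‖(u n - v).fn‖)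
    linarith
  have hsq : Tendsto (fun n => ‖u n - v‖ ^ 2) F (𝓝 0) := by
    have h := hε0.const_mul m⁻¹
    rw [mul_zero] at h
    exact squeeze_zero' (Eventually.of_forall fun n => sq_nonneg _) hbd h
  rw [tendsto_zero_iff_norm_tendsto_zero]
  have h := hsq.sqrt
  simpa [Real.sqrt_sq (norm_nonneg _)] using h

end PalaisSmale

end

noncomputable section

/-! ### The variational problem on the space of radial functions -/

section RadialProblem

variable {N : ℕ} {p μ c : ℝ}

/-- The pairing `I'(u) v`. -/
def energyPairing (N : ℕ) (p μ : ℝ) (u v : H2 N) : ℝ :=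
  inner ℝ u.lap v.lap + inner ℝ u.grad v.grad
    - μ * (∫ x, |u.fn x| ^ (p - 2) * u.fn x * v.fn x)
    - ∫ x, |u.fn x| ^ (fourStar N - 2) * u.fn x * v.fn x

lemma integral_signedPow_mul_self {q : ℝ} (hq : 2 < q) (u : H2 N) :
    ∫ x, |u.fn x| ^ (q - 2) * u.fn x * u.fn x = u.powInt q := by
  refine integral_congr_ae (Eventually.of_forall fun x => ?_)
  simp only
  rw [mul_assoc, ← abs_mul_abs_self, ← sq, ← Real.rpow_two,
    ← Real.rpow_add_of_nonneg (abs_nonneg _) (by linarith) (by norm_num), sub_add_cancel]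

lemma integral_signedPow_neg (q : ℝ) (u v : H2 N) :
    ∫ x, |(-u).fn x| ^ (q - 2) * (-u).fn x * v.fn x
      = -∫ x, |u.fn x| ^ (q - 2) * u.fn x * v.fn x := by
  rw [← integral_neg]
  refine integral_congr_ae ?_
  filter_upwards [u.coeFn_neg] with x hx
  rw [hx, abs_neg]
  ring

lemma energyPairing_neg (u v : H2 N) : energyPairing N p μ (-u) v = -energyPairing N p μ u v := by
  have e1 : (-u).lap = -u.lap := rfl
  have e2 : (-u).grad = -u.grad := rfl
  unfold energyPairing
  rw [integral_signedPow_neg, integral_signedPow_neg, e1, e2, inner_neg_left, inner_neg_left]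
  ring

lemma powInt_neg (q : ℝ) (u : H2 N) : (-u).powInt q = u.powInt q := by
  refine integral_congr_ae ?_
  filter_upwards [u.coeFn_neg] with x hx
  rw [hx, abs_neg]

lemma energy_neg (u : H2 N) : energy N p μ (-u) = energy N p μ u := by
  have e1 : (-u).lap = -u.lap := rfl
  have e2 : (-u).grad = -u.grad := rfl
  rw [energy, energy, powInt_neg, powInt_neg, e1, e2, norm_neg, norm_neg]

/-- Both exponents exceed `2`, so each power term counts more in `I'(u)u` than in `2I(u)`. This is
the source of the sign of the multipliers: at a critical point `λ c = I'(u)u ≤ 2I(u) < 0`. -/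
lemma energyPairing_self_le (hN : 5 ≤ N) (hp : 2 < p) (hμ : 0 < μ) (u : H2 N) :
    energyPairing N p μ u u ≤ 2 * energy N p μ u := by
  have hq := two_lt_fourStar hN
  unfold energyPairing energy
  rw [integral_signedPow_mul_self hp, integral_signedPow_mul_self hq, real_inner_self_eq_norm_sq,
    real_inner_self_eq_norm_sq]
  have h1 : μ / p * u.powInt p * 2 ≤ μ * u.powInt p := by
    have h : μ / p * 2 ≤ μ := by
      rw [div_mul_eq_mul_div, div_le_iff₀ (by linarith)]
      nlinarith
    nlinarith [u.powInt_nonneg p]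
  have h2 : 1 / fourStar N * u.powInt (fourStar N) * 2 ≤ u.powInt (fourStar N) := by
    have h : 1 / fourStar N * 2 ≤ 1 := by
      rw [div_mul_eq_mul_div, div_le_iff₀ (by linarith)]
      linarith
    nlinarith [u.powInt_nonneg (fourStar N)]
  linarith

/-- A closed subspace of a separable Hilbert space is the image of a separable Hilbert space. -/
lemma exists_isometry_range_eq {E : Type} [NormedAddCommGroup E] [InnerProductSpace ℝ E]
    [CompleteSpace E] [SecondCountableTopology E] (K : Submodule ℝ E) (hK : IsClosed (K : Set E)) :
    ∃ (H : Type) (_ : NormedAddCommGroup H) (_ : InnerProductSpace ℝ H) (_ : CompleteSpace H)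
      (_ : TopologicalSpace.SeparableSpace H) (ι : H →ₗᵢ[ℝ] E), Set.range ι = K := by
  have h1 : CompleteSpace K := hK.completeSpace_coe
  have h2 : SecondCountableTopology K := TopologicalSpace.Subtype.secondCountableTopology _
  exact ⟨K, inferInstance, inferInstance, h1, inferInstance, K.subtypeₗᵢ, by simp⟩

/-! In the sequel `ι : H → H²` is an isometric embedding of a Hilbert space `H` with values in the
radial functions. -/

variable {H : Type*} [NormedAddCommGroup H] [InnerProductSpace ℝ H]

/-- The map `u ↦ ι u` into `L²`. -/
def massMap (ι : H →ₗᵢ[ℝ] H2 N) : H →L[ℝ] L2Fun N := H2.fnL.comp ι.toContinuousLinearMap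

lemma massMap_apply (ι : H →ₗᵢ[ℝ] H2 N) (u : H) : massMap ι u = (ι u).fn := rfl

/-- The gradient of the energy in `H²_r`. -/
theorem exists_radialGrad [CompleteSpace H] (ι : H →ₗᵢ[ℝ] H2 N) (hN : 5 ≤ N) (hp : 2 < p) (hp' : p < 2 + 4 / (N : ℝ)) (μ : ℝ) :
    ∃ g : H → H, (∀ u v, inner ℝ (g u) v = energyPairing N p μ (ι u) (ι v)) ∧
      (∀ u : H, DifferentiableAt ℝ (energy N p μ) (ι u) ∧
        ∀ v : H, fderiv ℝ (energy N p μ) (ι u) (ι v) = inner ℝ (g u) v) ∧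
      (∀ u, HasFDerivAt (fun u : H => energy N p μ (ι u)) (innerSL ℝ (g u)) u) ∧
      (∀ u, g (-u) = -g u) ∧
      ∀ r, ∃ L, 0 ≤ L ∧ ∀ u v, ‖u‖ ≤ r → ‖v‖ ≤ r → ‖g u - g v‖ ≤ L * ‖u - v‖ := by
  obtain ⟨dE, h1, h2, h3⟩ := exists_energyDeriv hN hp hp' μ
  let g : H → H := fun u =>
    (InnerProductSpace.toDual ℝ H).symm ((dE (ι u)).comp ι.toContinuousLinearMap)
  have hg : ∀ u v : H, inner ℝ (g u) v = dE (ι u) (ι v) := fun u v =>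
    InnerProductSpace.toDual_symm_apply
  have hg' : ∀ u v : H, inner ℝ (g u) v = energyPairing N p μ (ι u) (ι v) := fun u v =>
    (hg u v).trans (h1 (ι u) (ι v))
  refine ⟨g, hg', fun u => ⟨(h2 (ι u)).differentiableAt, fun v => ?_⟩, fun u => ?_, fun u => ?_,
    fun r => ?_⟩
  · rw [(h2 (ι u)).fderiv, hg]
  · refine ((h2 (ι u)).comp u ι.toContinuousLinearMap.hasFDerivAt).congr_fderiv ?_
    ext v
    exact (hg u v).symm
  · refine ext_inner_right ℝ fun v => ?_
    rw [inner_neg_left, hg', hg', map_neg]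
    exact energyPairing_neg _ _
  · obtain ⟨L, hL, h⟩ := h3 r
    refine ⟨L, hL, fun u v hu hv => ?_⟩
    have h4 := h (ι u) (ι v) (by rwa [ι.norm_map]) (by rwa [ι.norm_map])
    rw [← map_sub, ι.norm_map] at h4
    have e : g u - g v = (InnerProductSpace.toDual ℝ H).symm
        ((dE (ι u) - dE (ι v)).comp ι.toContinuousLinearMap) := by
      refine ext_inner_right ℝ fun w => ?_
      rw [inner_sub_left, hg, hg, InnerProductSpace.toDual_symm_apply]
      rfl
    rw [e, LinearIsometryEquiv.norm_map]
    refine (ContinuousLinearMap.opNorm_comp_le _ _).trans ?_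
    calc ‖dE (ι u) - dE (ι v)‖ * ‖ι.toContinuousLinearMap‖ ≤ ‖dE (ι u) - dE (ι v)‖ * 1 := by
          gcongr
          exact ι.norm_toContinuousLinearMap_le
      _ ≤ L * ‖u - v‖ := by
          rw [mul_one]
          exact h4

/-- On the mass sphere the constraint defining `V_r(c)` becomes the norm ball `‖u‖ < √(r_*² + c)`,
the form required by `ConstrainedCrit.exists_seq_critical`. -/
lemma lap_grad_eq (ι : H →ₗᵢ[ℝ] H2 N) {u : H} (hu : ‖massMap ι u‖ ^ 2 = c) :
    ‖(ι u).lap‖ ^ 2 + ‖(ι u).grad‖ ^ 2 = ‖u‖ ^ 2 - c := by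
  have h := (ι u).norm_sq_eq
  rw [massMap_apply] at hu
  rw [hu] at h
  rw [← ι.norm_map, h]
  ring

/-- The energy is nonnegative for `r₀ < ρ ≤ r_*`, so a point of negative energy in the open ball
already lies in the smaller one. -/
lemma energy_shell (ι : H →ₗᵢ[ℝ] H2 N) (hN : 5 ≤ N) (hp : 2 < p) (hp' : p < 2 + 4 / (N : ℝ)) (hμ : 0 < μ)
    {r₀ : ℝ} (hc : 0 < c)
    (hshell : ∀ ρ, r₀ < ρ → ρ ≤ rStar N p μ →
        0 ≤ 1 / 2 * ρ ^ 2 - μ / p * gnConst N p ^ p * c ^ (p * (1 - gam N p) / 2)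
          * ρ ^ (p * gam N p)
          - 1 / (fourStar N * sobolevS N ^ (fourStar N / 2)) * ρ ^ fourStar N)
    {u : H} (hu : ‖massMap ι u‖ ^ 2 = c) (huR : ‖u‖ < √(rStar N p μ ^ 2 + c))
    (hE : energy N p μ (ι u) < 0) : ‖u‖ ≤ √(r₀ ^ 2 + c) := by
  have hr := (rStar_spec hN hp hp' hμ).2.1
  have h1 := lap_grad_eq ι hu
  set ρ := √(‖(ι u).lap‖ ^ 2 + ‖(ι u).grad‖ ^ 2) with hρ
  have hρ0 : 0 ≤ ρ := Real.sqrt_nonneg _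
  have hρ2 : ‖(ι u).lap‖ ^ 2 + ‖(ι u).grad‖ ^ 2 = ρ ^ 2 :=
    (Real.sq_sqrt (by positivity)).symm
  rw [Real.lt_sqrt (norm_nonneg u)] at huR
  have hlt : ρ ^ 2 < rStar N p μ ^ 2 := by rw [← hρ2, h1]; linarith
  have hle : ρ ≤ rStar N p μ := (abs_le_of_sq_le_sq' hlt.le hr.le).2
  by_contra hcon
  rw [not_le, Real.sqrt_lt' (lt_of_le_of_ne (norm_nonneg _) fun h => by
    rw [← h] at h1
    nlinarith [sq_nonneg ‖(ι u).lap‖, sq_nonneg ‖(ι u).grad‖])] at hcon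
  have h2 : r₀ < ρ := by
    refine lt_of_pow_lt_pow_left₀ 2 hρ0 ?_
    rw [← hρ2, h1]
    linarith
  have h3 := hshell ρ h2 hle
  have h4 := energy_ge hN hp hp' hμ (ι u) hρ0 hρ2
  rw [massMap_apply] at hu
  rw [hu] at h4
  linarith

/-- Weakly null bounded radial sequences tend to zero in `L^p`, while inside the ball the energy is
at least `-(μ/p)∫|u|^p`; it cannot stay below `b < 0`. -/
lemma radial_not_weakly_null [CompleteSpace H] (ι : H →ₗᵢ[ℝ] H2 N)
    (hι : ∀ u, ι u ∈ H2rad N) (hN : 5 ≤ N) (hp : 2 < p) (hp' : p < 2 + 4 / (N : ℝ)) (hμ : 0 < μ)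
    {R₀ : ℝ} (hR₀ : R₀ ^ 2 ≤ rStar N p μ ^ 2 + c) {b : ℝ} (hb : b < 0) (u : ℕ → H)
    (hu : ∀ n, ‖massMap ι (u n)‖ ^ 2 = c ∧ ‖u n‖ ≤ R₀ ∧ energy N p μ (ι (u n)) ≤ b) :
    ¬ ∀ v, Tendsto (fun n => inner ℝ (u n) v) atTop (𝓝 0) := by
  intro hw
  have hF : ((hyperfilter ℕ : Ultrafilter ℕ) : Filter ℕ) ≤ atTop := Nat.hyperfilter_le_atTop
  have hwf : ∀ f : L2Fun N, Tendsto (fun n => inner ℝ (ι (u n)).fn f)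
      (hyperfilter ℕ : Ultrafilter ℕ) (𝓝 0) := by
    intro f
    refine ((hw (ContinuousLinearMap.adjoint (massMap ι) f)).mono_left hF).congr fun n => ?_
    rw [ContinuousLinearMap.adjoint_inner_right]
    rfl
  have h1 := tendsto_powInt_of_weak hN hp (lt_fourStar hN hp') (hyperfilter ℕ)
    (u := fun n => ι (u n)) (fun n => hι (u n)) (B := R₀)
    (fun n => (ι.norm_map _).trans_le (hu n).2.1) hwf
  have h2 : ∀ n, -b ≤ μ / p * (ι (u n)).powInt p := by
    intro n
    obtain ⟨m1, m2, m3⟩ := hu n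
    have h3 := lap_grad_eq ι m1
    have h4 := energy_ge_neg_powInt hN hp hp' hμ (ι (u n)) (by
      rw [h3]
      have := pow_le_pow_left₀ (norm_nonneg _) m2 2
      linarith)
    linarith
  have h3 := ge_of_tendsto (h1.const_mul (μ / p)) (Eventually.of_forall h2)
  linarith

/-- Pairing the tangential gradient with `u_n` itself gives `l_n c = I'(u_n)u_n + o(1) ≤ 2I(u_n) +
o(1)`, whose right side tends to `2b`. The multipliers are therefore bounded and eventually at most
`b / c < 0`, as `tendsto_zero_of_almost_critical` requires. Working along an ultrafilter avoids
extracting subsequences. -/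
lemma radial_palaisSmale [CompleteSpace H] (ι : H →ₗᵢ[ℝ] H2 N)
    (hι : ∀ u, ι u ∈ H2rad N) (hN : 5 ≤ N) (hp : 2 < p) (hp' : p < 2 + 4 / (N : ℝ)) (hμ : 0 < μ)
    (hc : 0 < c) {R₀ : ℝ} (hR₀ : R₀ ^ 2 ≤ rStar N p μ ^ 2 + c) {g : H → H}
    (hg : ∀ u v, inner ℝ (g u) v = energyPairing N p μ (ι u) (ι v)) (hg_neg : ∀ u, g (-u) = -g u)
    (hLip : ∀ r, ∃ L, 0 ≤ L ∧ ∀ u v, ‖u‖ ≤ r → ‖v‖ ≤ r → ‖g u - g v‖ ≤ L * ‖u - v‖)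
    {b : ℝ} (hb : b < 0) (u : ℕ → H)
    (hu : ∀ n, ‖massMap ι (u n)‖ ^ 2 = c ∧ ‖u n‖ ≤ R₀ ∧ energy N p μ (ι (u n)) < 0)
    (hE : Tendsto (fun n => energy N p μ (ι (u n))) atTop (𝓝 b))
    (hG : Tendsto (fun n => ConstrainedCrit.tgrad (massMap ι) g (u n)) atTop (𝓝 0)) :
    ∃ f : Filter ℕ, f.NeBot ∧ f ≤ atTop ∧ ∃ v, Tendsto u f (𝓝 v) := by
  have hF : ((hyperfilter ℕ : Ultrafilter ℕ) : Filter ℕ) ≤ atTop := Nat.hyperfilter_le_atTop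
  refine ⟨(hyperfilter ℕ : Ultrafilter ℕ), inferInstance, hF, ?_⟩
  have hB : ∀ n, ‖u n‖ ≤ R₀ := fun n => (hu n).2.1
  have hR0 : 0 ≤ R₀ := (norm_nonneg _).trans (hB 0)
  obtain ⟨v, hv⟩ := exists_weak_limit (hyperfilter ℕ) hB
  set l : ℕ → ℝ := fun n => ConstrainedCrit.multiplier (massMap ι) g (u n) with hl
  have hpair : ∀ n w, inner ℝ (ConstrainedCrit.tgrad (massMap ι) g (u n)) w
      = inner ℝ (g (u n)) w - l n * inner ℝ (massMap ι (u n)) (massMap ι w) := by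
    intro n w
    rw [ConstrainedCrit.tgrad, inner_sub_left, real_inner_smul_left,
      ConstrainedCrit.inner_massGrad]
  have hsmall : ∀ w : ℕ → H, (∃ B, ∀ n, ‖w n‖ ≤ B) →
      Tendsto (fun n => inner ℝ (ConstrainedCrit.tgrad (massMap ι) g (u n)) (w n)) atTop (𝓝 0) := by
    rintro w ⟨B, hw⟩
    have h : Tendsto (fun n => ‖ConstrainedCrit.tgrad (massMap ι) g (u n)‖ * B) atTop (𝓝 0) := by
      simpa using hG.norm.mul_const B
    refine squeeze_zero_norm (fun n => ?_) h
    exact (norm_inner_le_norm _ _).trans (by gcongr; exact hw n)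
  have hself : ∀ n, inner ℝ (ConstrainedCrit.tgrad (massMap ι) g (u n)) (u n)
      = inner ℝ (g (u n)) (u n) - l n * c := by
    intro n
    rw [hpair, real_inner_self_eq_norm_sq, (hu n).1]
  have hs := hsmall u ⟨R₀, hB⟩
  have hlneg : ∀ᶠ n in atTop, l n ≤ -(-b / c) := by
    have h1 : Tendsto (fun n => 2 * energy N p μ (ι (u n))
        - inner ℝ (ConstrainedCrit.tgrad (massMap ι) g (u n)) (u n)) atTop (𝓝 (2 * b)) := by
      simpa using (hE.const_mul 2).sub hs
    -- The limit `2b` is strictly below `b`, which leaves room for the error term.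
    filter_upwards [(tendsto_order.1 h1).2 b (by linarith)] with n hn
    have h2 := hself n
    rw [hg] at h2
    have h3 := energyPairing_self_le hN hp hμ (ι (u n))
    rw [neg_div, neg_neg, le_div_iff₀ hc]
    linarith
  obtain ⟨L, hL0, hL⟩ := hLip R₀
  have hg0 : g 0 = 0 := by
    have h := hg_neg 0
    rw [neg_zero, eq_neg_iff_add_eq_zero, ← two_smul ℝ] at h
    exact (smul_eq_zero.1 h).resolve_left two_ne_zero
  have hlbd : ∀ᶠ n in atTop, |l n| ≤ (L * R₀ * R₀ + 1) / c := by
    filter_upwards [Metric.tendsto_nhds.1 hs 1 one_pos] with n hn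
    rw [dist_zero_right, Real.norm_eq_abs, hself] at hn
    have h1 : ‖g (u n)‖ ≤ L * R₀ := by
      have := hL (u n) 0 (hB n) (by simpa using hR0)
      rw [hg0, sub_zero, sub_zero] at this
      exact this.trans (by gcongr; exact hB n)
    have h2 : |inner ℝ (g (u n)) (u n)| ≤ L * R₀ * R₀ :=
      (abs_real_inner_le_norm _ _).trans (mul_le_mul h1 (hB n) (norm_nonneg _) (by positivity))
    rw [le_div_iff₀ hc, ← abs_of_pos hc, ← abs_mul]
    have h3 := abs_sub_abs_le_abs_sub (l n * c) (inner ℝ (g (u n)) (u n))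
    rw [abs_sub_comm] at h3
    linarith
  have hcore := tendsto_zero_of_almost_critical hN hp hp' hμ (hyperfilter ℕ)
    (u := fun n => ι (u n)) (v := ι v) (B := R₀) (fun n => (ι.norm_map _).trans_le (hB n))
    (fun n => (map_sub ι (u n) v) ▸ hι (u n - v))
    (fun n => by
      rw [lap_grad_eq ι (hu n).1]
      have := pow_le_pow_left₀ (norm_nonneg _) (hB n) 2
      linarith)
    (fun L => (hv (L.comp ι.toContinuousLinearMap)).congr fun n => congrArg L (map_sub ι (u n) v)) (div_pos (neg_pos.2 hb) hc) (hF hlneg) (hF hlbd) (by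
      refine ((hsmall (fun n => u n - v) ⟨R₀ + ‖v‖, fun n =>
        (norm_sub_le _ _).trans (by gcongr; exact hB n)⟩).mono_left hF).congr fun n => ?_
      rw [hpair, hg, massMap_apply, massMap_apply, map_sub]
      rfl)
  refine ⟨v, ?_⟩
  rw [tendsto_iff_norm_sub_tendsto_zero]
  refine (tendsto_zero_iff_norm_tendsto_zero.1 hcore).congr fun n => ?_
  rw [← map_sub, ι.norm_map]

end RadialProblem

end

noncomputable section

/-! ### Dilations -/

section Dilation

variable {N : ℕ}

lemma norm_toLp_sq {E : Type*} [NormedAddCommGroup E] [InnerProductSpace ℝ E] {f : RN N → E}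
    (hf : MemLp f 2 volume) : ‖hf.toLp f‖ ^ 2 = ∫ x, ‖f x‖ ^ 2 := by
  rw [← real_inner_self_eq_norm_sq, L2.inner_def]
  refine integral_congr_ae ?_
  filter_upwards [hf.coeFn_toLp] with x hx
  rw [hx, real_inner_self_eq_norm_sq]

lemma integral_comp_dilation (f : RN N → ℝ) {t : ℝ} (ht : 0 < t) :
    ∫ x, f (t • x) = (t ^ N)⁻¹ * ∫ x, f x := by
  rw [Measure.integral_comp_smul_of_nonneg volume f t (hR := ht.le), finrank_euclideanSpace_fin,
    smul_eq_mul]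

lemma ofTest_dilation {φ : RN N → ℝ} (h : IsTest φ) {t : ℝ} (ht : 0 < t) :
    ‖(ofTest (h.comp_smul ht.ne')).fn‖ ^ 2 = (t ^ N)⁻¹ * ‖(ofTest h).fn‖ ^ 2 ∧
      ‖(ofTest (h.comp_smul ht.ne')).grad‖ ^ 2 = t ^ 2 * ((t ^ N)⁻¹ * ‖(ofTest h).grad‖ ^ 2) ∧
      ‖(ofTest (h.comp_smul ht.ne')).lap‖ ^ 2 = t ^ 4 * ((t ^ N)⁻¹ * ‖(ofTest h).lap‖ ^ 2) ∧
      ∀ q, (ofTest (h.comp_smul ht.ne')).powInt q = (t ^ N)⁻¹ * (ofTest h).powInt q := by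
  refine ⟨?_, ?_, ?_, fun q => ?_⟩
  · rw [ofTest_fn, ofTest_fn, norm_toLp_sq, norm_toLp_sq,
      ← integral_comp_dilation (fun x => ‖φ x‖ ^ 2) ht]
  · rw [ofTest_grad, ofTest_grad, norm_toLp_sq, norm_toLp_sq,
      ← integral_comp_dilation (fun x => ‖gradient φ x‖ ^ 2) ht, ← integral_const_mul]
    refine integral_congr_ae (Eventually.of_forall fun x => ?_)
    simp only [gradient_comp_smul, norm_smul, Real.norm_eq_abs, mul_pow, sq_abs]
  · rw [ofTest_lap, ofTest_lap, norm_toLp_sq, norm_toLp_sq,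
      ← integral_comp_dilation (fun x => ‖Laplacian.laplacian φ x‖ ^ 2) ht, ← integral_const_mul]
    refine integral_congr_ae (Eventually.of_forall fun x => ?_)
    simp only [laplacian_comp_smul h.1, norm_mul, norm_pow, Real.norm_eq_abs, mul_pow, sq_abs]
    ring
  · have e : ∀ {ψ : RN N → ℝ} (hψ : IsTest ψ), (ofTest hψ).powInt q = ∫ x, |ψ x| ^ q := by
      intro ψ hψ
      refine integral_congr_ae ?_
      filter_upwards [ofTest_coeFn hψ] with x hx
      rw [hx]
    rw [e, e, ← integral_comp_dilation (fun x => |φ x| ^ q) ht]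

lemma fn_injective : Function.Injective (H2.fn (N := N)) := by
  intro u v h
  rw [← sub_eq_zero]
  refine H2.eq_zero_of_fn_eq_zero ?_
  exact (map_sub H2.fnL u v).trans (sub_eq_zero.2 h)

lemma ofTest_sum {n : ℕ} {φ : Fin n → RN N → ℝ} (h : ∀ i, IsTest (φ i)) (x : Fin n → ℝ)
    {ψ : RN N → ℝ} (hψ : IsTest ψ) (e : ∀ y, ψ y = ∑ i, x i * φ i y) :
    ∑ i, x i • ofTest (h i) = ofTest hψ := by
  refine fn_injective ?_
  have e1 : (∑ i, x i • ofTest (h i)).fn = ∑ i, x i • (ofTest (h i)).fn := by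
    refine (map_sum H2.fnL (fun i => x i • ofTest (h i)) Finset.univ).trans ?_
    exact Finset.sum_congr rfl fun i _ => map_smul H2.fnL _ _
  rw [e1, ofTest_fn]
  refine Lp.ext ?_
  have h1 := Lp.coeFn_finsetSum Finset.univ fun i => x i • (ofTest (h i)).fn
  have h2 : ∀ᵐ y, ∀ i, (x i • (ofTest (h i)).fn) y = x i * φ i y := ae_all_iff.2 fun i => by
    filter_upwards [Lp.coeFn_smul (x i) (ofTest (h i)).fn, ofTest_coeFn (h i)] with y h3 h4
    rw [h3, Pi.smul_apply, h4, smul_eq_mul]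
  filter_upwards [h1, h2, (hψ.memLp 2).coeFn_toLp] with y h3 h4 h5
  rw [h3, h5, e y]
  simp only [Finset.sum_apply, h4]

/-- Linearly independent radial test functions. -/
lemma exists_radial_family (hN : 5 ≤ N) (n : ℕ) : ∃ φ : Fin n → RN N → ℝ, (∀ i, IsTest (φ i)) ∧
    (∀ i, ∃ f : ℝ → ℝ, Continuous f ∧ ∀ y, φ i y = f ‖y‖) ∧
    ∀ x : Fin n → ℝ, (∀ y, ∑ i, x i * φ i y = 0) → x = 0 := by
  -- Bumps in the variable `‖y‖²`, which is smooth at the origin, centred at `i + 1` with radius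
  -- `1/2`. At a point with `‖y‖² = j + 1` only the `j`-th bump survives, and it equals `1`; this
  -- gives independence.
  let b : ∀ i : Fin n, ContDiffBump ((i : ℝ) + 1) := fun i => ⟨1 / 4, 1 / 2, by norm_num, by norm_num⟩
  refine ⟨fun i y => b i (‖y‖ ^ 2), fun i => ⟨?_, ?_⟩, fun i => ⟨fun r => b i (r ^ 2), ?_, fun y => rfl⟩,
    fun x hx => ?_⟩
  · exact (b i).contDiff.comp (contDiff_norm_sq ℝ)
  · refine HasCompactSupport.of_support_subset_isCompact
      (isCompact_closedBall (0 : RN N) ((i : ℝ) + 2)) fun y hy => ?_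
    have h1 : ‖y‖ ^ 2 ∈ Function.support (b i) := hy
    rw [(b i).support_eq, Metric.mem_ball, Real.dist_eq] at h1
    have h2 := (abs_lt.1 h1).2
    change ‖y‖ ^ 2 - ((i : ℝ) + 1) < 1 / 2 at h2
    rw [mem_closedBall_zero_iff]
    have : (0 : ℝ) ≤ i := Nat.cast_nonneg _
    nlinarith [norm_nonneg y]
  · exact (b i).continuous.comp (continuous_pow 2)
  · funext j
    have hz : ∃ y : RN N, ‖y‖ ^ 2 = (j : ℝ) + 1 := by
      refine ⟨√((j : ℝ) + 1) • EuclideanSpace.single ⟨0, by omega⟩ 1, ?_⟩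
      rw [norm_smul, mul_pow, Real.norm_eq_abs, sq_abs, Real.sq_sqrt (by positivity)]
      simp
    obtain ⟨y, hy⟩ := hz
    have h1 : ∑ i, x i * b i (‖y‖ ^ 2) = 0 := hx y
    rw [Finset.sum_eq_single j] at h1
    · rw [hy, (b j).one_of_mem_closedBall (Metric.mem_closedBall_self (b j).rIn_pos.le),
        mul_one] at h1
      exact h1
    · intro i _ hij
      rw [hy, (b i).zero_of_le_dist, mul_zero]
      rw [Real.dist_eq, add_sub_add_right_eq_sub]
      change (1 / 2 : ℝ) ≤ _
      have : (1 : ℝ) ≤ |(j : ℝ) - i| := by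
        have h2 : (1 : ℤ) ≤ |(j : ℤ) - i| :=
          Int.one_le_abs (sub_ne_zero.2 fun h => hij (Fin.ext (by exact_mod_cast h.symm)))
        exact_mod_cast h2
      linarith
    · exact fun h => absurd (Finset.mem_univ j) h

/-- A finite-dimensional space of radial functions together with its dilations. -/
lemma exists_dilated_family (hN : 5 ≤ N) (n : ℕ) :
    ∃ L : EuclideanSpace ℝ (Fin n) →ₗ[ℝ] H2 N, (∀ x, x ≠ 0 → L x ≠ 0) ∧
      ∀ t : ℝ, 0 < t → ∃ M : EuclideanSpace ℝ (Fin n) →ₗ[ℝ] H2 N, ∀ x, M x ∈ H2rad N ∧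
        ‖(M x).fn‖ ^ 2 = (t ^ N)⁻¹ * ‖(L x).fn‖ ^ 2 ∧
        ‖(M x).grad‖ ^ 2 = t ^ 2 * ((t ^ N)⁻¹ * ‖(L x).grad‖ ^ 2) ∧
        ‖(M x).lap‖ ^ 2 = t ^ 4 * ((t ^ N)⁻¹ * ‖(L x).lap‖ ^ 2) ∧
        ∀ q, (M x).powInt q = (t ^ N)⁻¹ * (L x).powInt q := by
  obtain ⟨φ, hφ, hrad, hind⟩ := exists_radial_family hN n
  let mk : (Fin n → H2 N) → EuclideanSpace ℝ (Fin n) →ₗ[ℝ] H2 N := fun e =>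
    { toFun := fun x => ∑ i, x i • e i
      map_add' := fun x y => by simp [add_smul, Finset.sum_add_distrib]
      map_smul' := fun a x => by simp [mul_smul, Finset.smul_sum] }
  have hmk : ∀ e x, mk e x = ∑ i, x i • e i := fun e x => rfl
  have hψ : ∀ x : EuclideanSpace ℝ (Fin n), IsTest fun y => ∑ i, x i * φ i y := fun x =>
    IsTest.sum Finset.univ fun i _ => (hφ i).const_mul (x i)
  have hL : ∀ x, mk (fun i => ofTest (hφ i)) x = ofTest (hψ x) := fun x =>
    ofTest_sum hφ x (hψ x) fun y => rfl
  refine ⟨mk fun i => ofTest (hφ i), fun x hx h0 => hx ?_, fun t ht =>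
    ⟨mk fun i => ofTest ((hφ i).comp_smul ht.ne'), fun x => ⟨?_, ?_⟩⟩⟩
  · rw [hL] at h0
    have h1 : (ofTest (hψ x)).fn = 0 := by rw [h0]; rfl
    have h2 : (fun y => ∑ i, x i * φ i y) =ᵐ[volume] fun _ => (0 : ℝ) :=
      (ofTest_coeFn (hψ x)).symm.trans ((Lp.eq_zero_iff_ae_eq_zero).1 h1)
    have h3 := (hψ x).continuous.ae_eq_iff_eq volume continuous_const |>.1 h2
    have h4 := hind x fun y => congrFun h3 y
    ext i
    exact congrFun h4 i
  · rw [hmk]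
    refine Submodule.sum_mem _ fun i _ => Submodule.smul_mem _ _ ?_
    obtain ⟨f, hf, hfy⟩ := hrad i
    refine ⟨fun r => f (t * r), (hf.comp (continuous_const.mul continuous_id)).measurable, ?_⟩
    filter_upwards [ofTest_coeFn ((hφ i).comp_smul ht.ne')] with y hy
    rw [hy, hfy, norm_smul, Real.norm_of_nonneg ht.le]
  · have hM : mk (fun i => ofTest ((hφ i).comp_smul ht.ne')) x
        = ofTest ((hψ x).comp_smul ht.ne') :=
      ofTest_sum (fun i => (hφ i).comp_smul ht.ne') x _ fun y => rfl
    rw [hM, hL]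
    exact ofTest_dilation (hψ x) ht

end Dilation

end

noncomputable section

/-! ### Spheres of negative energy -/

section Spheres

variable {N : ℕ} {p μ c : ℝ}

lemma powInt_smul (q a : ℝ) (u : H2 N) : (a • u).powInt q = |a| ^ q * u.powInt q := by
  unfold H2.powInt
  rw [← integral_const_mul]
  refine integral_congr_ae ?_
  filter_upwards [u.coeFn_smul a] with x hx
  rw [hx, abs_mul, Real.mul_rpow (abs_nonneg _) (abs_nonneg _)]

/-- `t² = o(t^β)` as `t → 0⁺` because `β < 2`. Here `t²` bounds the quadratic energy and `t^β`
measures the subcritical term of a dilated function. -/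
lemma exists_pos_smallness {A P r e β : ℝ} (hr : 0 < r) (hP : 0 < P) (hβ : β < 2) :
    ∃ t : ℝ, 0 < t ∧ t ≤ 1 ∧ t ^ 2 * A < r ^ 2 ∧ e * (t ^ 2 * A) < P * t ^ β := by
  have h1 : Tendsto (fun t : ℝ => t ^ 2 * A) (𝓝[>] 0) (𝓝 0) := by
    have : ContinuousAt (fun t : ℝ => t ^ 2 * A) 0 := by fun_prop
    simpa using this.tendsto.mono_left nhdsWithin_le_nhds
  have h2 : Tendsto (fun t : ℝ => e * A * t ^ (2 - β)) (𝓝[>] 0) (𝓝 0) := by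
    have : ContinuousAt (fun t : ℝ => e * A * t ^ (2 - β)) 0 :=
      continuousAt_const.mul (Real.continuousAt_rpow_const _ _ (Or.inr (by linarith)))
    have := this.tendsto.mono_left (nhdsWithin_le_nhds (s := Set.Ioi (0 : ℝ)))
    rwa [Real.zero_rpow (by linarith), mul_zero] at this
  have h3 : ∀ᶠ t : ℝ in 𝓝[>] 0, t ≤ 1 :=
    (eventually_le_nhds one_pos).filter_mono nhdsWithin_le_nhds
  obtain ⟨t, ⟨⟨ht1, ht2⟩, ht3⟩, ht0⟩ := (((((tendsto_order.1 h1).2 (r ^ 2) (by positivity)).and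
    ((tendsto_order.1 h2).2 P hP)).and h3).and self_mem_nhdsWithin).exists
  have ht0 : 0 < t := ht0
  refine ⟨t, ht0, ht3, ht1, ?_⟩
  have e1 : t ^ 2 = t ^ (2 - β) * t ^ β := by
    rw [← Real.rpow_add ht0, sub_add_cancel, Real.rpow_two]
  calc e * (t ^ 2 * A) = e * A * t ^ (2 - β) * t ^ β := by rw [e1]; ring
    _ < P * t ^ β := mul_lt_mul_of_pos_right ht2 (Real.rpow_pos_of_pos ht0 _)

/-- Normalisation of a dilated function `v = u(t ·)`. -/
lemma normalized_dilation {u v : H2 N} (hc : 0 < c) {t : ℝ} (ht0 : 0 < t)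
    (ht1 : t ≤ 1) (hf : 0 < ‖u.fn‖ ^ 2) (m2 : ‖v.fn‖ ^ 2 = (t ^ N)⁻¹ * ‖u.fn‖ ^ 2)
    (m3 : ‖v.grad‖ ^ 2 = t ^ 2 * ((t ^ N)⁻¹ * ‖u.grad‖ ^ 2))
    (m4 : ‖v.lap‖ ^ 2 = t ^ 4 * ((t ^ N)⁻¹ * ‖u.lap‖ ^ 2))
    (m5 : v.powInt p = (t ^ N)⁻¹ * u.powInt p) {a : ℝ} (ha0 : 0 < a)
    (ha2 : a ^ 2 * ‖v.fn‖ ^ 2 = c) :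
    ‖(a • v).fn‖ ^ 2 = c ∧
    ‖(a • v).lap‖ ^ 2 + ‖(a • v).grad‖ ^ 2
      ≤ t ^ 2 * (c * ((‖u.lap‖ ^ 2 + ‖u.grad‖ ^ 2) / ‖u.fn‖ ^ 2)) ∧
    (a • v).powInt p
      = c ^ (p / 2) * (u.powInt p / (‖u.fn‖ ^ 2) ^ (p / 2)) * t ^ ((N : ℝ) * (p / 2 - 1)) := by
  have e1 : ‖(a • v).fn‖ ^ 2 = a ^ 2 * ‖v.fn‖ ^ 2 := by
    have : (a • v).fn = a • v.fn := rfl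
    rw [this, norm_smul, mul_pow, Real.norm_eq_abs, sq_abs]
  have e2 : ‖(a • v).grad‖ ^ 2 = a ^ 2 * ‖v.grad‖ ^ 2 := by
    have : (a • v).grad = a • v.grad := rfl
    rw [this, norm_smul, mul_pow, Real.norm_eq_abs, sq_abs]
  have e3 : ‖(a • v).lap‖ ^ 2 = a ^ 2 * ‖v.lap‖ ^ 2 := by
    have : (a • v).lap = a • v.lap := rfl
    rw [this, norm_smul, mul_pow, Real.norm_eq_abs, sq_abs]
  refine ⟨e1.trans ha2, ?_, ?_⟩
  · rw [e2, e3, m3, m4]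
    rw [m2] at ha2
    generalize ‖u.fn‖ ^ 2 = f at *
    have hG : 0 ≤ ‖u.grad‖ ^ 2 := sq_nonneg _
    have hΛ : 0 ≤ ‖u.lap‖ ^ 2 := sq_nonneg _
    generalize ‖u.grad‖ ^ 2 = G at *
    generalize ‖u.lap‖ ^ 2 = Λ at *
    have hT : (0 : ℝ) < (t ^ N)⁻¹ := by positivity
    generalize (t ^ N)⁻¹ = T at *
    have h3 : t ^ 4 ≤ t ^ 2 := pow_le_pow_of_le_one ht0.le ht1 (by norm_num)
    have h4 : t ^ 4 * (a ^ 2 * (T * Λ)) ≤ t ^ 2 * (a ^ 2 * (T * Λ)) := by gcongr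
    have h5 : c * ((Λ + G) / f) = a ^ 2 * (T * Λ) + a ^ 2 * (T * G) := by
      rw [← ha2]
      field_simp
    rw [h5]
    linarith
  · rw [powInt_smul, m5, abs_of_pos ha0]
    have ha3 : a ^ 2 = c / ((t ^ N)⁻¹ * ‖u.fn‖ ^ 2) := by
      rw [← ha2, m2, mul_div_cancel_right₀ _ (mul_pos (by positivity) hf).ne']
    have h2 : a ^ p = (a ^ 2) ^ (p / 2) := by
      rw [← Real.rpow_two, ← Real.rpow_mul ha0.le]
      congr 1
      ring
    have h3 : ((t ^ N)⁻¹) ^ (p / 2) * t ^ ((N : ℝ) * (p / 2 - 1)) = (t ^ N)⁻¹ := by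
      rw [← Real.rpow_natCast, ← Real.rpow_neg ht0.le, ← Real.rpow_mul ht0.le,
        ← Real.rpow_add ht0]
      congr 1
      ring
    have h4 : (0 : ℝ) < (t ^ N)⁻¹ := by positivity
    have h5 := Real.rpow_pos_of_pos h4 (p / 2)
    have h6 := Real.rpow_pos_of_pos hf (p / 2)
    rw [h2, ha3, Real.div_rpow hc.le (by positivity), Real.mul_rpow h4.le hf.le]
    generalize ((t ^ N)⁻¹) ^ (p / 2) = X at *
    generalize t ^ ((N : ℝ) * (p / 2 - 1)) = Y at *
    rw [← h3]
    generalize (‖u.fn‖ ^ 2) ^ (p / 2) = Z at *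
    field_simp

/-- The unit sphere of a space of radial functions is spread out by a dilation with small `t` and
rescaled to mass `c`. The subcritical term then exceeds the quadratic part and the critical term
only helps. -/
theorem exists_radial_sphere (hN : 5 ≤ N) (hp : 2 < p) (hp' : p < 2 + 4 / (N : ℝ)) (hμ : 0 < μ)
    (hc : 0 < c) {r : ℝ} (hr : 0 < r) (k : ℕ) :
    ∃ h : EuclideanSpace ℝ (Fin (k + 1)) → H2 N, ContinuousOn h (Metric.sphere 0 1) ∧
      ∀ x ∈ Metric.sphere 0 1, h (-x) = -h x ∧ h x ∈ H2rad N ∧ ‖(h x).fn‖ ^ 2 = c ∧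
        ‖(h x).lap‖ ^ 2 + ‖(h x).grad‖ ^ 2 < r ^ 2 ∧ energy N p μ (h x) < 0 := by
  obtain ⟨L, hL0, hL⟩ := exists_dilated_family hN (k + 1)
  have hLc : Continuous L := L.continuous_of_finiteDimensional
  have hp4 := (lt_fourStar hN hp').le
  have hp0 : 0 < p := by linarith
  obtain ⟨G, _, hG, _⟩ := H2.exists_powDual hN hp hp4
  have hpc : Continuous (H2.powInt (N := N) p) :=
    continuous_iff_continuousAt.2 fun u => (hG u).continuousAt
  have hfc : Continuous fun x => ‖(L x).fn‖ ^ 2 := (H2.fnL.continuous.comp hLc).norm.pow 2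
  have hgc : Continuous fun x => ‖(L x).grad‖ ^ 2 := (H2.gradL.continuous.comp hLc).norm.pow 2
  have hlc : Continuous fun x => ‖(L x).lap‖ ^ 2 := (H2.lapL.continuous.comp hLc).norm.pow 2
  have hne : ∀ x ∈ Metric.sphere (0 : EuclideanSpace ℝ (Fin (k + 1))) 1, L x ≠ 0 := by
    intro x hx
    refine hL0 x fun h => ?_
    rw [h] at hx
    simp at hx
  have hf0 : ∀ x ∈ Metric.sphere (0 : EuclideanSpace ℝ (Fin (k + 1))) 1, 0 < ‖(L x).fn‖ ^ 2 := by
    intro x hx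
    have : (L x).fn ≠ 0 := fun h => hne x hx (H2.eq_zero_of_fn_eq_zero h)
    positivity
  have hcomp := isCompact_sphere (0 : EuclideanSpace ℝ (Fin (k + 1))) 1
  have hsne : (Metric.sphere (0 : EuclideanSpace ℝ (Fin (k + 1))) 1).Nonempty :=
    NormedSpace.sphere_nonempty.2 zero_le_one
  -- By compactness the normalised quadratic part has a maximum `A` and the normalised `L^p` term a
  -- positive minimum `P`, so one `t` serves the whole sphere.
  obtain ⟨x₁, hx₁, hmax⟩ := hcomp.exists_isMaxOn hsne
    (f := fun x => (‖(L x).lap‖ ^ 2 + ‖(L x).grad‖ ^ 2) / ‖(L x).fn‖ ^ 2)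
    ((hlc.add hgc).continuousOn.div hfc.continuousOn fun x hx => (hf0 x hx).ne')
  obtain ⟨x₂, hx₂, hmin⟩ := hcomp.exists_isMinOn hsne
    (f := fun x => (L x).powInt p / (‖(L x).fn‖ ^ 2) ^ (p / 2))
    ((hpc.comp hLc).continuousOn.div
      (hfc.continuousOn.rpow_const fun x hx => Or.inl (hf0 x hx).ne')
      fun x hx => (Real.rpow_pos_of_pos (hf0 x hx) _).ne')
  set A := (‖(L x₁).lap‖ ^ 2 + ‖(L x₁).grad‖ ^ 2) / ‖(L x₁).fn‖ ^ 2 with hA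
  set P := (L x₂).powInt p / (‖(L x₂).fn‖ ^ 2) ^ (p / 2) with hP
  have hP0 : 0 < P := div_pos (H2.powInt_pos hN hp.le hp4 (hne x₂ hx₂))
    (Real.rpow_pos_of_pos (hf0 x₂ hx₂) _)
  set β := (N : ℝ) * (p / 2 - 1) with hβ
  -- `β = N(p-2)/2 = 2pγ_p`, so this is the condition `p < 2 + 4/N`. The exponent `2` to beat comes
  -- from the gradient term, since under dilation the Laplacian term is of the smaller order `t⁴`.
  have hβ2 : β < 2 := by
    have := mul_gam_lt_one hN hp hp'
    rw [mul_gam hp] at this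
    rw [hβ]
    linarith
  obtain ⟨t, ht0, ht1, ht2, ht3⟩ := exists_pos_smallness (A := c * A)
    (P := μ / p * (c ^ (p / 2) * P)) (e := 1 / 2) hr (by positivity) hβ2
  obtain ⟨M, hM⟩ := hL t ht0
  have hMc : Continuous M := M.continuous_of_finiteDimensional
  have hMf : ∀ x ∈ Metric.sphere (0 : EuclideanSpace ℝ (Fin (k + 1))) 1, 0 < ‖(M x).fn‖ := by
    intro x hx
    have h1 := (hM x).2.1
    have h2 := hf0 x hx
    have h3 : 0 < ‖(M x).fn‖ ^ 2 := by rw [h1]; positivity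
    exact norm_pos_iff.2 fun h => by simp [h] at h3
  refine ⟨fun x => (√c / ‖(M x).fn‖) • M x, ?_, fun x hx => ?_⟩
  · refine ContinuousOn.smul (continuousOn_const.div
      (H2.fnL.continuous.comp hMc).norm.continuousOn fun x hx => (hMf x hx).ne') hMc.continuousOn
  obtain ⟨m1, m2, m3, m4, m5⟩ := hM x
  obtain ⟨n1, n2, n3⟩ := normalized_dilation hc ht0 ht1 (hf0 x hx) m2 m3 m4 (m5 p)
    (a := √c / ‖(M x).fn‖) (div_pos (Real.sqrt_pos.2 hc) (hMf x hx)) (by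
      have := (hMf x hx).ne'
      rw [div_pow, Real.sq_sqrt hc.le]
      field_simp)
  have h3 : (‖(L x).lap‖ ^ 2 + ‖(L x).grad‖ ^ 2) / ‖(L x).fn‖ ^ 2 ≤ A := hmax hx
  have h4 : P ≤ (L x).powInt p / (‖(L x).fn‖ ^ 2) ^ (p / 2) := hmin hx
  have e4 : ‖(M (-x)).fn‖ = ‖(M x).fn‖ := by
    have : (M (-x)).fn = -(M x).fn := by rw [map_neg]; rfl
    rw [this, norm_neg]
  have hodd : (√c / ‖(M (-x)).fn‖) • M (-x) = -((√c / ‖(M x).fn‖) • M x) := by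
    rw [e4, map_neg, smul_neg]
  refine ⟨hodd, Submodule.smul_mem _ _ m1, n1, ?_, ?_⟩
  all_goals beta_reduce
  all_goals clear hodd e4
  all_goals generalize (√c / ‖(M x).fn‖) • M x = w at *
  · refine n2.trans_lt (lt_of_le_of_lt ?_ ht2)
    gcongr
  · have hquad : ‖w.lap‖ ^ 2 + ‖w.grad‖ ^ 2 ≤ t ^ 2 * (c * A) := n2.trans (by gcongr)
    have hpow : c ^ (p / 2) * P * t ^ β ≤ w.powInt p := by
      rw [n3]
      gcongr
    have h2 : 0 ≤ 1 / fourStar N * w.powInt (fourStar N) :=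
      mul_nonneg (one_div_pos.2 (fourStar_pos hN)).le (w.powInt_nonneg _)
    have h3 := mul_le_mul_of_nonneg_left hpow (by positivity : 0 ≤ μ / p)
    unfold energy
    linarith

end Spheres

/-! ### The main result -/

/-- Normalised radial critical points of negative energy, with energies strictly increasing to
zero. -/
theorem exists_normalized_critical_points (N : ℕ) (hN : 5 ≤ N) (p : ℝ) (hp : 2 < p)
    (hp' : p < 2 + 4 / (N : ℝ)) (μ c : ℝ) (hμ : 0 < μ) (hc : 0 < c) (hcs : c < cStar N p μ) :
    ∃ (u : ℕ → H2 N) (l : ℕ → ℝ),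
      (∀ j, IsCriticalPoint N p μ c (u j) ∧ IsLagrangeMultiplier N p μ (u j) (l j) ∧
        energy N p μ (u j) < 0 ∧ ‖(u j).fn‖ ^ 2 = c ∧ l j < 0) ∧
      StrictMono (fun j => energy N p μ (u j)) ∧
      Tendsto (fun j => energy N p μ (u j)) atTop (𝓝 0) := by
  obtain ⟨H, _, _, _, _, ι, hι⟩ := @exists_isometry_range_eq (H2 N) _ _ _ _ (H2rad N) (isClosed_H2rad N)
  have hmem : ∀ u, ι u ∈ H2rad N := fun u => by
    have : ι u ∈ Set.range ι := ⟨u, rfl⟩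
    rwa [hι] at this
  have hsurj : ∀ v ∈ H2rad N, ∃ u, ι u = v := fun v hv => by
    have : v ∈ Set.range ι := by rwa [hι]
    exact this
  obtain ⟨g, hg, hgd, hgE, hg_neg, hLip⟩ := exists_radialGrad ι hN hp hp' μ
  obtain ⟨r₀, hr₀, hr₀r, hshell⟩ := exists_shell hN hp hp' hμ hc hcs
  have hr := (rStar_spec hN hp hp' hμ).2.1
  have hR : √(r₀ ^ 2 + c) < √(rStar N p μ ^ 2 + c) :=
    Real.sqrt_lt_sqrt (by positivity) (by gcongr)
  have hR₀ : √(r₀ ^ 2 + c) ^ 2 ≤ rStar N p μ ^ 2 + c := by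
    rw [Real.sq_sqrt (by positivity)]
    gcongr
  have hlt : ∀ u : H, ‖massMap ι u‖ ^ 2 = c →
      (‖u‖ < √(rStar N p μ ^ 2 + c) ↔
        ‖(ι u).lap‖ ^ 2 + ‖(ι u).grad‖ ^ 2 < rStar N p μ ^ 2) := fun u hu => by
    rw [lap_grad_eq ι hu, Real.lt_sqrt (norm_nonneg u), sub_lt_iff_lt_add]
  obtain ⟨u, hu, hmono, hlim⟩ := ConstrainedCrit.exists_seq_critical (J := massMap ι) (g := g)
    (E := fun u => energy N p μ (ι u)) hgE hg_neg hLip hc (Real.sqrt_nonneg _) hR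
    (fun u h1 h2 h3 => energy_shell ι hN hp hp' hμ hc hshell h1 h2 h3)
    (fun b hb u h1 h2 h3 => radial_palaisSmale ι hmem hN hp hp' hμ hc hR₀ hg hg_neg hLip hb u h1 h2 h3)
    (fun b hb u h1 => radial_not_weakly_null ι hmem hN hp hp' hμ hR₀ hb u h1)
    (fun k => by
      obtain ⟨h, hcont, hh⟩ := exists_radial_sphere hN hp hp' hμ hc hr k
      -- The map is lifted through `ι` on the sphere only; elsewhere it takes the default value `0`,
      -- which plays no role.
      have hex : ∀ x, ∃ w : H, x ∈ Metric.sphere 0 1 → ι w = h x := fun x => by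
        by_cases hx : x ∈ Metric.sphere 0 1
        · obtain ⟨w, hw⟩ := hsurj (h x) (hh x hx).2.1
          exact ⟨w, fun _ => hw⟩
        · exact ⟨0, fun h => absurd h hx⟩
      choose w hw using hex
      refine ⟨w, ?_, fun x hx => ?_⟩
      · rw [ι.isometry.isEmbedding.isInducing.continuousOn_iff]
        exact hcont.congr fun x hx => hw x hx
      · obtain ⟨h1, _, h3, h4, h5⟩ := hh x hx
        have hm : ‖massMap ι (w x)‖ ^ 2 = c := by rw [massMap_apply, hw x hx, h3]
        refine ⟨ι.injective ?_, hm, (hlt _ hm).2 (by rwa [hw x hx]), by simp only [hw x hx]; exact h5⟩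
        rw [map_neg, hw x hx, hw (-x) (by simpa using hx), h1])
  have hcrit : ∀ j v, inner ℝ (g (u j)) v = ConstrainedCrit.multiplier (massMap ι) g (u j)
      * inner ℝ (massMap ι (u j)) (massMap ι v) := by
    intro j v
    have h := congrArg (fun w => inner ℝ w v) (hu j).2.2.2
    simp only [ConstrainedCrit.tgrad, inner_sub_left, real_inner_smul_left,
      ConstrainedCrit.inner_massGrad, inner_zero_left, sub_eq_zero] at h
    exact h
  have hlag : ∀ j, IsLagrangeMultiplier N p μ (ι (u j))
      (ConstrainedCrit.multiplier (massMap ι) g (u j)) := by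
    intro j v hv
    obtain ⟨w, rfl⟩ := hsurj v hv
    rw [(hgd (u j)).2 w, hcrit]
    rfl
  refine ⟨fun j => ι (u j), fun j => ConstrainedCrit.multiplier (massMap ι) g (u j),
    fun j => ⟨⟨⟨hmem _, (hu j).1, (hlt _ (hu j).1).1 (hu j).2.1⟩, (hgd (u j)).1,
      fun v hv h0 => ?_⟩, hlag j, (hu j).2.2.1, (hu j).1, ?_⟩, hmono, hlim⟩
  · rw [hlag j v hv, h0, mul_zero]
  -- The multiplier identity tested with `u_j` itself reads `I'(u_j)u_j = λ_j c`, and `I'(u_j)u_j ≤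
  -- 2I(u_j) < 0`.
  · have h1 := hcrit j (u j)
    rw [real_inner_self_eq_norm_sq, (hu j).1, hg] at h1
    have h2 := energyPairing_self_le hN hp hμ (ι (u j))
    have h3 : energy N p μ (ι (u j)) < 0 := (hu j).2.2.1
    by_contra hcon
    have h4 := mul_nonneg (not_lt.1 hcon) hc.le
    linarith

theorem theorem1p2 (N : ℕ) (hN : 5 ≤ N) (p : ℝ) (hp : 2 < p) (hp' : p < 2 + 4 / (N : ℝ)) :
    ∃ μ₀ : ℕ → ℝ, (∀ m, 1 ≤ m → 0 < μ₀ m) ∧ BddAbove (Set.range μ₀) ∧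
      ∀ μ c : ℝ, 0 < μ → 0 < c → c < cStar N p μ →
        ∃ (u : ℕ → H2 N) (l : ℕ → ℝ),
          (∀ m, 1 ≤ m → μ₀ m ≤ μ →
            (∀ j ∈ Set.Icc 1 m,
              IsCriticalPoint N p μ c (u j) ∧ IsLagrangeMultiplier N p μ (u j) (l j) ∧
                energy N p μ (u j) < 0 ∧ ‖(u j).fn‖ ^ 2 = c ∧ l j < 0) ∧
            (∀ i ∈ Set.Icc 1 m, ∀ j ∈ Set.Icc 1 m, i ≠ j → u i ≠ u j ∧ u i ≠ -u j)) ∧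
          ((∀ m, 1 ≤ m → μ₀ m ≤ μ) →
            Tendsto (fun m => energy N p μ (u m)) atTop (𝓝[<] 0)) := by
  -- The construction works for every `μ > 0`, so any bounded positive sequence of thresholds will
  -- do; the constant `1` is taken.
  refine ⟨fun _ => 1, fun _ _ => one_pos, ⟨1, by rintro _ ⟨m, rfl⟩; exact le_rfl⟩,
    fun μ c hμ hc hcs => ?_⟩
  obtain ⟨u, l, hu, hmono, hlim⟩ := exists_normalized_critical_points N hN p hp hp' μ c hμ hc hcs
  refine ⟨u, l, fun m _ _ => ⟨fun j _ => hu j, fun i _ j _ hij => ?_⟩, fun _ => ?_⟩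
  -- Strictly increasing energies separate the points, and evenness of the energy separates them
  -- from each other's negatives as well.
  · have hne : energy N p μ (u i) ≠ energy N p μ (u j) := fun h => hij (hmono.injective h)
    refine ⟨fun h => hne (by rw [h]), fun h => hne ?_⟩
    rw [h, energy_neg]
  · exact tendsto_nhdsWithin_iff.2 ⟨hlim, Eventually.of_forall fun j => (hu j).2.2.1⟩

end
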